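/- **Conventions.** Let $K=(K,\prec)$ be an abstract elementary class (AEC) with Löwenheim–Skolem number $\mathrm{LS}(K)$, and for an interval of cardinals $\mathcal F=[\lambda,\theta)$, where $\theta>\lambda$ is a cardinal or $\infty$, let $K_{\mathcal F}=\{M\in K:\|M\|\in\mathcal F\}$ and $K_\lambda=K_{[\lambda,\lambda^+)}$. A $K$-embedding $f:M\to N$ is an isomorphism onto some $f[M]\prec N$. Given triples $(a,M,N)$ with $M\prec N\in K$, $a\in N$, call $(a_1,M,N_1)$, $(a_2,M,N_2)$ atomically equivalent if there are $N\in K$ and $K$-embeddings $f_\ell:N_\ell\to N$ with $f_1\restriction M=f_2\restriction M$ and $f_1(a_1)=f_2(a_2)$; the Galois type $\mathrm{tp}(a/M;N)$ is the class of $(a,M,N)$ under the equivalence relation generated by atomic equivalence, and $S(M)$ is the set of these types over $M$. A type is nonalgebraic if it is $\mathrm{tp}(a/M;N)$ for some $a\in N\setminus M$. Restrictions $p\restriction M_0$ for $M_0\prec M$ are defined in the obvious way. $K$ is *$(\lambda,<\theta)$-tame* (for $1$-types) if for every $M\in K$ with $\mathrm{LS}(K)\le\|M\|<\theta$ and all distinct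 $p,q\in S(M)$ there is $M_0\prec M$ with $\|M_0\|\le\lambda$ and $p\restriction M_0\ne q\restriction M_0$. $K_{\mathcal F}$ has *amalgamation* if whenever $M_0\prec M_1$, $M_0\prec M_2$ are in $K_{\mathcal F}$ there are $N\in K_{\mathcal F}$ and $K$-embeddings $M_1\to N$, $M_2\to N$ over $M_0$. A *pre-$\mathcal F$-frame* is a triple $\mathfrak s=(K,\perp,S^{bs})$ where $K$ is an AEC with $\mathrm{LS}(K)\le\lambda$ and $K_\lambda\ne\emptyset$; $S^{bs}(M)$, for $M\in K_{\mathcal F}$, is a set of nonalgebraic types in $S(M)$ (the *basic* types); and $\perp(M_0,M_1,a,N)$ is a relation between $M_0\prec M_1\prec N$ in $K_{\mathcal F}$ and $a\in N$; such that * (invariance) $\perp$ and $S^{bs}$ are invariant under isomorphisms; * (monotonicity) if $\perp(M_0,M_1,a,N)$, $M_0\prec M_0'\prec M_1'\prec M_1\prec N'\prec N\prec N''$, $a\in N'$ and $N''\in K_{\mathcal F}$, then $\perp(M_0',M_1',a,N')$ and $\perp(M_0',M_1',a,N'')$; * if $\perp(M,M,a,N)$, then $\mathrm{tp}(a/M;N)\in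 S^{bs}(M)$. A type $p\in S(M_1)$ *does not fork over* $M_0\prec M_1$ if $p=\mathrm{tp}(a/M_1;N)$ for some $a,N$ with $\perp(M_0,M_1,a,N)$. A *good $\mathcal F$-frame* is a pre-$\mathcal F$-frame such that 1. $K_{\mathcal F}$ has amalgamation, joint embedding and no maximal models. 2. (bs-stability) $|S^{bs}(M)|\le\|M\|$ for all $M\in K_{\mathcal F}$. 3. (density) If $M\prec N$ are in $K_{\mathcal F}$ and $M\ne N$, there is $a\in N$ with $\mathrm{tp}(a/M;N)\in S^{bs}(M)$. 4. (existence) If $p\in S^{bs}(M)$ and $M\prec N\in K_{\mathcal F}$, some $q\in S^{bs}(N)$ extends $p$ and does not fork over $M$. 5. (uniqueness) If $p,q\in S(N)$ do not fork over $M$ and $p\restriction M=q\restriction M$, then $p=q$. 6. (symmetry) If $\perp(M_0,M_2,a_1,N)$, $a_2\in M_2$ and $\mathrm{tp}(a_2/M_0;N)\in S^{bs}(M_0)$, then there are $N'\succ N$ and $M_1$ containing $a_1$ with $\perp(M_0,M_1,a_2,N')$. 7. (local character) If $\delta$ is a limit ordinal, $\langle M_i\in K_{\mathcal F}:i\le\delta\rangle$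 is increasing continuous and $p\in S^{bs}(M_\delta)$, then $p$ does not fork over $M_i$ for some $i<\delta$. 8. (continuity) If $\delta$ is a limit ordinal, $\langle M_i\in K_{\mathcal F}:i\le\delta\rangle$ is increasing continuous and $p_i\in S^{bs}(M_i)$ ($i<\delta$) satisfy $p_i\restriction M_j=p_j$ for $j<i$, then some $p\in S^{bs}(M_\delta)$ satisfies $p\restriction M_i=p_i$ for all $i<\delta$. Moreover, if no $p_i$ forks over $M_0$, then every $p\in S(M_\delta)$ with $p\restriction M_i=p_i$ for all $i<\delta$ does not fork over $M_0$. 9. (transitivity) If $M_0\prec M_1\prec M_2$, $p\in S(M_2)$ does not fork over $M_1$ and $p\restriction M_1$ does not fork over $M_0$, then $p$ does not fork over $M_0$. A *good $\lambda$-frame* is a good $[\lambda,\lambda^+)$-frame. If $\mathfrak s=(K,\perp,S^{bs})$ is a good $\lambda$-frame, its extension $\mathfrak s_{\mathcal F}=(K,\perp_{\mathcal F},S^{bs}_{\mathcal F})$ is defined as follows. For $M_0\prec M_1\prec N$ in $K_{\mathcal F}$ and $a\in N$, $\perp_{\mathcal F}(M_0,M_1,a,N)$ holds iff there is $M_0'\prec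 M_0$ in $K_\lambda$ such that $\perp(M_0',M_1',a,N')$ for all $M_1',N'\in K_\lambda$ with $M_0'\prec M_1'\prec M_1$, $M_1'\prec N'\prec N$ and $a\in N'$. A type $p\in S(M)$, $M\in K_{\mathcal F}$, is in $S^{bs}_{\mathcal F}(M)$ iff $p=\mathrm{tp}(a/M;N)$ for some $N\succ M$ in $K_{\mathcal F}$ and $a\in N$ with $\perp_{\mathcal F}(M,M,a,N)$. **Corollary 5.13.** Let $\mathfrak s=(K,\perp,S^{bs})$ be a good $\lambda$-frame and let $\mathcal F=[\lambda,\theta)$, where $\theta>\lambda$ is a cardinal or $\infty$. Assume that $K_{\mathcal F}$ has amalgamation and that $K$ is $(\lambda,<\theta)$-tame for $1$-types. Then $\mathfrak s_{\mathcal F}$ is a good $\mathcal F$-frame. -/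

import Mathlib

open scoped FirstOrder

universe u

/-- An abstract elementary class in the vocabulary `L`. `Mem M` says that `M` is in the class `K`;
`Strong S`, for a substructure `S` of `N`, says `S ≺ N`. For substructures `S ≤ T` of a common
structure, `S ≺ T` is `Strong (S.comap T.subtype.toHom)`: the copy of `S` inside the structure `T`
is strong in `T`. Antisymmetry of `≺` is automatic. -/
structure AEC (L : FirstOrder.Language.{u, u}) where
  Mem : ∀ (M : Type u) [L.Structure M], Prop
  Strong : ∀ {N : Type u} [L.Structure N], L.Substructure N → Prop
  mem_of_strong : ∀ {N : Type u} [L.Structure N] (S : L.Substructure N),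
    Strong S → Mem S ∧ Mem N
  /-- closure of `K` under isomorphism -/
  mem_iso : ∀ {M N : Type u} [L.Structure M] [L.Structure N], (M ≃[L] N) → Mem M → Mem N
  /-- closure of `≺` under isomorphism -/
  strong_iso : ∀ {N N' : Type u} [L.Structure N] [L.Structure N'] (f : N ≃[L] N')
    (S : L.Substructure N), Strong S → Strong (S.map f.toHom)
  /-- `≺` is reflexive -/
  strong_top : ∀ {N : Type u} [L.Structure N], Mem N → Strong (⊤ : L.Substructure N)
  /-- `≺` is transitive -/
  strong_trans : ∀ {N : Type u} [L.Structure N] (S T : L.Substructure N), S ≤ T →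
    Strong (S.comap T.subtype.toHom) → Strong T → Strong S
  /-- coherence: `S ⊆ T ≺ N` and `S ≺ N` imply `S ≺ T` -/
  coherence : ∀ {N : Type u} [L.Structure N] (S T : L.Substructure N), S ≤ T →
    Strong S → Strong T → Strong (S.comap T.subtype.toHom)
  /-- the union `T` of a `≺`-increasing chain is in `K`, and is a `≺`-extension of every member of
  the chain (`U` is any structure, not assumed in `K`, that contains the chain, e.g. its union) -/
  chain_union : ∀ {U : Type u} [L.Structure U] (δ : Ordinal.{u}), Order.IsSuccLimit δ →
    ∀ C : Ordinal.{u} → L.Substructure U,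
    (∀ i j, i ≤ j → j < δ → C i ≤ C j ∧ Strong ((C i).comap (C j).subtype.toHom)) →
    ∀ T : L.Substructure U, (T : Set U) = ⋃ i < δ, (C i : Set U) →
      Mem T ∧ ∀ i < δ, Strong ((C i).comap T.subtype.toHom)
  /-- smoothness: if all members of the chain are `≺ N`, then so is the union -/
  chain_smooth : ∀ {N : Type u} [L.Structure N] (δ : Ordinal.{u}), Order.IsSuccLimit δ →
    ∀ C : Ordinal.{u} → L.Substructure N,
    (∀ i j, i ≤ j → j < δ → C i ≤ C j ∧ Strong ((C i).comap (C j).subtype.toHom)) →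
    (∀ i < δ, Strong (C i)) →
    ∀ T : L.Substructure N, (T : Set N) = ⋃ i < δ, (C i : Set N) → Strong T
  /-- the Löwenheim–Skolem–Tarski axiom -/
  exists_LS : ∃ μ : Cardinal.{u}, Cardinal.aleph0 ≤ μ ∧ L.card ≤ μ ∧
    ∀ {N : Type u} [L.Structure N], Mem N → ∀ A : Set N,
      ∃ S : L.Substructure N, A ⊆ S ∧ Strong S ∧ Cardinal.mk S ≤ Cardinal.mk A + μ

namespace AEC

variable {L : FirstOrder.Language.{u, u}} (K : AEC.{u} L)

/-- The Löwenheim–Skolem number `LS(K)`. -/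
noncomputable def LS : Cardinal.{u} :=
  sInf {μ : Cardinal.{u} | Cardinal.aleph0 ≤ μ ∧ L.card ≤ μ ∧
    ∀ {N : Type u} [L.Structure N], K.Mem N → ∀ A : Set N,
      ∃ S : L.Substructure N, A ⊆ S ∧ K.Strong S ∧ Cardinal.mk S ≤ Cardinal.mk A + μ}

/-- `S ≺ T` for substructures of a common structure. -/
def Le {U : Type u} [L.Structure U] (S T : L.Substructure U) : Prop :=
  S ≤ T ∧ K.Strong (S.comap T.subtype.toHom)

/-- `f` is a `K`-embedding: an isomorphism onto some `S ≺ N`. -/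
def StrongEmb {M N : Type u} [L.Structure M] [L.Structure N] (f : M ↪[L] N) : Prop :=
  K.Strong f.toHom.range

/-- `M ∈ K_F` for the interval of cardinals `F = [lam, θ)`; `θ = ⊤` stands for `∞`. -/
def InF (lam : Cardinal.{u}) (θ : WithTop Cardinal.{u}) (M : Type u) [L.Structure M] : Prop :=
  K.Mem M ∧ lam ≤ Cardinal.mk M ∧ ((Cardinal.mk M : Cardinal.{u}) : WithTop Cardinal.{u}) < θ

/-- `K_F` has amalgamation, `F = [lam, θ)`. -/
def Amalgamation (lam : Cardinal.{u}) (θ : WithTop Cardinal.{u}) : Prop :=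
  ∀ (M₀ M₁ M₂ : Type u) [L.Structure M₀] [L.Structure M₁] [L.Structure M₂]
    (f₁ : M₀ ↪[L] M₁) (f₂ : M₀ ↪[L] M₂),
    K.InF lam θ M₀ → K.InF lam θ M₁ → K.InF lam θ M₂ → K.StrongEmb f₁ → K.StrongEmb f₂ →
    ∃ (N : Type u) (_ : L.Structure N) (g₁ : M₁ ↪[L] N) (g₂ : M₂ ↪[L] N),
      K.InF lam θ N ∧ K.StrongEmb g₁ ∧ K.StrongEmb g₂ ∧ ∀ x, g₁ (f₁ x) = g₂ (f₂ x)

/-- `K_F` has joint embedding, `F = [lam, θ)`. -/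
def JointEmbedding (lam : Cardinal.{u}) (θ : WithTop Cardinal.{u}) : Prop :=
  ∀ (M₁ M₂ : Type u) [L.Structure M₁] [L.Structure M₂], K.InF lam θ M₁ → K.InF lam θ M₂ →
    ∃ (N : Type u) (_ : L.Structure N) (g₁ : M₁ ↪[L] N) (g₂ : M₂ ↪[L] N),
      K.InF lam θ N ∧ K.StrongEmb g₁ ∧ K.StrongEmb g₂

/-- `K_F` has no maximal models, `F = [lam, θ)`. -/
def NoMaximalModels (lam : Cardinal.{u}) (θ : WithTop Cardinal.{u}) : Prop :=
  ∀ (M : Type u) [L.Structure M], K.InF lam θ M →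
    ∃ (N : Type u) (_ : L.Structure N) (g : M ↪[L] N),
      K.InF lam θ N ∧ K.StrongEmb g ∧ ¬ Function.Surjective g

section helpers

variable {K}

theorem strongEmb_subtype {N : Type u} [L.Structure N] {S : L.Substructure N}
    (hS : K.Strong S) : K.StrongEmb S.subtype := by
  have h : S.subtype.toHom.range = S := FirstOrder.Language.Substructure.range_subtype S
  unfold StrongEmb
  rw [h]
  exact hS

theorem strongEmb_inclusion {N : Type u} [L.Structure N] {S T : L.Substructure N}
    (hST : S ≤ T) (hS : K.Strong S) (hT : K.Strong T) :
    K.StrongEmb (FirstOrder.Language.Substructure.inclusion hST) := by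
  have h : (FirstOrder.Language.Substructure.inclusion hST).toHom.range = S.comap T.subtype.toHom := by
    ext x
    constructor
    · rintro ⟨y, rfl⟩
      exact y.2
    · intro hx
      exact ⟨⟨x.1, hx⟩, rfl⟩
  unfold StrongEmb
  rw [h]
  exact K.coherence S T hST hS hT

theorem strongEmb_comp {M N P : Type u} [L.Structure M] [L.Structure N] [L.Structure P]
    {g : N ↪[L] P} {f : M ↪[L] N} (hg : K.StrongEmb g) (hf : K.StrongEmb f) :
    K.StrongEmb (g.comp f) := by
  unfold StrongEmb at *
  have hle : (g.comp f).toHom.range ≤ g.toHom.range := by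
    rintro _ ⟨y, rfl⟩
    exact ⟨f y, rfl⟩
  refine K.strong_trans _ _ hle ?_ hg
  have h := K.strong_iso g.equivRange _ hf
  convert h using 1
  ext x
  constructor
  · rintro ⟨y, hy⟩
    exact ⟨f y, ⟨y, rfl⟩, Subtype.ext hy⟩
  · rintro ⟨_, ⟨y, rfl⟩, hy⟩
    exact ⟨y, congrArg Subtype.val hy⟩

end helpers

/-- A triple `(a, M, N)` with `M ≺ N` and `a ∈ N`; the inclusion of `M` is any `K`-embedding. -/
structure PointedExt (M : Type u) [L.Structure M] where
  carrier : Type u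
  [str : L.Structure carrier]
  emb : M ↪[L] carrier
  strong : K.StrongEmb emb
  pt : carrier

attribute [instance] PointedExt.str

/-- Atomic equivalence of triples over `M`: both embed over `M` in one model of `K`, with the
same image of the distinguished points. -/
def AtEq (M : Type u) [L.Structure M] (x y : K.PointedExt M) : Prop :=
  ∃ (N : Type u) (_ : L.Structure N) (g₁ : x.carrier ↪[L] N) (g₂ : y.carrier ↪[L] N),
    K.StrongEmb g₁ ∧ K.StrongEmb g₂ ∧ (∀ m, g₁ (x.emb m) = g₂ (y.emb m)) ∧ g₁ x.pt = g₂ y.pt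

/-- The set `S(M)` of Galois types over `M` of sequences of length one: triples up to the
equivalence relation generated by atomic equivalence. -/
def GType (M : Type u) [L.Structure M] : Type (u + 1) := Quot (K.AtEq M)

/-- The Galois type of `a ∈ N` over `M`, along a `K`-embedding of `M` in `N`. -/
def gtp {M N : Type u} [L.Structure M] [L.Structure N] (i : M ↪[L] N) (hi : K.StrongEmb i)
    (a : N) : K.GType M :=
  Quot.mk _ { carrier := N, emb := i, strong := hi, pt := a }

/-- `tp(a / S; N)` for `S ≺ N`. -/
def tp {N : Type u} [L.Structure N] (S : L.Substructure N) (hS : K.Strong S) (a : N) :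
    K.GType S :=
  K.gtp S.subtype (strongEmb_subtype hS) a

variable {K}

/-- Restriction of a Galois type along a `K`-embedding `f : M₀ → M`. -/
def GType.restrict {M₀ M : Type u} [L.Structure M₀] [L.Structure M] (f : M₀ ↪[L] M)
    (hf : K.StrongEmb f) : K.GType M → K.GType M₀ :=
  Quot.map
    (fun x => { carrier := x.carrier, emb := x.emb.comp f,
                strong := strongEmb_comp x.strong hf, pt := x.pt })
    (by
      rintro x y ⟨N, iN, g₁, g₂, h₁, h₂, h, hp⟩
      exact ⟨N, iN, g₁, g₂, h₁, h₂, fun m => h (f m), hp⟩)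

/-- `p ↾ S` for `S ≺ M`. -/
def GType.res {M : Type u} [L.Structure M] (p : K.GType M) (S : L.Substructure M)
    (hS : K.Strong S) : K.GType S :=
  p.restrict S.subtype (strongEmb_subtype hS)

/-- `p ↾ S` for a type `p` over `T`, where `S ≤ T` and `S, T ≺ N`. -/
def GType.resLE {N : Type u} [L.Structure N] {S T : L.Substructure N} (p : K.GType T)
    (hST : S ≤ T) (hS : K.Strong S) (hT : K.Strong T) : K.GType S :=
  p.restrict (FirstOrder.Language.Substructure.inclusion hST) (strongEmb_inclusion hST hS hT)

/-- `p ∈ Sⁿᵃ(M)`: `p` is the type of some `a ∈ N \ M`. -/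
def GType.Nonalgebraic {M : Type u} [L.Structure M] (p : K.GType M) : Prop :=
  ∃ x : K.PointedExt M, (Quot.mk _ x : K.GType M) = p ∧ x.pt ∉ x.emb.toHom.range

variable (K)

/-- `K` is `(lam, <θ)`-tame (for types of length one). -/
def Tame (lam : Cardinal.{u}) (θ : WithTop Cardinal.{u}) : Prop :=
  ∀ (M : Type u) [L.Structure M], K.InF K.LS θ M → ∀ p q : K.GType M, p ≠ q →
    ∃ (S : L.Substructure M) (hS : K.Strong S), Cardinal.mk S ≤ lam ∧ p.res S hS ≠ q.res S hS

/-- `⟨C i : i ≤ δ⟩` is an increasing continuous chain of members of `K_F` with last member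
`C δ = N`. (All `C i` are `≺ N`, so by coherence `C i ≺ C j` for `i ≤ j`.) -/
structure IsChain (lam : Cardinal.{u}) (θ : WithTop Cardinal.{u}) {N : Type u} [L.Structure N]
    (δ : Ordinal.{u}) (C : Ordinal.{u} → L.Substructure N) : Prop where
  inF : ∀ i ≤ δ, K.InF lam θ (C i)
  strong : ∀ i ≤ δ, K.Strong (C i)
  mono : ∀ i j, i ≤ j → j ≤ δ → C i ≤ C j
  cont : ∀ i ≤ δ, Order.IsSuccLimit i → (C i : Set N) = ⋃ j < i, (C j : Set N)
  last : C δ = ⊤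

/-- The data of a frame for types of single elements: the basic types, and the relation
`nf M₀ M₁ a` (in `N`), "`a` does not fork from `M₁` over `M₀` in `N`". -/
structure Frame where
  bs : ∀ (M : Type u) [L.Structure M], Set (K.GType M)
  nf : ∀ {N : Type u} [L.Structure N], L.Substructure N → L.Substructure N → N → Prop

namespace Frame

variable {K}

/-- The type `p` over `M` does not fork over `M₀`. -/
def DoesNotFork (s : K.Frame) {M : Type u} [L.Structure M] (p : K.GType M)
    (M₀ : L.Substructure M) : Prop :=
  ∃ x : K.PointedExt M, (Quot.mk _ x : K.GType M) = p ∧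
    s.nf (M₀.map x.emb.toHom) x.emb.toHom.range x.pt

/-- `s` is a pre-`F`-frame, `F = [lam, θ)`. -/
structure IsPreFrame (s : K.Frame) (lam : Cardinal.{u}) (θ : WithTop Cardinal.{u}) : Prop where
  LS_le : K.LS ≤ lam
  exists_model : ∃ (M : Type u) (_ : L.Structure M), K.Mem M ∧ Cardinal.mk M = lam
  bs_dom : ∀ (M : Type u) [L.Structure M], ∀ p ∈ s.bs M, K.InF lam θ M ∧ p.Nonalgebraic
  nf_dom : ∀ {N : Type u} [L.Structure N] (M₀ M₁ : L.Substructure N) (a : N), s.nf M₀ M₁ a →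
    K.InF lam θ M₀ ∧ K.InF lam θ M₁ ∧ K.InF lam θ N ∧ K.Le M₀ M₁ ∧ K.Strong M₁
  /-- invariance of nonforking -/
  nf_iso : ∀ {N N' : Type u} [L.Structure N] [L.Structure N'] (f : N ≃[L] N')
    (M₀ M₁ : L.Substructure N) (a : N), s.nf M₀ M₁ a →
    s.nf (M₀.map f.toHom) (M₁.map f.toHom) (f a)
  /-- invariance of basic types; `g` is the restriction of `f : N ≅ N'` to `M ≅ M'` -/
  bs_iso : ∀ {M M' N N' : Type u} [L.Structure M] [L.Structure M'] [L.Structure N]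
    [L.Structure N'] (i : M ↪[L] N) (hi : K.StrongEmb i) (i' : M' ↪[L] N')
    (hi' : K.StrongEmb i') (g : M ≃[L] M') (f : N ≃[L] N'), (∀ m, f (i m) = i' (g m)) →
    ∀ a : N, K.gtp i hi a ∈ s.bs M → K.gtp i' hi' (f a) ∈ s.bs M'
  /-- monotonicity, passing to a smaller ambient model `N' ≺ N` -/
  mono_down : ∀ {N : Type u} [L.Structure N] (M₀ M₀' M₁' M₁ N' : L.Substructure N) (a : N),
    s.nf M₀ M₁ a → K.Le M₀ M₀' → K.Le M₀' M₁' → K.Le M₁' M₁ → K.Le M₁ N' → K.Strong N' →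
    ∀ ha : a ∈ N', s.nf (M₀'.comap N'.subtype.toHom) (M₁'.comap N'.subtype.toHom)
      (⟨a, ha⟩ : N')
  /-- monotonicity, passing to a larger ambient model `N'' ≻ N` -/
  mono_up : ∀ {N N'' : Type u} [L.Structure N] [L.Structure N''] (M₀ M₀' M₁' M₁ : L.Substructure N)
    (a : N) (j : N ↪[L] N''), s.nf M₀ M₁ a → K.Le M₀ M₀' → K.Le M₀' M₁' → K.Le M₁' M₁ →
    K.StrongEmb j → K.InF lam θ N'' →
    s.nf (M₀'.map j.toHom) (M₁'.map j.toHom) (j a)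
  /-- nonforking types are basic -/
  bs_of_nf : ∀ {N : Type u} [L.Structure N] (M : L.Substructure N) (hM : K.Strong M) (a : N),
    s.nf M M a → K.tp M hM a ∈ s.bs M

/-- `s` is a good `F`-frame, `F = [lam, θ)`. -/
structure IsGood (s : K.Frame) (lam : Cardinal.{u}) (θ : WithTop Cardinal.{u}) : Prop
    extends s.IsPreFrame lam θ where
  amalgamation : K.Amalgamation lam θ
  jointEmbedding : K.JointEmbedding lam θ
  noMaximalModels : K.NoMaximalModels lam θ
  bs_stability : ∀ (M : Type u) [L.Structure M], K.InF lam θ M →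
    Cardinal.mk (s.bs M) ≤ Cardinal.lift.{u + 1} (Cardinal.mk M)
  density : ∀ {N : Type u} [L.Structure N] (M : L.Substructure N) (hM : K.Strong M),
    K.InF lam θ M → K.InF lam θ N → M ≠ ⊤ → ∃ a : N, K.tp M hM a ∈ s.bs M
  existence : ∀ {N : Type u} [L.Structure N] (M : L.Substructure N) (hM : K.Strong M),
    K.InF lam θ N → ∀ p ∈ s.bs M, ∃ q ∈ s.bs N, s.DoesNotFork q M ∧ q.res M hM = p
  uniqueness : ∀ {N : Type u} [L.Structure N] (M : L.Substructure N) (hM : K.Strong M)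
    (p q : K.GType N), s.DoesNotFork p M → s.DoesNotFork q M → p.res M hM = q.res M hM → p = q
  symmetry : ∀ {N : Type u} [L.Structure N] (M₀ M₂ : L.Substructure N) (hM₀ : K.Strong M₀)
    (a₁ a₂ : N), s.nf M₀ M₂ a₁ → a₂ ∈ M₂ → K.tp M₀ hM₀ a₂ ∈ s.bs M₀ →
    ∃ (N' : Type u) (_ : L.Structure N') (j : N ↪[L] N') (M₁ : L.Substructure N'),
      K.StrongEmb j ∧ j a₁ ∈ M₁ ∧ s.nf (M₀.map j.toHom) M₁ (j a₂)
  localCharacter : ∀ {N : Type u} [L.Structure N] (δ : Ordinal.{u}), Order.IsSuccLimit δ →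
    ∀ C : Ordinal.{u} → L.Substructure N, K.IsChain lam θ δ C →
    ∀ p ∈ s.bs N, ∃ i < δ, s.DoesNotFork p (C i)
  /-- The coherent basic types `p i` have a common basic extension `q` over the union `N` of the
  chain, and if all `p i` do not fork over `C 0`, neither does any common extension of them. -/
  continuity : ∀ {N : Type u} [L.Structure N] (δ : Ordinal.{u}), Order.IsSuccLimit δ →
    ∀ (C : Ordinal.{u} → L.Substructure N) (hC : K.IsChain lam θ δ C)
    (p : ∀ i : Ordinal.{u}, K.GType (C i)), (∀ i < δ, p i ∈ s.bs (C i)) →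
    (∀ (i j : Ordinal.{u}) (hji : j < i) (hi : i < δ),
      (p i).resLE (hC.mono j i hji.le hi.le) (hC.strong j (hji.le.trans hi.le))
        (hC.strong i hi.le) = p j) →
    (∃ q ∈ s.bs N, ∀ (i : Ordinal.{u}) (hi : i < δ), q.res (C i) (hC.strong i hi.le) = p i) ∧
      ((∀ i < δ, s.DoesNotFork (p i) ((C 0).comap (C i).subtype.toHom)) →
        ∀ q : K.GType N,
          (∀ (i : Ordinal.{u}) (hi : i < δ), q.res (C i) (hC.strong i hi.le) = p i) →
          s.DoesNotFork q (C 0))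
  transitivity : ∀ {N : Type u} [L.Structure N] (M₀ M₁ : L.Substructure N) (hM₁ : K.Strong M₁),
    K.Le M₀ M₁ → ∀ p : K.GType N, s.DoesNotFork p M₁ →
    s.DoesNotFork (p.res M₁ hM₁) (M₀.comap M₁.subtype.toHom) → s.DoesNotFork p M₀

/-- The nonforking relation of the extension of `s` (a frame on models of size `lam`) to
models with sizes in `F = [lam, θ)`. -/
def extendNF (s : K.Frame) (lam : Cardinal.{u}) (θ : WithTop Cardinal.{u}) {N : Type u}
    [L.Structure N] (M₀ M₁ : L.Substructure N) (a : N) : Prop :=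
  K.InF lam θ M₀ ∧ K.InF lam θ M₁ ∧ K.InF lam θ N ∧ K.Le M₀ M₁ ∧ K.Strong M₁ ∧
  ∃ M₀' : L.Substructure N, K.Le M₀' M₀ ∧ Cardinal.mk M₀' = lam ∧
    ∀ M₁' N' : L.Substructure N, K.Le M₀' M₁' → K.Le M₁' M₁ → K.Le M₁' N' → K.Strong N' →
      Cardinal.mk M₁' = lam → Cardinal.mk N' = lam → ∀ ha : a ∈ N',
      s.nf (M₀'.comap N'.subtype.toHom) (M₁'.comap N'.subtype.toHom) (⟨a, ha⟩ : N')

/-- The extension `s_F` of `s` to `F = [lam, θ)`. -/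
def extend (s : K.Frame) (lam : Cardinal.{u}) (θ : WithTop Cardinal.{u}) : K.Frame where
  bs := fun M _ => {p | ∃ x : K.PointedExt M, (Quot.mk _ x : K.GType M) = p ∧
    s.extendNF lam θ x.emb.toHom.range x.emb.toHom.range x.pt}
  nf := fun M₀ M₁ a => s.extendNF lam θ M₀ M₁ a

end Frame

end AEC

/-!
Call a type `p` over a model `X` in `K_F` free over a submodel `A` of size `lam` if its restrictions
to all submodels of size `lam` containing `A` do not fork over `A` (`Ctx.Fr`). The nonforking
relation of the extended frame says that the type in question is free over some `A` inside the base
(`Ctx.extendNF_iff`, `Ctx.extend_dnf_iff`), so that all axioms become statements about free types.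

*Uniqueness* follows from tameness and uniqueness in size `lam` (`Ctx.Fr.uniq`), and *transitivity*
from transitivity in size `lam` (`Ctx.Fr.trans`). For *local character*, *continuity* and *density*
one works inside a model of size `lam` that contains the relevant parameters and in which the given
chain of models induces a chain of models of size `lam`; such models come from Skolem functions for
chains of submodels (`exists_skolem_chain`, `Ctx.exists_small_chain`). A coherent sequence of basic
types is based on a single member of the chain (`Ctx.exists_uniform_base`); otherwise a subsequence
of length `ω` could be reflected to size `lam`, contradicting continuity and local character there.
*Existence* (`Ctx.exists_fr`) is by induction on the size of the model: free extensions to the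
members of a filtration are coherent by uniqueness, and a direct limit realizes them all.
*Stability* follows by counting along a filtration.

*Symmetry* (`Ctx.symAt`) is the main point, and it is proved by induction on the size `μ` of the
models. For `μ = lam` it is the axiom of the given frame (`Ctx.symAt_lam`). By uniqueness it is
enough to find, for two basic types over a model of size `lam` inside `X`, realizations `a` and `b`
of their free extensions to `X` such that `a` is free from a model containing `X` and `b`, and `b`
from a model containing `X` and `a` (`Ctx.exists_free_pair`). Write `X` as the union of a continuous
chain of models `C i` of sizes below `μ`. A tower of models `X_i ≤ N_i`, with `C i ≤ X_i` and one
element `b` of all `N_i` that is free from all `X_i`, is built such that `X_{i+1}` dominates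
`N_{i+1}`: every realization `a` of the prescribed type that lies in a model from which `b` is free,
and is free from `X_{i+1}`, is free from `N_{i+1}`. If `W` and `X'` are the unions of the `N_i` and
the `X_i`, let `a` be free from `X'`, and amalgamate freely so that `b` stays free from a model
containing `X'` and `a`. By domination `a` is free from all `N_{i+1}`, and by continuity from `W`,
which contains `X` and `b`.

Dominated extensions of models of size `χ` exist (`Ctx.exists_dominated`): otherwise there is a
tower of length `χ⁺` of pairs `X_i ≤ N_i` of models of size `χ` and elements `a_i` of `X_{i+1}`,
free from `X_i` but not from `N_i`. That is impossible (`Ctx.FreeSeq.exists_free`): the models `X_i`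
and the `a_i` form a free sequence, and every extension `R` of the union `X` of the `X_i` extends
further to a model `N` on which the sequence stays free, in the sense that the small submodels `S`
of `N` closed under a suitable operation satisfy `S ∩ X = X_i` for some `i`, with `a_i` free from
`S`. To get `N` one builds an increasing chain of extensions of `R`, with submodels on which the
sequence stays free. As long as such a submodel is not the whole extension, by density it can be
enlarged by an element realizing a free type; the enlargement (`Ctx.StaysFree.exists_extension`)
pushes the `a_i` along and uses symmetry in size `χ < μ`, and the property survives unions
(`Ctx.StaysFree.union`). The chain has length `χ⁺⁺` and consists of models of size `χ⁺`, so that at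
some stage the submodel already contains all elements of the extension that belong to later
submodels (`Ctx.exists_stable_index`). By construction it is then the whole extension.
-/

universe v

namespace AEC

open Cardinal

variable {L : FirstOrder.Language.{u, u}} {K : AEC.{u} L}

/-! ### Bundled strong embeddings -/

/-- A `K`-embedding, bundled with the proof that its image is a strong submodel. -/
structure SEmb (K : AEC.{u} L) (M N : Type u) [L.Structure M] [L.Structure N] where
  emb : M ↪[L] N
  strong : K.StrongEmb emb

namespace SEmb

variable {M N P Q : Type u} [L.Structure M] [L.Structure N] [L.Structure P] [L.Structure Q]

instance : FunLike (SEmb K M N) M N where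
  coe f := f.emb
  coe_injective := by
    rintro ⟨f, hf⟩ ⟨g, hg⟩ h
    have : f = g := DFunLike.coe_injective h
    subst this
    rfl

@[ext] theorem ext {f g : SEmb K M N} (h : ∀ x, f x = g x) : f = g := DFunLike.ext _ _ h

theorem injective (f : SEmb K M N) : Function.Injective f := f.emb.injective

/-- The image of a strong embedding, as a substructure. -/
abbrev range (f : SEmb K M N) : L.Substructure N := f.emb.toHom.range

theorem strong_range (f : SEmb K M N) : K.Strong f.range := f.strong

theorem mem_right (f : SEmb K M N) : K.Mem N := (K.mem_of_strong _ f.strong).2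

theorem mem_left (f : SEmb K M N) : K.Mem M :=
  K.mem_iso f.emb.equivRange.symm (K.mem_of_strong _ f.strong).1

/-- Composition of strong embeddings. -/
def comp (g : SEmb K N P) (f : SEmb K M N) : SEmb K M P :=
  ⟨g.emb.comp f.emb, strongEmb_comp g.strong f.strong⟩

@[simp] theorem comp_apply (g : SEmb K N P) (f : SEmb K M N) (x : M) : g.comp f x = g (f x) := rfl

theorem comp_assoc (h : SEmb K P Q) (g : SEmb K N P) (f : SEmb K M N) :
    (h.comp g).comp f = h.comp (g.comp f) := rfl

/-- An isomorphism of members of `K` is a strong embedding. -/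
def ofEquiv (f : M ≃[L] N) (h : K.Mem M) : SEmb K M N :=
  ⟨f.toEmbedding, by
    have h1 : f.toEmbedding.toHom.range = ⊤ := by
      ext x
      simp only [FirstOrder.Language.Substructure.mem_top, iff_true]
      exact ⟨f.symm x, f.apply_symm_apply x⟩
    unfold StrongEmb
    rw [h1]
    exact K.strong_top (K.mem_iso f h)⟩

/-- The identity. -/
def refl (h : K.Mem M) : SEmb K M M := ofEquiv (FirstOrder.Language.Equiv.refl L M) h

@[simp] theorem refl_apply (h : K.Mem M) (x : M) : refl h x = x := rfl

@[simp] theorem comp_refl (f : SEmb K M N) (h : K.Mem M) : f.comp (refl h) = f := rfl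

/-- The inclusion of a strong submodel. -/
def ofSub {S : L.Substructure N} (hS : K.Strong S) : SEmb K S N :=
  ⟨S.subtype, strongEmb_subtype hS⟩

@[simp] theorem range_ofSub {S : L.Substructure N} (hS : K.Strong S) : (ofSub hS).range = S :=
  FirstOrder.Language.Substructure.range_subtype S

/-- The inclusion between strong submodels of one model. -/
def incl {S T : L.Substructure N} (h : S ≤ T) (hS : K.Strong S) (hT : K.Strong T) : SEmb K S T :=
  ⟨FirstOrder.Language.Substructure.inclusion h, strongEmb_inclusion h hS hT⟩

/-- Corestriction of a strong embedding to a strong submodel containing its image. -/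
def lift (f : SEmb K M N) {S : L.Substructure N} (hS : K.Strong S) (h : ∀ x, f x ∈ S) :
    SEmb K M S :=
  ⟨f.emb.codRestrict S h, by
    have h1 : (f.emb.codRestrict S h).toHom.range = f.range.comap S.subtype.toHom := by
      ext x
      constructor
      · rintro ⟨y, rfl⟩
        exact ⟨y, rfl⟩
      · rintro ⟨y, hy⟩
        exact ⟨y, Subtype.ext hy⟩
    unfold StrongEmb
    rw [h1]
    refine K.coherence _ _ ?_ f.strong hS
    rintro _ ⟨y, rfl⟩
    exact h y⟩

@[simp] theorem ofSub_comp_lift (f : SEmb K M N) {S : L.Substructure N} (hS : K.Strong S)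
    (h : ∀ x, f x ∈ S) : (ofSub hS).comp (f.lift hS h) = f := rfl

/-- A strong embedding whose image lies in the image of another one factors through it. -/
theorem exists_factor (g : SEmb K P N) (f : SEmb K M N) (h : ∀ x, f x ∈ g.range) :
    ∃ k : SEmb K M P, g.comp k = f := by
  refine ⟨(ofEquiv g.emb.equivRange.symm (K.mem_of_strong _ g.strong).1).comp
    (f.lift g.strong h), ?_⟩
  ext x
  have h1 : ((g.emb.equivRange (g.emb.equivRange.symm (f.lift g.strong h x)) : g.range) : N)
      = f x := by
    rw [g.emb.equivRange.apply_symm_apply]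
    rfl
  exact h1

theorem strong_map (f : SEmb K M N) {S : L.Substructure M} (hS : K.Strong S) :
    K.Strong (S.map f.emb.toHom) := by
  have h := (f.comp (ofSub hS)).strong_range
  convert h using 1
  ext x
  constructor
  · rintro ⟨y, hy, rfl⟩
    exact ⟨⟨y, hy⟩, rfl⟩
  · rintro ⟨y, rfl⟩
    exact ⟨y, y.2, rfl⟩

theorem strong_comap (f : SEmb K M N) {S : L.Substructure N} (hS : K.Strong S) (h : S ≤ f.range) :
    K.Strong (S.comap f.emb.toHom) := by
  obtain ⟨k, hk⟩ := exists_factor f (ofSub hS) (fun x => h x.2)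
  have h1 := k.strong_range
  convert h1 using 1
  ext x
  constructor
  · intro hx
    refine ⟨⟨f x, hx⟩, f.injective ?_⟩
    exact DFunLike.congr_fun hk _
  · rintro ⟨y, rfl⟩
    have : f (k y) = y := DFunLike.congr_fun hk y
    exact (this ▸ y.2 : f (k y) ∈ S)

theorem mk_range (f : SEmb K M N) : #f.range = #M :=
  (Cardinal.mk_congr f.emb.equivRange.toEquiv).symm

theorem mk_le (f : SEmb K M N) : #M ≤ #N := Cardinal.mk_le_of_injective f.injective

theorem range_comp (g : SEmb K N P) (f : SEmb K M N) :
    (g.comp f).range = f.range.map g.emb.toHom := by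
  ext x
  constructor
  · rintro ⟨y, rfl⟩
    exact ⟨f y, ⟨y, rfl⟩, rfl⟩
  · rintro ⟨_, ⟨y, rfl⟩, rfl⟩
    exact ⟨y, rfl⟩

end SEmb

section basics

variable {N : Type u} [L.Structure N]

theorem Strong.mem {S : L.Substructure N} (h : K.Strong S) : K.Mem S := (K.mem_of_strong S h).1

theorem Strong.le_iff {S T : L.Substructure N} (hS : K.Strong S) (hT : K.Strong T) :
    K.Le S T ↔ S ≤ T :=
  ⟨fun h => h.1, fun h => ⟨h, K.coherence S T h hS hT⟩⟩

theorem Le.strong {S T : L.Substructure N} (h : K.Le S T) (hT : K.Strong T) : K.Strong S :=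
  K.strong_trans S T h.1 h.2 hT

theorem LS_spec (K : AEC.{u} L) : ℵ₀ ≤ K.LS ∧ L.card ≤ K.LS ∧
    ∀ {N : Type u} [L.Structure N], K.Mem N → ∀ A : Set N,
      ∃ S : L.Substructure N, A ⊆ S ∧ K.Strong S ∧ #S ≤ #A + K.LS :=
  csInf_mem (s := {μ : Cardinal.{u} | ℵ₀ ≤ μ ∧ L.card ≤ μ ∧
    ∀ {N : Type u} [L.Structure N], K.Mem N → ∀ A : Set N,
      ∃ S : L.Substructure N, A ⊆ S ∧ K.Strong S ∧ #S ≤ #A + μ}) K.exists_LS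

theorem exists_strong_le (hN : K.Mem N) {κ : Cardinal.{u}} (hκ : K.LS ≤ κ) (A : Set N)
    (hA : #A ≤ κ) : ∃ S : L.Substructure N, A ⊆ S ∧ K.Strong S ∧ #S ≤ κ := by
  obtain ⟨S, h1, h2, h3⟩ := (LS_spec K).2.2 hN A
  exact ⟨S, h1, h2, h3.trans (Cardinal.add_le_of_le ((LS_spec K).1.trans hκ) hA hκ)⟩

/-- Downward Löwenheim–Skolem, with a prescribed size. -/
theorem exists_strong_card (hN : K.Mem N) {κ : Cardinal.{u}} (hκ : K.LS ≤ κ) (A : Set N)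
    (hA : #A ≤ κ) (hκN : κ ≤ #N) : ∃ S : L.Substructure N, A ⊆ S ∧ K.Strong S ∧ #S = κ := by
  obtain ⟨B, hB⟩ : ∃ B : Set N, #B = κ := Cardinal.le_mk_iff_exists_set.1 hκN
  have hAB : #(A ∪ B : Set N) ≤ κ := (Cardinal.mk_union_le _ _).trans
    (Cardinal.add_le_of_le ((LS_spec K).1.trans hκ) hA hB.le)
  obtain ⟨S, h1, h2, h3⟩ := exists_strong_le hN hκ _ hAB
  refine ⟨S, Set.subset_union_left.trans h1, h2, le_antisymm h3 ?_⟩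
  rw [← hB]
  exact Cardinal.mk_le_mk_of_subset (Set.subset_union_right.trans h1)

end basics

/-! ### Closed sets -/

section closed

variable {N : Type u}

/-- `Y` is closed under the finitary set-valued operation `H`. -/
def Cl (H : Finset N → Set N) (Y : Set N) : Prop := ∀ s : Finset N, (s : Set N) ⊆ Y → H s ⊆ Y

theorem Cl.mono {H H' : Finset N → Set N} (h : ∀ s, H' s ⊆ H s) {Y : Set N} (hY : Cl H Y) :
    Cl H' Y := fun s hs => (h s).trans (hY s hs)

/-- A finite subset of a directed union lies in one of the sets. -/
theorem exists_subset_of_directed {α : Type u} {ι : Type*} [Nonempty ι] {Y : ι → Set α}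
    (hd : Directed (· ⊆ ·) Y) (s : Finset α) (hs : (s : Set α) ⊆ ⋃ i, Y i) :
    ∃ i, (s : Set α) ⊆ Y i := by
  classical
  induction s using Finset.induction_on with
  | empty => exact ⟨Classical.arbitrary ι, by simp⟩
  | insert a s ha ih =>
    rw [Finset.coe_insert, Set.insert_subset_iff] at hs
    obtain ⟨i, hi⟩ := ih hs.2
    obtain ⟨j, hj⟩ := Set.mem_iUnion.1 hs.1
    obtain ⟨k, hik, hjk⟩ := hd i j
    exact ⟨k, by
      rw [Finset.coe_insert, Set.insert_subset_iff]
      exact ⟨hjk hj, hi.trans hik⟩⟩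

theorem Cl.iUnion_directed {H : Finset N → Set N} {ι : Type*} [Nonempty ι] {Y : ι → Set N}
    (hd : Directed (· ⊆ ·) Y) (hY : ∀ i, Cl H (Y i)) : Cl H (⋃ i, Y i) := by
  intro s hs
  obtain ⟨i, hi⟩ := exists_subset_of_directed hd s hs
  exact (hY i s hi).trans (Set.subset_iUnion Y i)

/-- One closure step. -/
def hullStep (H : Finset N → Set N) (A : Set N) : Set N :=
  A ∪ ⋃ s : {s : Finset N // (s : Set N) ⊆ A}, H s

/-- The closure of `A` under `H`. -/
def hull (H : Finset N → Set N) (A : Set N) : Set N := ⋃ n : ℕ, (hullStep H)^[n] A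

theorem subset_hull (H : Finset N → Set N) (A : Set N) : A ⊆ hull H A :=
  Set.subset_iUnion (fun n : ℕ => (hullStep H)^[n] A) 0

theorem hullStep_mono_nat (H : Finset N → Set N) (A : Set N) :
    Monotone fun n : ℕ => (hullStep H)^[n] A := by
  refine monotone_nat_of_le_succ fun n => ?_
  change _ ≤ (hullStep H)^[n + 1] A
  rw [Function.iterate_succ_apply']
  exact Set.subset_union_left

theorem cl_hull (H : Finset N → Set N) (A : Set N) : Cl H (hull H A) := by
  intro s hs
  obtain ⟨n, hn⟩ := exists_subset_of_directed (hullStep_mono_nat H A).directed_le s hs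
  refine Set.Subset.trans ?_ (Set.subset_iUnion (fun n : ℕ => (hullStep H)^[n] A) (n + 1))
  rw [Function.iterate_succ_apply']
  exact Set.subset_union_of_subset_right
    (Set.subset_iUnion (fun s : {s : Finset N // (s : Set N) ⊆ _} => H s) ⟨s, hn⟩) _

theorem hull_subset {H : Finset N → Set N} {A Y : Set N} (hY : Cl H Y) (hA : A ⊆ Y) :
    hull H A ⊆ Y := by
  refine Set.iUnion_subset fun n => ?_
  induction n with
  | zero => exact hA
  | succ n ih =>
    rw [Function.iterate_succ_apply']
    exact Set.union_subset ih (Set.iUnion_subset fun s => hY _ (s.2.trans ih))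

theorem mk_finset_subset_le {κ : Cardinal.{u}} (hκ : ℵ₀ ≤ κ) {A : Set N} (hA : #A ≤ κ) :
    #{s : Finset N // (s : Set N) ⊆ A} ≤ κ := by
  classical
  have h1 : #{s : Finset N // (s : Set N) ⊆ A} ≤ #(Finset A) := by
    refine Cardinal.mk_le_of_injective (f := fun s => s.1.subtype (· ∈ A)) ?_
    intro s t h
    apply Subtype.ext
    ext x
    have := Finset.ext_iff.1 h
    constructor
    · intro hx
      exact Finset.mem_subtype.1 ((this ⟨x, s.2 hx⟩).1 (Finset.mem_subtype.2 hx))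
    · intro hx
      exact Finset.mem_subtype.1 ((this ⟨x, t.2 hx⟩).2 (Finset.mem_subtype.2 hx))
  refine h1.trans ?_
  rcases finite_or_infinite A with h | h
  · exact (Cardinal.lt_aleph0_of_finite _).le.trans hκ
  · rw [Cardinal.mk_finset_of_infinite]
    exact hA

theorem mk_iUnion_le_of_le {α ι : Type u} {κ : Cardinal.{u}} (hκ : ℵ₀ ≤ κ) (f : ι → Set α)
    (hι : #ι ≤ κ) (hf : ∀ i, #(f i) ≤ κ) : #(⋃ i, f i) ≤ κ := by
  refine (Cardinal.mk_iUnion_le f).trans ?_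
  exact Cardinal.mul_le_of_le hκ hι (ciSup_le' hf)

theorem mk_union_le_of_le {α : Type u} {κ : Cardinal.{u}} (hκ : ℵ₀ ≤ κ) {A B : Set α}
    (hA : #A ≤ κ) (hB : #B ≤ κ) : #(A ∪ B : Set α) ≤ κ :=
  (Cardinal.mk_union_le _ _).trans (Cardinal.add_le_of_le hκ hA hB)

theorem mk_hull_le {H : Finset N → Set N} {κ : Cardinal.{u}} (hκ : ℵ₀ ≤ κ)
    (hH : ∀ s, #(H s) ≤ κ) {A : Set N} (hA : #A ≤ κ) : #(hull H A) ≤ κ := by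
  have key : ∀ n : ℕ, #((hullStep H)^[n] A : Set N) ≤ κ := by
    intro n
    induction n with
    | zero => exact hA
    | succ n ih =>
      rw [Function.iterate_succ_apply']
      exact mk_union_le_of_le hκ ih (mk_iUnion_le_of_le hκ _ (mk_finset_subset_le hκ ih)
        fun s => hH _)
  have h2 : hull H A = ⋃ n : ULift.{u} ℕ, (hullStep H)^[n.down] A := by
    ext x
    simp only [hull, Set.mem_iUnion]
    exact ⟨fun ⟨n, h⟩ => ⟨⟨n⟩, h⟩, fun ⟨n, h⟩ => ⟨n.down, h⟩⟩
  rw [h2]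
  refine mk_iUnion_le_of_le hκ _ ?_ fun n => key _
  simpa using hκ

/-- The `i`-th stage of a continuous filtration by `H`-closed sets: the closure of `D` and of
what `w j` assigns to the earlier stages `j < i`. -/
noncomputable def filtration (H : Finset N → Set N) (D : Set N) (w : Ordinal.{u} → Set N → Set N)
    (i : Ordinal.{u}) : Set N :=
  hull H (D ∪ ⋃ j : Set.Iio i, (filtration H D w j.1 ∪ w j.1 (filtration H D w j.1)))
termination_by i
decreasing_by all_goals exact j.2

variable {H : Finset N → Set N} {D : Set N} {w : Ordinal.{u} → Set N → Set N}

theorem cl_filtration (i : Ordinal.{u}) : Cl H (filtration H D w i) := by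
  rw [filtration]
  exact cl_hull _ _

theorem subset_filtration (i : Ordinal.{u}) : D ⊆ filtration H D w i := by
  rw [filtration]
  exact Set.subset_union_left.trans (subset_hull _ _)

theorem filtration_union_subset {i j : Ordinal.{u}} (h : j < i) :
    filtration H D w j ∪ w j (filtration H D w j) ⊆ filtration H D w i := by
  conv_rhs => rw [filtration]
  refine Set.Subset.trans ?_ (subset_hull _ _)
  refine Set.Subset.trans ?_ Set.subset_union_right
  exact Set.subset_iUnion (fun j : Set.Iio i =>
    filtration H D w j.1 ∪ w j.1 (filtration H D w j.1)) ⟨j, h⟩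

theorem filtration_mono {i j : Ordinal.{u}} (h : j ≤ i) :
    filtration H D w j ⊆ filtration H D w i := by
  rcases h.eq_or_lt with rfl | h
  · exact subset_rfl
  · exact Set.subset_union_left.trans (filtration_union_subset h)

theorem witness_subset_filtration {i j : Ordinal.{u}} (h : j < i) :
    w j (filtration H D w j) ⊆ filtration H D w i :=
  Set.subset_union_right.trans (filtration_union_subset h)

theorem filtration_limit {i : Ordinal.{u}} (hi : Order.IsSuccLimit i) :
    filtration H D w i = ⋃ j < i, filtration H D w j := by
  apply Set.Subset.antisymm
  · rw [← Set.iUnion_subtype (fun j => j < i) (fun j => filtration H D w j.1)]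
    have hne : Nonempty {j // j < i} := ⟨⟨0, hi.bot_lt⟩⟩
    rw [filtration]
    refine hull_subset (Cl.iUnion_directed (Monotone.directed_le ?_) fun j => cl_filtration _) ?_
    · exact fun a b hab => filtration_mono (Subtype.coe_le_coe.2 hab)
    · refine Set.union_subset ((subset_filtration 0).trans (Set.subset_iUnion
        (fun j : {j // j < i} => filtration H D w j.1) ⟨0, hi.bot_lt⟩)) ?_
      refine Set.iUnion_subset fun j => ?_
      exact (filtration_union_subset (Order.lt_succ j.1)).trans
        (Set.subset_iUnion (fun j : {j // j < i} => filtration H D w j.1)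
          ⟨Order.succ j.1, hi.succ_lt j.2⟩)
  · exact Set.iUnion₂_subset fun j hj => filtration_mono hj.le

theorem mk_biUnion_ordinal_le {α : Type u} {κ : Cardinal.{u}} (hκ : ℵ₀ ≤ κ) {i : Ordinal.{u}}
    (hi : i.card ≤ κ) (f : Set.Iio i → Set α) (hf : ∀ j, #(f j) ≤ κ) :
    #(⋃ j, f j) ≤ κ := by
  have h : (⋃ j, f j) = ⋃ j : i.ToType, f (Ordinal.ToType.mk.symm j) :=
    (Ordinal.ToType.mk.symm.surjective.iUnion_comp f).symm
  rw [h]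
  exact mk_iUnion_le_of_le hκ _ (by simpa using hi) fun j => hf _

theorem mk_filtration_le {κ : Cardinal.{u}} (hκ : ℵ₀ ≤ κ) (hH : ∀ s, #(H s) ≤ κ) (hD : #D ≤ κ)
    (hw : ∀ j (Y : Set N), #Y ≤ κ → #(w j Y) ≤ κ) {i : Ordinal.{u}} (hi : i.card ≤ κ) :
    #(filtration H D w i) ≤ κ := by
  induction i using WellFoundedLT.induction with
  | ind i ih =>
    rw [filtration]
    refine mk_hull_le hκ hH (mk_union_le_of_le hκ hD (mk_biUnion_ordinal_le hκ hi _ fun j => ?_))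
    have := ih j.1 j.2 ((Ordinal.card_le_card j.2.le).trans hi)
    exact mk_union_le_of_le hκ this (hw _ _ this)

end closed

/-! ### Skolem functions -/

section skolem

variable {N : Type u} [L.Structure N]

/-- The union of an increasing chain of strong submodels is a strong submodel. -/
theorem strong_iUnion_chain {δ : Ordinal.{u}} (hδ : Order.IsSuccLimit δ)
    (C : Ordinal.{u} → L.Substructure N) (hC : ∀ i < δ, K.Strong (C i))
    (hm : ∀ i j, i ≤ j → j < δ → C i ≤ C j) (T : L.Substructure N)
    (hT : (T : Set N) = ⋃ i < δ, (C i : Set N)) : K.Strong T :=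
  K.chain_smooth δ hδ C
    (fun i j hij hj => (Strong.le_iff (hC i (hij.trans_lt hj)) (hC j hj)).2 (hm i j hij hj))
    hC T hT

/-- The union of the values of `F` at the finite subsets of `A`. -/
def spanOf (F : Finset N → L.Substructure N) (A : Set N) : L.Substructure N :=
  ⨆ s : {s : Finset N // (s : Set N) ⊆ A}, F s

theorem mem_spanOf {F : Finset N → L.Substructure N} (hF : Monotone F) {A : Set N} {x : N} :
    x ∈ spanOf F A ↔ ∃ s : Finset N, (s : Set N) ⊆ A ∧ x ∈ F s := by
  classical
  have hd : Directed (· ≤ ·) fun s : {s : Finset N // (s : Set N) ⊆ A} => F s := by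
    intro s t
    exact ⟨⟨s.1 ∪ t.1, by rw [Finset.coe_union]; exact Set.union_subset s.2 t.2⟩,
      hF Finset.subset_union_left, hF Finset.subset_union_right⟩
  have : Nonempty {s : Finset N // (s : Set N) ⊆ A} := ⟨⟨∅, by simp⟩⟩
  unfold spanOf
  rw [FirstOrder.Language.Substructure.mem_iSup_of_directed hd]
  exact ⟨fun ⟨s, h⟩ => ⟨s.1, s.2, h⟩, fun ⟨s, h, h'⟩ => ⟨⟨s, h⟩, h'⟩⟩

/-- An enumeration of a set along the initial ordinal of its cardinality. -/
theorem exists_rank (α : Type u) : ∃ r : α → Ordinal.{u}, Function.Injective r ∧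
    (∀ a, r a < (#α).ord) ∧ ∀ i < (#α).ord, ∃ a, r a = i := by
  obtain ⟨e⟩ : Nonempty (α ≃ (#α).ord.ToType) := Cardinal.eq.1 (by simp)
  refine ⟨fun a => (Ordinal.ToType.mk.symm (e a)).1, ?_, fun a => (Ordinal.ToType.mk.symm (e a)).2,
    fun i hi => ⟨e.symm (Ordinal.ToType.mk ⟨i, hi⟩), by simp⟩⟩
  intro a b h
  exact e.injective (Ordinal.ToType.mk.symm.injective (Subtype.ext h))

theorem mk_rank_lt {α : Type u} {r : α → Ordinal.{u}} (hr : Function.Injective r)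
    (i : Ordinal.{u}) : #{a // r a < i} ≤ i.card := by
  have h := Cardinal.lift_mk_le_lift_mk_of_injective
    (f := fun a : {a // r a < i} => (⟨r a.1, a.2⟩ : Set.Iio i))
    (fun a b h => Subtype.ext (hr (congrArg Subtype.val h)))
  rw [Cardinal.mk_Iio_ordinal, Cardinal.lift_lift] at h
  exact Cardinal.lift_le.1 h

/-- Unions of directed finitely indexed families of strong submodels are strong. The set `A` is
written as an increasing chain of smaller sets, and the claim follows by induction on `#A`. -/
theorem strong_spanOf {F : Finset N → L.Substructure N} (hF : Monotone F)
    (hS : ∀ s, K.Strong (F s)) (A : Set N) : K.Strong (spanOf F A) := by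
  classical
  induction hc : #A using WellFoundedLT.induction generalizing A with
  | ind c ih =>
  subst hc
  by_cases hA : A.Finite
  · have : spanOf F A = F hA.toFinset := by
      ext x
      rw [mem_spanOf hF]
      constructor
      · rintro ⟨s, hs, hx⟩
        exact hF (fun y hy => hA.mem_toFinset.2 (hs hy)) hx
      · exact fun hx => ⟨_, by simp, hx⟩
    rw [this]
    exact hS _
  · obtain ⟨r, hr, hr1, -⟩ := exists_rank A
    have hinf : ℵ₀ ≤ #A := by
      have : Infinite A := Set.infinite_coe_iff.2 hA
      exact Cardinal.aleph0_le_mk A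
    have hlim : Order.IsSuccLimit (#A).ord := Cardinal.isSuccLimit_ord hinf
    let B : Ordinal.{u} → Set N := fun i => Subtype.val '' {a : A | r a < i}
    have hBm : ∀ i j, i ≤ j → B i ⊆ B j := fun i j hij =>
      Set.image_mono fun a (ha : r a < i) => ha.trans_le hij
    refine strong_iUnion_chain hlim (fun i => spanOf F (B i)) (fun i hi => ?_) ?_ _ ?_
    · refine ih #(B i) ?_ _ rfl
      refine (Cardinal.mk_image_le.trans (mk_rank_lt hr i)).trans_lt ?_
      exact Cardinal.lt_ord.1 hi
    · intro i j hij _ x hx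
      rw [mem_spanOf hF] at hx ⊢
      obtain ⟨s, hs, hx⟩ := hx
      exact ⟨s, hs.trans (hBm i j hij), hx⟩
    · ext x
      simp only [SetLike.mem_coe, Set.mem_iUnion, mem_spanOf hF, exists_prop]
      constructor
      · rintro ⟨s, hs, hx⟩
        have hsub : (s : Set N) ⊆ ⋃ i : Set.Iio (#A).ord, B i := by
          intro y hy
          exact Set.mem_iUnion.2 ⟨⟨Order.succ (r ⟨y, hs hy⟩), hlim.succ_lt (hr1 _)⟩,
            ⟨y, hs hy⟩, show r _ < _ from Order.lt_succ _, rfl⟩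
        have : Nonempty (Set.Iio (#A).ord) := ⟨⟨0, hlim.bot_lt⟩⟩
        obtain ⟨i, hi⟩ := exists_subset_of_directed
          (Monotone.directed_le fun (i j : Set.Iio (#A).ord) hij => hBm i j hij) s hsub
        exact ⟨i.1, i.2, s, hi, hx⟩
      · rintro ⟨i, hi, s, hs, hx⟩
        refine ⟨s, hs.trans ?_, hx⟩
        rintro _ ⟨a, -, rfl⟩
        exact a.2

open Classical in
/-- A Skolem function below the monotone family `S₀`: the value at a finite set is a small strong
submodel of `S₀ s` containing `s` and the values at the proper subsets of `s`. -/
noncomputable def skolemFun (K : AEC.{u} L) (κ : Cardinal.{u}) (S₀ : Finset N → L.Substructure N) :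
    Finset N → L.Substructure N :=
  Finset.strongInduction fun s F =>
    if h : ∃ S : L.Substructure N, S ≤ S₀ s ∧ (s : Set N) ⊆ S ∧
        (∀ t (ht : t ⊂ s), F t ht ≤ S) ∧ K.Strong S ∧ #S ≤ κ then h.choose else ⊤

theorem skolemFun_spec {κ : Cardinal.{u}} (hκ : K.LS ≤ κ) {S₀ : Finset N → L.Substructure N}
    (hm : Monotone S₀) (hS : ∀ s, K.Strong (S₀ s)) (hs : ∀ s : Finset N, (s : Set N) ⊆ S₀ s)
    (s : Finset N) :
    skolemFun K κ S₀ s ≤ S₀ s ∧ (s : Set N) ⊆ skolemFun K κ S₀ s ∧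
      (∀ t, t ⊂ s → skolemFun K κ S₀ t ≤ skolemFun K κ S₀ s) ∧ K.Strong (skolemFun K κ S₀ s) ∧
      #(skolemFun K κ S₀ s) ≤ κ := by
  classical
  induction s using Finset.strongInduction with
  | H s ih =>
  have hinf : ℵ₀ ≤ κ := (LS_spec K).1.trans hκ
  have h : ∃ S : L.Substructure N, S ≤ S₀ s ∧ (s : Set N) ⊆ S ∧
        (∀ t (_ : t ⊂ s), skolemFun K κ S₀ t ≤ S) ∧ K.Strong S ∧ #S ≤ κ := by
    let A : Set N := s ∪ ⋃ t : {t : Finset N // t ∈ s.ssubsets}, (skolemFun K κ S₀ t.1 : Set N)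
    have hAc : #A ≤ κ := by
      refine mk_union_le_of_le hinf ?_ (mk_iUnion_le_of_le hinf _ ?_ ?_)
      · exact (Cardinal.lt_aleph0_of_finite _).le.trans hinf
      · exact (Cardinal.lt_aleph0_of_finite _).le.trans hinf
      · intro t
        exact (ih t.1 (Finset.mem_ssubsets.1 t.2)).2.2.2.2
    have hAS : A ⊆ S₀ s := by
      refine Set.union_subset (hs s) (Set.iUnion_subset fun t => ?_)
      have ht := Finset.mem_ssubsets.1 t.2
      exact (ih t.1 ht).1.trans (hm ht.subset)
    obtain ⟨S, h1, h2, h3⟩ := exists_strong_le (hS s).mem hκ (Subtype.val ⁻¹' A : Set (S₀ s))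
      ((Cardinal.mk_preimage_of_injective _ _ Subtype.val_injective).trans hAc)
    refine ⟨S.map (S₀ s).subtype.toHom, ?_, ?_, ?_, (SEmb.ofSub (hS s)).strong_map h2, ?_⟩
    · rintro _ ⟨x, -, rfl⟩
      exact x.2
    · intro x hx
      exact ⟨⟨x, hs s hx⟩, h1 (Set.subset_union_left hx), rfl⟩
    · intro t ht x hx
      have hxA : x ∈ A := Set.subset_union_right
        (Set.mem_iUnion.2 ⟨⟨t, Finset.mem_ssubsets.2 ht⟩, hx⟩)
      exact ⟨⟨x, hAS hxA⟩, h1 hxA, rfl⟩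
    · exact Cardinal.mk_image_le.trans h3
  have heq : skolemFun K κ S₀ s = h.choose := by
    have h0 : skolemFun K κ S₀ s = _ := Finset.strongInduction_eq _ s
    rw [h0]
    exact dif_pos h
  rw [heq]
  exact h.choose_spec

/-- Skolem functions for a model with a chain of strong submodels: there is a finitary operation
such that every closed substructure is strong, and meets each member of the chain in a strong
submodel. -/
theorem exists_skolem_chain (hN : K.Mem N) (δ : Ordinal.{u}) (C : Ordinal.{u} → L.Substructure N)
    (hC : ∀ i < δ, K.Strong (C i)) (hm : ∀ i j, i ≤ j → j < δ → C i ≤ C j) :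
    ∃ H : Finset N → Set N, (∀ s, #(H s) ≤ K.LS) ∧ ∀ Y : Set N, Cl H Y →
      ∃ S : L.Substructure N, (S : Set N) = Y ∧ K.Strong S ∧ ∀ i < δ, K.Strong (S ⊓ C i) := by
  classical
  let S₀ : Finset N → L.Substructure N := fun s =>
    if h : ∃ i, i < δ ∧ (s : Set N) ⊆ C i then C (sInf {i | i < δ ∧ (s : Set N) ⊆ C i}) else ⊤
  have hmin : ∀ s : Finset N, (∃ i, i < δ ∧ (s : Set N) ⊆ C i) →
      sInf {i | i < δ ∧ (s : Set N) ⊆ C i} < δ ∧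
        (s : Set N) ⊆ C (sInf {i | i < δ ∧ (s : Set N) ⊆ C i}) := fun s h => csInf_mem h
  have h1 : ∀ s, K.Strong (S₀ s) := by
    intro s
    by_cases h : ∃ i, i < δ ∧ (s : Set N) ⊆ C i
    · simp only [S₀, dif_pos h]
      exact hC _ (hmin s h).1
    · simp only [S₀, dif_neg h]
      exact K.strong_top hN
  have h2 : ∀ s : Finset N, (s : Set N) ⊆ S₀ s := by
    intro s
    by_cases h : ∃ i, i < δ ∧ (s : Set N) ⊆ C i
    · simp only [S₀, dif_pos h]
      exact (hmin s h).2
    · simp only [S₀, dif_neg h]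
      exact Set.subset_univ _
  have hle : ∀ s : Finset N, ∀ i < δ, (s : Set N) ⊆ C i → S₀ s ≤ C i := by
    intro s i hi hs
    have h : ∃ i, i < δ ∧ (s : Set N) ⊆ C i := ⟨i, hi, hs⟩
    simp only [S₀, dif_pos h]
    exact hm _ _ (csInf_le' ⟨hi, hs⟩) hi
  have h3 : Monotone S₀ := by
    intro s t hst
    by_cases h : ∃ i, i < δ ∧ (t : Set N) ⊆ C i
    · conv_rhs => simp only [S₀, dif_pos h]
      exact hle s _ (hmin t h).1 ((Finset.coe_subset.2 hst).trans (hmin t h).2)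
    · conv_rhs => simp only [S₀, dif_neg h]
      exact le_top
  have spec := skolemFun_spec (K := K) le_rfl h3 h1 h2
  set F := skolemFun K K.LS S₀ with hFdef
  have hFm : Monotone F := by
    intro s t hst
    rcases hst.eq_or_ssubset with rfl | hst
    · exact le_rfl
    · exact (spec t).2.2.1 s hst
  have hcl : ∀ Y : Set N, Cl (fun s => (F s : Set N)) Y → (spanOf F Y : Set N) = Y := by
    intro Y hY
    ext x
    rw [SetLike.mem_coe, mem_spanOf hFm]
    constructor
    · rintro ⟨s, hs, hx⟩
      exact hY s hs hx
    · intro hx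
      exact ⟨{x}, by simpa using hx, (spec {x}).2.1 (by simp)⟩
  refine ⟨fun s => F s, fun s => (spec s).2.2.2.2, fun Y hY => ⟨spanOf F Y, hcl Y hY,
    strong_spanOf hFm (fun s => (spec s).2.2.2.1) Y, fun i hi => ?_⟩⟩
  have hYi : Cl (fun s => (F s : Set N)) (Y ∩ C i) := by
    intro s hs
    refine Set.subset_inter (hY s (hs.trans Set.inter_subset_left)) ?_
    exact (spec s).1.trans (hle s i hi (hs.trans Set.inter_subset_right))
  have : spanOf F Y ⊓ C i = spanOf F (Y ∩ C i) := by
    apply SetLike.coe_injective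
    rw [FirstOrder.Language.Substructure.coe_inf, hcl Y hY, hcl _ hYi]
  rw [this]
  exact strong_spanOf hFm (fun s => (spec s).2.2.2.1) _

/-- Skolem functions: a finitary operation all of whose closed sets are strong submodels. -/
theorem exists_skolem (hN : K.Mem N) :
    ∃ H : Finset N → Set N, (∀ s, #(H s) ≤ K.LS) ∧ ∀ Y : Set N, Cl H Y →
      ∃ S : L.Substructure N, (S : Set N) = Y ∧ K.Strong S := by
  obtain ⟨H, h1, h2⟩ := exists_skolem_chain hN 0 (fun _ => ⊤) (fun _ _ => K.strong_top hN)
    (fun _ _ _ _ => le_rfl)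
  exact ⟨H, h1, fun Y hY => let ⟨S, h, h', _⟩ := h2 Y hY; ⟨S, h, h'⟩⟩

end skolem

/-! ### Direct limits and towers -/

section limits

theorem le_range_of_comp {P Q N : Type u} [L.Structure P] [L.Structure Q] [L.Structure N]
    (a : P ↪[L] N) (b : Q ↪[L] N) (g : SEmb K P Q) (h : ∀ x, b (g x) = a x) :
    K.Le a.toHom.range b.toHom.range := by
  refine ⟨?_, ?_⟩
  · rintro _ ⟨x, rfl⟩
    exact ⟨g x, h x⟩
  · have h1 := K.strong_iso b.equivRange _ g.strong_range
    convert h1 using 1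
    ext x
    constructor
    · rintro ⟨y, hy⟩
      exact ⟨g y, ⟨y, rfl⟩, Subtype.ext ((h y).trans hy)⟩
    · rintro ⟨_, ⟨y, rfl⟩, hy⟩
      exact ⟨y, (h y).symm.trans (congrArg Subtype.val hy)⟩

variable {δ : Ordinal.{u}} {A : Ordinal.{u} → Type u} [∀ i, L.Structure (A i)]

/-- If `R` is covered by a coherent chain of models, with strong embeddings between them, then the
members of the chain are strong in `R`. -/
theorem strongEmb_of_cover (hδ : Order.IsSuccLimit δ)
    (g : ∀ j k, j ≤ k → k < δ → SEmb K (A j) (A k)) {R : Type u} [L.Structure R]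
    (e : ∀ j, j < δ → A j ↪[L] R)
    (he : ∀ j k (h : j ≤ k) (hk : k < δ) x, e k hk (g j k h hk x) = e j (h.trans_lt hk) x)
    (hs : ∀ r : R, ∃ j, ∃ hj : j < δ, ∃ x, e j hj x = r) (j : Ordinal.{u}) (hj : j < δ) :
    K.StrongEmb (e j hj) := by
  classical
  let C : Ordinal.{u} → L.Substructure R := fun i =>
    if h : i < δ then (e i h).toHom.range else ⊤
  have hC : ∀ i (h : i < δ), C i = (e i h).toHom.range := fun i h => dif_pos h
  have hU := K.chain_union δ hδ C (fun i j hij hj => by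
    rw [hC i (hij.trans_lt hj), hC j hj]
    exact le_range_of_comp _ _ (g i j hij hj) (he i j hij hj)) ⊤ (by
      ext x
      simp only [FirstOrder.Language.Substructure.coe_top, Set.mem_univ, Set.mem_iUnion, true_iff]
      obtain ⟨j, hj, y, rfl⟩ := hs x
      exact ⟨j, hj, by rw [hC j hj]; exact ⟨y, rfl⟩⟩)
  have h1 := K.strong_iso FirstOrder.Language.Substructure.topEquiv _ (hU.2 j hj)
  unfold StrongEmb
  rw [← hC j hj]
  convert h1 using 1
  ext x
  constructor
  · intro hx
    exact ⟨⟨x, trivial⟩, hx, rfl⟩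
  · rintro ⟨y, hy, rfl⟩
    exact hy

/-- Direct limits of coherent chains of strong embeddings. -/
theorem exists_colimit (hδ : Order.IsSuccLimit δ)
    (g : ∀ j k, j ≤ k → k < δ → SEmb K (A j) (A k))
    (hrefl : ∀ j (hj : j < δ) x, g j j le_rfl hj x = x)
    (hcoh : ∀ j k l (hjk : j ≤ k) (hkl : k ≤ l) (hl : l < δ) x,
      g k l hkl hl (g j k hjk (hkl.trans_lt hl) x) = g j l (hjk.trans hkl) hl x) :
    ∃ (R : Type u) (_ : L.Structure R) (e : ∀ j, j < δ → SEmb K (A j) R),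
      (∀ j k (h : j ≤ k) (hk : k < δ) x, e k hk (g j k h hk x) = e j (h.trans_lt hk) x) ∧
      ∀ r : R, ∃ j, ∃ hj : j < δ, ∃ x, e j hj x = r := by
  let G : δ.ToType → Type u := fun a => A (Ordinal.ToType.mk.symm a).1
  let f : ∀ a b : δ.ToType, a ≤ b → G a ↪[L] G b := fun a b h =>
    (g _ _ (Ordinal.ToType.mk.symm.monotone h) (Ordinal.ToType.mk.symm b).2).emb
  have : DirectedSystem G fun a b h => f a b h :=
    { map_self := fun a x => hrefl _ _ x
      map_map := fun {a b c} hab hbc x => hcoh _ _ _ _ _ _ x }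
  have : Nonempty δ.ToType := ⟨Ordinal.ToType.mk ⟨0, hδ.bot_lt⟩⟩
  let e : ∀ j, j < δ → A j ↪[L] FirstOrder.Language.DirectLimit G f := fun j hj =>
    { toFun := fun x => FirstOrder.Language.DirectLimit.of L δ.ToType G f
        (Ordinal.ToType.mk ⟨j, hj⟩) (g j _ (by simp) (Ordinal.ToType.mk.symm _).2 x)
      inj' := fun x y h => (g j _ _ _).injective
        ((FirstOrder.Language.DirectLimit.of L δ.ToType G f _).injective h)
      map_fun' := fun F x => by
        have := ((FirstOrder.Language.DirectLimit.of L δ.ToType G f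
          (Ordinal.ToType.mk ⟨j, hj⟩)).comp
            (g j _ (by simp) (Ordinal.ToType.mk.symm _).2).emb).map_fun F x
        exact this
      map_rel' := fun F x => by
        have := ((FirstOrder.Language.DirectLimit.of L δ.ToType G f
          (Ordinal.ToType.mk ⟨j, hj⟩)).comp
            (g j _ (by simp) (Ordinal.ToType.mk.symm _).2).emb).map_rel F x
        exact this }
  have he0 : ∀ j (hj : j < δ) x, e j hj x = FirstOrder.Language.DirectLimit.of L δ.ToType G f
        (Ordinal.ToType.mk ⟨j, hj⟩) (g j _ (by simp) (Ordinal.ToType.mk.symm _).2 x) :=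
    fun _ _ _ => rfl
  have he : ∀ j k (h : j ≤ k) (hk : k < δ) x, e k hk (g j k h hk x) = e j (h.trans_lt hk) x := by
    intro j k h hk x
    rw [he0, he0]
    have hab : Ordinal.ToType.mk ⟨j, h.trans_lt hk⟩ ≤ Ordinal.ToType.mk ⟨k, hk⟩ :=
      Ordinal.ToType.mk.monotone h
    rw [← FirstOrder.Language.DirectLimit.of_f (hij := hab)]
    congr 1
    exact (hcoh _ _ _ _ _ _ _).trans (hcoh _ _ _ _ _ _ _).symm
  have hs : ∀ r, ∃ j, ∃ hj : j < δ, ∃ x, e j hj x = r := by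
    intro r
    obtain ⟨a, x, rfl⟩ := FirstOrder.Language.DirectLimit.exists_of r
    refine ⟨_, (Ordinal.ToType.mk.symm a).2, x, (he0 _ _ _).trans ?_⟩
    have hab : a ≤ Ordinal.ToType.mk ⟨_, (Ordinal.ToType.mk.symm a).2⟩ := by simp
    rw [← FirstOrder.Language.DirectLimit.of_f (hij := hab)]
    rfl
  exact ⟨_, inferInstance, fun j hj => ⟨e j hj, strongEmb_of_cover hδ g e he hs j hj⟩, he, hs⟩

/-- Strong embeddings of the members of a chain covering `M` glue to a strong embedding
of `M`. -/
theorem exists_glue (hδ : Order.IsSuccLimit δ)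
    (g : ∀ j k, j ≤ k → k < δ → SEmb K (A j) (A k)) {M W : Type u} [L.Structure M]
    [L.Structure W] (e : ∀ j, j < δ → SEmb K (A j) M)
    (he : ∀ j k (h : j ≤ k) (hk : k < δ) x, e k hk (g j k h hk x) = e j (h.trans_lt hk) x)
    (hs : ∀ r : M, ∃ j, ∃ hj : j < δ, ∃ x, e j hj x = r)
    (w : ∀ j, j < δ → SEmb K (A j) W)
    (hw : ∀ j k (h : j ≤ k) (hk : k < δ) x, w k hk (g j k h hk x) = w j (h.trans_lt hk) x) :
    ∃ h : SEmb K M W, ∀ j hj x, h (e j hj x) = w j hj x := by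
  classical
  choose J hJ y hy using hs
  let h : M → W := fun m => w (J m) (hJ m) (y m)
  have key : ∀ j hj x, h (e j hj x) = w j hj x := by
    intro j hj x
    rcases le_total (J (e j hj x)) j with hle | hle
    · change w _ _ _ = _
      rw [← hw _ _ hle hj]
      congr 1
      apply (e j hj).injective
      rw [he, hy]
    · change w _ _ _ = _
      rw [← hw _ _ hle (hJ _)]
      congr 1
      apply (e _ (hJ (e j hj x))).injective
      rw [he, hy]
  have hfin : ∀ {n : ℕ} (x : Fin n → M), ∃ j, ∃ hj : j < δ, ∃ z : Fin n → A j,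
      x = fun i => e j hj (z i) := by
    intro n x
    have : ∃ j < δ, ∀ i, J (x i) ≤ j := by
      rcases n with _ | n
      · exact ⟨0, hδ.bot_lt, fun i => i.elim0⟩
      · obtain ⟨i, -, hi⟩ := Finset.exists_max_image Finset.univ (fun i => J (x i))
          Finset.univ_nonempty
        exact ⟨J (x i), hJ _, fun k => hi k (Finset.mem_univ k)⟩
    obtain ⟨j, hj, hle⟩ := this
    refine ⟨j, hj, fun i => g _ _ (hle i) hj (y (x i)), ?_⟩
    funext i
    rw [he, hy]
  let E : M ↪[L] W :=
    { toFun := h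
      inj' := by
        intro a b hab
        obtain ⟨j, hj, z, hz⟩ := hfin ![a, b]
        have ha : a = e j hj (z 0) := congrFun hz 0
        have hb : b = e j hj (z 1) := congrFun hz 1
        rw [ha, hb] at hab ⊢
        rw [key, key] at hab
        rw [(w j hj).injective hab]
      map_fun' := by
        intro n F x
        obtain ⟨j, hj, z, rfl⟩ := hfin x
        have h1 := (e j hj).emb.map_fun F z
        have h2 := (w j hj).emb.map_fun F z
        have h3 : (h ∘ fun i => e j hj (z i)) = (w j hj).emb ∘ z := by
          funext i
          exact key j hj (z i)
        rw [h3, ← h2]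
        change h (FirstOrder.Language.Structure.funMap F ((e j hj).emb ∘ z)) = _
        rw [← h1]
        exact key _ _ _
      map_rel' := by
        intro n F x
        obtain ⟨j, hj, z, rfl⟩ := hfin x
        have h1 := (e j hj).emb.map_rel F z
        have h2 := (w j hj).emb.map_rel F z
        have h3 : (h ∘ fun i => e j hj (z i)) = (w j hj).emb ∘ z := by
          funext i
          exact key j hj (z i)
        rw [h3]
        exact h2.trans h1.symm }
  refine ⟨⟨E, ?_⟩, key⟩
  let C : Ordinal.{u} → L.Substructure W := fun i =>
    if h : i < δ then (w i h).range else ⊤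
  have hC : ∀ i (h : i < δ), C i = (w i h).range := fun i h => dif_pos h
  refine strong_iUnion_chain hδ C (fun i hi => by rw [hC i hi]; exact (w i hi).strong_range) ?_ _ ?_
  · intro i j hij hj
    rw [hC i (hij.trans_lt hj), hC j hj]
    rintro _ ⟨x, rfl⟩
    exact ⟨g i j hij hj x, hw _ _ _ _ _⟩
  · ext z
    simp only [SetLike.mem_coe, Set.mem_iUnion, exists_prop]
    constructor
    · rintro ⟨m, rfl⟩
      exact ⟨J m, hJ m, by rw [hC _ (hJ m)]; exact ⟨y m, rfl⟩⟩
    · rintro ⟨i, hi, hz⟩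
      rw [hC i hi] at hz
      obtain ⟨x, rfl⟩ := hz
      exact ⟨e i hi x, key _ _ _⟩

end limits

section towers

variable {Ob : Type v} (car : Ob → Type u) [∀ o, L.Structure (car o)]

/-- A continuous coherent system, indexed by the ordinals below `δ`, of objects `o` carrying models
`car o` of `K`; the `i`-th object satisfies `Q i` and the connecting maps satisfy `T`. -/
structure Tower (K : AEC.{u} L) (Q : Ordinal.{u} → Ob → Prop)
    (T : Ordinal.{u} → Ordinal.{u} → ∀ o o' : Ob, SEmb K (car o) (car o') → Prop)
    (δ : Ordinal.{u}) where
  ob : Ordinal.{u} → Ob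
  map : ∀ j k, j ≤ k → k < δ → SEmb K (car (ob j)) (car (ob k))
  good : ∀ i < δ, Q i (ob i)
  trans : ∀ j k (h : j ≤ k) (hk : k < δ), T j k _ _ (map j k h hk)
  map_self : ∀ j (hj : j < δ) x, map j j le_rfl hj x = x
  map_map : ∀ j k l (hjk : j ≤ k) (hkl : k ≤ l) (hl : l < δ) x,
      map k l hkl hl (map j k hjk (hkl.trans_lt hl) x) = map j l (hjk.trans hkl) hl x
  cont : ∀ i (hi : i < δ), Order.IsSuccLimit i → ∀ x : car (ob i),
      ∃ j, ∃ hj : j < i, ∃ y, map j i hj.le hi y = x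

variable {car}

/-- An injection into a large set extends along an injection of small sets. -/
theorem exists_extend_injection {α β U : Type u} {κ : Cardinal.{u}} (hκ : ℵ₀ ≤ κ)
    (hU : κ < #U) (hα : #α ≤ κ) (hβ : #β ≤ κ) (f : α → U) (hf : Function.Injective f) (g : α → β)
    (hg : Function.Injective g) : ∃ f' : β → U, Function.Injective f' ∧ ∀ x, f' (g x) = f x := by
  classical
  have h1 : #β ≤ #((Set.range f)ᶜ : Set U) := by
    by_contra! h
    have h2 := Cardinal.mk_sum_compl (Set.range f)
    have h3 : #(Set.range f) ≤ κ := Cardinal.mk_range_le.trans hα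
    rw [← h2] at hU
    exact absurd (Cardinal.add_le_of_le hκ h3 (h.le.trans hβ)) (not_le.2 hU)
  obtain ⟨k⟩ := h1
  refine ⟨fun y => if h : ∃ x, g x = y then f h.choose else (k y).1, ?_, ?_⟩
  · intro y y' h
    by_cases hy : ∃ x, g x = y <;> by_cases hy' : ∃ x, g x = y'
    · simp only [dif_pos hy, dif_pos hy'] at h
      rw [← hy.choose_spec, ← hy'.choose_spec, hf h]
    · simp only [dif_pos hy, dif_neg hy'] at h
      exact absurd ⟨_, h⟩ (k y').2
    · simp only [dif_neg hy, dif_pos hy'] at h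
      exact absurd ⟨_, h.symm⟩ (k y).2
    · simp only [dif_neg hy, dif_neg hy'] at h
      exact k.injective (Subtype.ext h)
  · intro x
    have h : ∃ x', g x' = g x := ⟨x, rfl⟩
    simp only [dif_pos h]
    rw [hg h.choose_spec]

/-- Construction of towers by transfinite recursion: a first object, extensions at successor steps,
and direct limits at limit steps. Stages carry injections into one large set; these determine the
connecting maps, which makes the system coherent. -/
theorem exists_tower {κ : Cardinal.{u}} (hκ : ℵ₀ ≤ κ) {δ : Ordinal.{u}}
    (hδ : ∀ i < δ, i.card ≤ κ) (Q : Ordinal.{u} → Ob → Prop)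
    (T : Ordinal.{u} → Ordinal.{u} → ∀ o o' : Ob, SEmb K (car o) (car o') → Prop)
    (hQm : ∀ i o, Q i o → K.Mem (car o)) (hQc : ∀ i o, Q i o → #(car o) ≤ κ)
    (hrefl : ∀ i o (h : Q i o), T i i o o (SEmb.refl (hQm i o h)))
    (hcomp : ∀ i j k o o' o'' (f : SEmb K (car o) (car o')) (g : SEmb K (car o') (car o'')),
      i ≤ j → j ≤ k → T i j o o' f → T j k o' o'' g → T i k o o'' (g.comp f))
    (h0 : ∃ o, Q 0 o)
    (hs : ∀ i o, Order.succ i < δ → Q i o →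
      ∃ o' g, Q (Order.succ i) o' ∧ T i (Order.succ i) o o' g)
    (hl : ∀ i < δ, Order.IsSuccLimit i → ∀ (S : Tower car K Q T i) (R : Type u) (_ : L.Structure R)
      (e : ∀ j, j < i → SEmb K (car (S.ob j)) R),
      (∀ j k (h : j ≤ k) (hk : k < i) x, e k hk (S.map j k h hk x) = e j (h.trans_lt hk) x) →
      (∀ r : R, ∃ j, ∃ hj : j < i, ∃ x, e j hj x = r) → #R ≤ κ →
      ∃ (o : Ob) (φ : SEmb K R (car o)), Function.Surjective φ ∧ Q i o ∧
        ∀ j hj, T j i _ _ (φ.comp (e j hj))) :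
    Nonempty (Tower car K Q T δ) := by
  classical
  obtain ⟨U, hU⟩ : ∃ U : Type u, #U = Order.succ κ := ⟨_, Cardinal.mk_out _⟩
  have hUκ : κ < #U := hU ▸ Order.lt_succ κ
  -- `Rel j k S S'`: the connecting map commutes with the injections in `U`, hence is unique
  let Stage := Σ o : Ob, (car o ↪ U)
  let Rel : Ordinal.{u} → Ordinal.{u} → Stage → Stage → Prop := fun j k S S' =>
    ∃ g : SEmb K (car S.1) (car S'.1), T j k _ _ g ∧ ∀ x, S'.2 (g x) = S.2 x
  -- `S` is a possible stage `i` after the stages `prev`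
  let Ext : ∀ i : Ordinal.{u}, (∀ j, j < i → Stage) → Stage → Prop := fun i prev S =>
    Q i S.1 ∧ (∀ j hj, Rel j i (prev j hj) S) ∧
      (Order.IsSuccLimit i → ∀ x, ∃ j, ∃ hj : j < i, ∃ y, (prev j hj).2 y = S.2 x)
  obtain ⟨o0, ho0⟩ := h0
  have hinit : ∀ o : Ob, #(car o) ≤ κ → Nonempty (car o ↪ U) := fun o h => h.trans hUκ.le
  let dflt : Stage := ⟨o0, (hinit o0 (hQc 0 o0 ho0)).some⟩
  let step : ∀ i : Ordinal.{u}, (∀ j, j < i → Stage) → Stage := fun i prev =>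
    if h : ∃ S, Ext i prev S then h.choose else dflt
  let s : Ordinal.{u} → Stage := WellFoundedLT.fix step
  have hsdef : ∀ i, s i = step i fun j _ => s j := fun i => WellFoundedLT.fix_eq step i
  have hsext : ∀ i, (∃ S, Ext i (fun j _ => s j) S) → Ext i (fun j _ => s j) (s i) := by
    intro i h
    have : s i = h.choose := by
      rw [hsdef]
      exact dif_pos h
    rw [this]
    exact h.choose_spec
  -- the tower obtained from the stages below `i`
  have mkT : ∀ i, (∀ j < i, Ext j (fun j _ => s j) (s j)) →
      ∃ S : Tower car K Q T i, (∀ j, S.ob j = (s j).1) ∧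
        ∃ ι : ∀ j, car (S.ob j) ↪ U, (∀ j k h hk x, ι k (S.map j k h hk x) = ι j x) ∧
          (∀ j, HEq (ι j) (s j).2) := by
    intro i hi
    have hrel : ∀ j k, j ≤ k → k < i → Rel j k (s j) (s k) := by
      intro j k hjk hk
      rcases hjk.eq_or_lt with rfl | hjk
      · exact ⟨SEmb.refl (hQm j _ (hi j hk).1), hrefl j _ (hi j hk).1, fun x => rfl⟩
      · exact (hi k hk).2.1 j hjk
    choose g hgT hg using hrel
    refine ⟨⟨fun j => (s j).1, g, fun j hj => (hi j hj).1, hgT, ?_, ?_, ?_⟩, fun j => rfl,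
      fun j => (s j).2, hg, fun j => HEq.rfl⟩
    · intro j hj x
      exact (s j).2.injective (hg _ _ _ _ _)
    · intro j k l hjk hkl hl x
      apply (s l).2.injective
      rw [hg, hg, hg]
    · intro k hk hlim x
      obtain ⟨j, hj, y, hy⟩ := (hi k hk).2.2 hlim x
      refine ⟨j, hj, y, (s k).2.injective ?_⟩
      rw [hg]
      exact hy
  have main : ∀ i, i < δ → Ext i (fun j _ => s j) (s i) := by
    intro i
    induction i using WellFoundedLT.induction with
    | ind i ih =>
    intro hi
    have ih' : ∀ j < i, Ext j (fun j _ => s j) (s j) := fun j hj => ih j hj (hj.trans hi)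
    apply hsext
    rcases Ordinal.zero_or_succ_or_isSuccLimit i with rfl | ⟨a, rfl⟩ | hlim
    · exact ⟨dflt, ho0, fun j hj => absurd hj (not_lt_bot),
        fun h => absurd rfl h.ne_bot⟩
    · have ha : a < Order.succ a := Order.lt_succ a
      obtain ⟨o', g, hQ', hT'⟩ := hs a (s a).1 hi (ih' a ha).1
      obtain ⟨f', hf', hf''⟩ := exists_extend_injection hκ hUκ (hQc _ _ (ih' a ha).1)
        (hQc _ _ hQ') (s a).2 (s a).2.injective g g.injective
      refine ⟨⟨o', f', hf'⟩, hQ', fun j hj => ?_, fun h => absurd h (Order.not_isSuccLimit_succ a)⟩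
      rcases (Order.lt_succ_iff.1 hj).eq_or_lt with rfl | hj'
      · exact ⟨g, hT', hf''⟩
      · obtain ⟨k, hk, hk'⟩ := (ih' a ha).2.1 j hj'
        refine ⟨g.comp k, hcomp _ _ _ _ _ _ _ _ hj'.le ha.le hk hT', fun x => ?_⟩
        exact (hf'' _).trans (hk' x)
    · obtain ⟨S, hS, ι, hι, hιs⟩ := mkT i ih'
      obtain ⟨R, iR, e, he, hes⟩ := exists_colimit hlim S.map S.map_self S.map_map
      have hcard : #R ≤ κ := by
        have h1 : (Set.univ : Set R) = ⋃ j : Set.Iio i, Set.range (e j.1 j.2) := by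
          ext r
          simp only [Set.mem_univ, Set.mem_iUnion, true_iff]
          obtain ⟨j, hj, x, hx⟩ := hes r
          exact ⟨⟨j, hj⟩, x, hx⟩
        rw [← Cardinal.mk_univ, h1]
        exact mk_biUnion_ordinal_le hκ (hδ i hi) _ fun j =>
          Cardinal.mk_range_le.trans (hQc _ _ (S.good j.1 j.2))
      obtain ⟨o, φ, hφs, hQ', hT'⟩ := hl i hi hlim S R iR e he hes hcard
      choose J hJ y hy using hes
      have hιe : ∀ j (hj : j < i) x, ι (J (e j hj x)) (y (e j hj x)) = ι j x := by
        intro j hj x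
        rcases le_total (J (e j hj x)) j with hle | hle
        · rw [← hι _ _ hle hj]
          congr 1
          apply (e j hj).injective
          rw [he, hy]
        · rw [← hι _ _ hle (hJ _)]
          congr 1
          apply (e _ (hJ (e j hj x))).injective
          rw [he, hy]
      -- the injections of the earlier stages glue to one of the limit, carried over to `o` by `φ`
      let ψ : R ≃ car o := Equiv.ofBijective φ ⟨φ.injective, hφs⟩
      let f : car o → U := fun z => ι (J (ψ.symm z)) (y (ψ.symm z))
      have hfe : ∀ j (hj : j < i) x, f (φ (e j hj x)) = ι j x := by
        intro j hj x
        have : ψ.symm (φ (e j hj x)) = e j hj x := ψ.symm_apply_apply _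
        change ι (J (ψ.symm _)) (y (ψ.symm _)) = _
        rw [this]
        exact hιe j hj x
      have hz : ∀ z : car o, ∃ j, ∃ hj : j < i, ∃ x, φ (e j hj x) = z := by
        intro z
        obtain ⟨r, rfl⟩ := hφs z
        exact ⟨J r, hJ r, y r, by rw [hy]⟩
      have hf : Function.Injective f := by
        intro z z' h
        obtain ⟨j, hj, x, rfl⟩ := hz z
        obtain ⟨k, hk, x', rfl⟩ := hz z'
        rw [hfe, hfe] at h
        rcases le_total j k with hle | hle
        · rw [← hι _ _ hle hk] at h
          rw [← (ι k).injective h, he]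
        · rw [← hι _ _ hle hj] at h
          rw [(ι j).injective h, he]
      have hob : S.ob = fun j => (s j).1 := funext hS
      clear_value ψ
      obtain ⟨ob, map, good, tr, ms, mm, ct⟩ := S
      simp only at hob
      subst hob
      obtain rfl : ι = fun j => (s j).2 := funext fun j => eq_of_heq (hιs j)
      refine ⟨⟨o, f, hf⟩, hQ', fun j hj => ⟨φ.comp (e j hj), hT' j hj, fun x => hfe j hj x⟩,
        fun _ x => ?_⟩
      obtain ⟨j, hj, z, rfl⟩ := hz x
      exact ⟨j, hj, z, (hfe j hj z).symm⟩
  obtain ⟨S, -⟩ := mkT δ main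
  exact ⟨S⟩

end towers

/-! ### Galois types along strong embeddings -/

section types

variable {M M' N N' X A B : Type u} [L.Structure M] [L.Structure M'] [L.Structure N]
  [L.Structure N'] [L.Structure X] [L.Structure A] [L.Structure B]

/-- Restriction of a type along a strong embedding. -/
def GType.pull (p : K.GType M) (f : SEmb K M' M) : K.GType M' := p.restrict f.emb f.strong

/-- The Galois type of `a` over `M` along a strong embedding of `M`. -/
def SEmb.tp (i : SEmb K M N) (a : N) : K.GType M := K.gtp i.emb i.strong a

theorem GType.pull_pull (p : K.GType M) (f : SEmb K M' M) (h : SEmb K A M') :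
    (p.pull f).pull h = p.pull (f.comp h) := by
  induction p using Quot.ind
  rfl

@[simp] theorem SEmb.tp_pull (i : SEmb K M N) (a : N) (f : SEmb K M' M) :
    (i.tp a).pull f = (i.comp f).tp a := rfl

theorem GType.pull_refl (p : K.GType M) (h : K.Mem M) : p.pull (SEmb.refl h) = p := by
  induction p using Quot.ind
  rfl

theorem SEmb.tp_comp (g : SEmb K N N') (i : SEmb K M N) (a : N) :
    (g.comp i).tp (g a) = i.tp a := by
  apply Quot.sound
  exact ⟨N', inferInstance, (SEmb.refl g.mem_right).emb, g.emb, (SEmb.refl g.mem_right).strong,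
    g.strong, fun m => rfl, rfl⟩

theorem SEmb.tp_eq_of_comp (g : SEmb K N N') (i : SEmb K M N) (i' : SEmb K M N')
    (h : g.comp i = i') (a : N) : i'.tp (g a) = i.tp a := by
  rw [← h, tp_comp]

theorem GType.exists_tp (p : K.GType M) :
    ∃ (N : Type u) (_ : L.Structure N) (i : SEmb K M N) (a : N), i.tp a = p := by
  induction p using Quot.ind with
  | mk x => exact ⟨x.carrier, x.str, ⟨x.emb, x.strong⟩, x.pt, rfl⟩

theorem SEmb.exists_inverse (f : SEmb K M N) (h : Function.Surjective f) :
    ∃ k : SEmb K N M, (∀ x, f (k x) = x) ∧ ∀ x, k (f x) = x := by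
  obtain ⟨k, hk⟩ := SEmb.exists_factor f (SEmb.refl f.mem_right) (fun x => h x)
  have h1 : ∀ x, f (k x) = x := fun x => DFunLike.congr_fun hk x
  exact ⟨k, h1, fun x => f.injective (h1 _)⟩

theorem GType.pull_injective_of_surjective (f : SEmb K M' M) (h : Function.Surjective f)
    {p q : K.GType M} (hpq : p.pull f = q.pull f) : p = q := by
  obtain ⟨k, hk, -⟩ := f.exists_inverse h
  have h1 : f.comp k = SEmb.refl f.mem_right := SEmb.ext hk
  rw [← p.pull_refl f.mem_right, ← q.pull_refl f.mem_right, ← h1, ← GType.pull_pull, hpq,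
    GType.pull_pull]

/-- A model, as a strong submodel of given size containing a given set, in bundled form. -/
theorem SEmb.exists_small (hN : K.Mem N) {κ : Cardinal.{u}} (hκ : K.LS ≤ κ) (Y : Set N)
    (hY : #Y ≤ κ) (hκN : κ ≤ #N) : ∃ (V : Type u) (_ : L.Structure V) (h : SEmb K V N),
      #V = κ ∧ ∀ y ∈ Y, y ∈ h.range := by
  obtain ⟨S, h1, h2, h3⟩ := exists_strong_card hN hκ Y hY hκN
  exact ⟨S, inferInstance, SEmb.ofSub h2, h3, fun y hy => by
    rw [SEmb.range_ofSub]; exact h1 hy⟩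

end types

/-! ### The context: a good frame, amalgamation and tameness -/

/-- The standing assumptions: `s` is a good frame on the models of size `lam`, and the models with
sizes in `[lam, θ)` have amalgamation and are tame. -/
structure Ctx (K : AEC.{u} L) (s : K.Frame) (lam : Cardinal.{u}) (θ : WithTop Cardinal.{u}) :
    Prop where
  lt : (lam : WithTop Cardinal.{u}) < θ
  good : s.IsGood lam ((Order.succ lam : Cardinal.{u}) : WithTop Cardinal.{u})
  ap : K.Amalgamation lam θ
  tame : K.Tame lam θ

namespace Ctx

variable {s : K.Frame} {lam : Cardinal.{u}} {θ : WithTop Cardinal.{u}}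

section

variable {M M' N N' X A B : Type u} [L.Structure M] [L.Structure M'] [L.Structure N]
  [L.Structure N'] [L.Structure X] [L.Structure A] [L.Structure B]

theorem LS_le (H : Ctx K s lam θ) : K.LS ≤ lam := H.good.LS_le

theorem aleph0_le (H : Ctx K s lam θ) : ℵ₀ ≤ lam := (LS_spec K).1.trans H.good.LS_le

theorem inF_succ_iff : K.InF lam ((Order.succ lam : Cardinal.{u}) : WithTop Cardinal.{u}) M ↔
    K.Mem M ∧ #M = lam := by
  unfold InF
  rw [WithTop.coe_lt_coe, Order.lt_succ_iff]
  exact ⟨fun h => ⟨h.1, le_antisymm h.2.2 h.2.1⟩, fun h => ⟨h.1, h.2.ge, h.2.le⟩⟩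

/-- Amalgamation, with a bound on the size of the amalgam. -/
theorem amalg (H : Ctx K s lam θ) {κ : Cardinal.{u}} (hκ : (κ : WithTop Cardinal.{u}) < θ)
    (f : SEmb K X N) (f' : SEmb K X N') (hX : lam ≤ #X) (hN : #N ≤ κ) (hN' : #N' ≤ κ) :
    ∃ (W : Type u) (_ : L.Structure W) (g : SEmb K N W) (g' : SEmb K N' W),
      #W ≤ κ ∧ ∀ x, g (f x) = g' (f' x) := by
  have hlt : ∀ {c : Cardinal.{u}}, c ≤ κ → (c : WithTop Cardinal.{u}) < θ := fun h =>
    (WithTop.coe_le_coe.2 h).trans_lt hκ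
  obtain ⟨W, iW, g, g', hW, hg, hg', h⟩ := H.ap X N N' f.emb f'.emb
    ⟨f.mem_left, hX, hlt (f.mk_le.trans hN)⟩ ⟨f.mem_right, hX.trans f.mk_le, hlt hN⟩
    ⟨f'.mem_right, hX.trans f'.mk_le, hlt hN'⟩ f.strong f'.strong
  have hlam : lam ≤ κ := (hX.trans f.mk_le).trans hN
  have hinf := H.aleph0_le.trans hlam
  obtain ⟨S, h1, h2, h3⟩ := exists_strong_le hW.1 (H.LS_le.trans hlam)
    (Set.range g ∪ Set.range g')
    (mk_union_le_of_le hinf (Cardinal.mk_range_le.trans hN) (Cardinal.mk_range_le.trans hN'))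
  exact ⟨S, inferInstance, SEmb.lift ⟨g, hg⟩ h2 fun x => h1 (Or.inl ⟨x, rfl⟩),
    SEmb.lift ⟨g', hg'⟩ h2 fun x => h1 (Or.inr ⟨x, rfl⟩), h3, fun x => Subtype.ext (h x)⟩

/-- Any two small pointed submodels of representatives `x` and `y` amalgamate over `X`. -/
def SmallAmalg (K : AEC.{u} L) (X : Type u) [L.Structure X] (x y : K.PointedExt X) : Prop :=
  ∀ (V V' : Type u) [L.Structure V] [L.Structure V'] (f : SEmb K X V) (f' : SEmb K X V')
    (v : V) (v' : V') (h : SEmb K V x.carrier) (h' : SEmb K V' y.carrier), #V ≤ #X → #V' ≤ #X →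
    (∀ m, h (f m) = x.emb m) → h v = x.pt → (∀ m, h' (f' m) = y.emb m) → h' v' = y.pt →
    ∃ (W : Type u) (_ : L.Structure W) (g : SEmb K V W) (g' : SEmb K V' W), #W ≤ #X ∧
      (∀ m, g (f m) = g' (f' m)) ∧ g v = g' v'

theorem exists_shrink (H : Ctx K s lam θ) (i : SEmb K X N) (hX : lam ≤ #X) (a : N) :
    ∃ (V : Type u) (_ : L.Structure V) (f : SEmb K X V) (v : V) (h : SEmb K V N), #V ≤ #X ∧
      (∀ m, h (f m) = i m) ∧ h v = a := by
  have hinf := H.aleph0_le.trans hX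
  obtain ⟨S, h1, h2, h3⟩ := exists_strong_le i.mem_right (H.LS_le.trans hX) (Set.range i ∪ {a})
    (mk_union_le_of_le hinf Cardinal.mk_range_le
      (by rw [Cardinal.mk_singleton]; exact Cardinal.one_le_aleph0.trans hinf))
  exact ⟨S, inferInstance, i.lift h2 fun x => h1 (Or.inl ⟨x, rfl⟩), ⟨a, h1 (Or.inr rfl)⟩,
    SEmb.ofSub h2, h3, fun m => rfl, rfl⟩

theorem smallAmalg_of_eqvGen (H : Ctx K s lam θ) (hX : lam ≤ #X)
    (hXθ : ((#X : Cardinal.{u}) : WithTop Cardinal.{u}) < θ) {x y : K.PointedExt X}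
    (h : Relation.EqvGen (K.AtEq X) x y) : SmallAmalg K X x y := by
  have hinf := H.aleph0_le.trans hX
  -- amalgams inside a common extension may be cut down by the Löwenheim–Skolem theorem
  have inside : ∀ {V V' W : Type u} [L.Structure V] [L.Structure V'] [L.Structure W]
      (f : SEmb K X V) (f' : SEmb K X V') (v : V) (v' : V') (k : SEmb K V W) (k' : SEmb K V' W),
      #V ≤ #X → #V' ≤ #X → (∀ m, k (f m) = k' (f' m)) → k v = k' v' →
      ∃ (W : Type u) (_ : L.Structure W) (g : SEmb K V W) (g' : SEmb K V' W), #W ≤ #X ∧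
        (∀ m, g (f m) = g' (f' m)) ∧ g v = g' v' := by
    intro V V' W _ _ _ f f' v v' k k' hV hV' hk hv
    obtain ⟨S, h1, h2, h3⟩ := exists_strong_le k.mem_right (H.LS_le.trans hX)
      (Set.range k ∪ Set.range k')
      (mk_union_le_of_le hinf (Cardinal.mk_range_le.trans hV) (Cardinal.mk_range_le.trans hV'))
    exact ⟨S, inferInstance, k.lift h2 fun x => h1 (Or.inl ⟨x, rfl⟩),
      k'.lift h2 fun x => h1 (Or.inr ⟨x, rfl⟩), h3, fun x => Subtype.ext (hk x), Subtype.ext hv⟩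
  induction h with
  | rel x y h =>
    obtain ⟨W, iW, g, g', hg, hg', h, hp⟩ := h
    intro V V' _ _ f f' v v' k k' hV hV' hkf hkv hkf' hkv'
    refine inside f f' v v' (SEmb.comp ⟨g, hg⟩ k) (SEmb.comp ⟨g', hg'⟩ k') hV hV' ?_ ?_
    · intro m
      simp only [SEmb.comp_apply, hkf, hkf']
      exact h m
    · simp only [SEmb.comp_apply, hkv, hkv']
      exact hp
  | refl x =>
    intro V V' _ _ f f' v v' k k' hV hV' hkf hkv hkf' hkv'
    exact inside f f' v v' k k' hV hV' (fun m => (hkf m).trans (hkf' m).symm) (hkv.trans hkv'.symm)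
  | symm x y _ ih =>
    intro V V' _ _ f f' v v' k k' hV hV' hkf hkv hkf' hkv'
    obtain ⟨W, iW, g, g', hW, h1, h2⟩ := ih V' V f' f v' v k' k hV' hV hkf' hkv' hkf hkv
    exact ⟨W, iW, g', g, hW, fun m => (h1 m).symm, h2.symm⟩
  | trans x y z _ _ ih1 ih2 =>
    intro V V' _ _ f f' v v' k k' hV hV' hkf hkv hkf' hkv'
    obtain ⟨U, iU, fU, u, kU, hU, hkfU, hkU⟩ := H.exists_shrink ⟨y.emb, y.strong⟩ hX y.pt
    obtain ⟨W₁, iW₁, g₁, g₁', hW₁, h1, h1'⟩ := ih1 V U f fU v u k kU hV hU hkf hkv hkfU hkU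
    obtain ⟨W₂, iW₂, g₂, g₂', hW₂, h2, h2'⟩ := ih2 U V' fU f' u v' kU k' hU hV' hkfU hkU hkf' hkv'
    obtain ⟨W, iW, g, g', hW, hg⟩ := H.amalg hXθ g₁' g₂ (hX.trans fU.mk_le) hW₁ hW₂
    refine ⟨W, iW, g.comp g₁, g'.comp g₂', hW, fun m => ?_, ?_⟩
    · simp only [SEmb.comp_apply, h1, ← h2, hg]
    · simp only [SEmb.comp_apply, h1', ← h2', hg]

/-- Elements with the same type over `X` are identified in an amalgam over `X`. -/
theorem amalg_of_tp_eq (H : Ctx K s lam θ) {κ : Cardinal.{u}}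
    (hκ : (κ : WithTop Cardinal.{u}) < θ) (i : SEmb K X N) (i' : SEmb K X N') (hX : lam ≤ #X)
    (hN : #N ≤ κ) (hN' : #N' ≤ κ) {a : N} {a' : N'} (h : i.tp a = i'.tp a') :
    ∃ (W : Type u) (_ : L.Structure W) (g : SEmb K N W) (g' : SEmb K N' W),
      #W ≤ κ ∧ (∀ x, g (i x) = g' (i' x)) ∧ g a = g' a' := by
  have hXκ : #X ≤ κ := i.mk_le.trans hN
  have hXθ : ((#X : Cardinal.{u}) : WithTop Cardinal.{u}) < θ :=
    (WithTop.coe_le_coe.2 hXκ).trans_lt hκ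
  have hs := H.smallAmalg_of_eqvGen hX hXθ (Quot.eqvGen_exact h)
  obtain ⟨V, iV, f, v, k, hV, hkf, hkv⟩ := H.exists_shrink i hX a
  obtain ⟨V', iV', f', v', k', hV', hkf', hkv'⟩ := H.exists_shrink i' hX a'
  obtain ⟨W, iW, g, g', hW, hg, hgv⟩ := hs V V' f f' v v' k k' hV hV' hkf hkv hkf' hkv'
  obtain ⟨W₁, iW₁, g₁, g₁', hW₁, h1⟩ := H.amalg hκ k g (hX.trans f.mk_le) hN (hW.trans hXκ)
  obtain ⟨W₂, iW₂, g₂, g₂', hW₂, h2⟩ := H.amalg hκ k' (g₁'.comp g') (hX.trans f'.mk_le) hN' hW₁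
  refine ⟨W₂, iW₂, g₂'.comp g₁, g₂, hW₂, fun x => ?_, ?_⟩
  · simp only [SEmb.comp_apply]
    rw [← hkf, ← hkf', h1, h2, hg]
    rfl
  · simp only [SEmb.comp_apply]
    rw [← hkv, ← hkv', h1, h2, hgv]
    rfl

/-! ### Nonforking over models of size `lam` -/

/-- Monotonicity in the type and in the base. -/
theorem dnf_mono (H : Ctx K s lam θ) {p : K.GType M} (d : SEmb K A M) (c : SEmb K A B)
    (d' : SEmb K B M') (m : SEmb K M' M) (h : ∀ x, m (d' (c x)) = d x)
    (hp : s.DoesNotFork p d.range) : s.DoesNotFork (p.pull m) d'.range := by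
  obtain ⟨x, rfl, hx⟩ := hp
  refine ⟨_, rfl, ?_⟩
  let i : SEmb K M x.carrier := ⟨x.emb, x.strong⟩
  have hr : d.range.map x.emb.toHom = (i.comp d).range := (SEmb.range_comp i d).symm
  have hr' : d'.range.map (x.emb.comp m.emb).toHom = ((i.comp m).comp d').range :=
    (SEmb.range_comp (i.comp m) d').symm
  have hm : (x.emb.comp m.emb).toHom.range = (i.comp m).range := rfl
  have hdom := H.good.nf_dom _ _ _ hx
  have hup := H.good.mono_up (d.range.map x.emb.toHom) ((i.comp m).comp d').range
    (i.comp m).range x.emb.toHom.range x.pt (SEmb.refl i.mem_right).emb hx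
    (by
      rw [hr, Strong.le_iff (i.comp d).strong_range (SEmb.strong_range _)]
      rintro _ ⟨y, rfl⟩
      exact ⟨c y, congrArg x.emb (h y)⟩)
    (by
      rw [Strong.le_iff (SEmb.strong_range _) (SEmb.strong_range _)]
      rintro _ ⟨y, rfl⟩
      exact ⟨d' y, rfl⟩)
    (by
      rw [Strong.le_iff (SEmb.strong_range _) i.strong_range]
      rintro _ ⟨y, rfl⟩
      exact ⟨m y, rfl⟩)
    (SEmb.refl i.mem_right).strong hdom.2.2.1
  have hid : ∀ S : L.Substructure x.carrier, S.map (SEmb.refl i.mem_right).emb.toHom = S := by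
    intro S
    ext z
    exact ⟨fun ⟨w, hw, h⟩ => h ▸ hw, fun hz => ⟨z, hz, rfl⟩⟩
  rw [hid, hid] at hup
  rw [← hr'] at hup
  exact hup

theorem dnf_mem_left (H : Ctx K s lam θ) {p : K.GType M} {M₀ : L.Substructure M}
    (hp : s.DoesNotFork p M₀) : K.Mem M ∧ #M = lam := by
  obtain ⟨x, rfl, hx⟩ := hp
  have h := inF_succ_iff.1 (H.good.nf_dom _ _ _ hx).2.1
  let i : SEmb K M x.carrier := ⟨x.emb, x.strong⟩
  exact ⟨i.mem_left, by rw [← h.2]; exact i.mk_range.symm⟩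

theorem dnf_bs (H : Ctx K s lam θ) {p : K.GType M} (d : SEmb K A M)
    (hp : s.DoesNotFork p d.range) : p ∈ s.bs M := by
  have hM := H.dnf_mem_left hp
  have h1 := H.dnf_mono d d (SEmb.refl hM.1) (SEmb.refl hM.1) (fun _ => rfl) hp
  rw [GType.pull_refl] at h1
  obtain ⟨x, rfl, hx⟩ := h1
  let i : SEmb K M x.carrier := ⟨x.emb, x.strong⟩
  have hr : (SEmb.refl hM.1).range.map x.emb.toHom = x.emb.toHom.range := by
    ext z
    constructor
    · rintro ⟨y, -, rfl⟩
      exact ⟨y, rfl⟩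
    · rintro ⟨y, rfl⟩
      exact ⟨y, ⟨y, rfl⟩, rfl⟩
  rw [hr] at hx
  have h2 := H.good.bs_of_nf _ x.strong _ hx
  refine H.good.bs_iso _ (strongEmb_subtype x.strong) x.emb x.strong x.emb.equivRange.symm
    (FirstOrder.Language.Equiv.refl L _) ?_ x.pt h2
  intro m
  change (m : x.carrier) = x.emb (x.emb.equivRange.symm m)
  rw [← FirstOrder.Language.Embedding.equivRange_apply, x.emb.equivRange.apply_symm_apply]

/-- Nonforking is invariant under isomorphism. -/
theorem dnf_pull_of_surjective {p : K.GType M} {M₀ : L.Substructure M}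
    (hp : s.DoesNotFork p M₀) (k : SEmb K M' M) (hk : Function.Surjective k) :
    s.DoesNotFork (p.pull k) (M₀.comap k.emb.toHom) := by
  obtain ⟨x, rfl, hx⟩ := hp
  refine ⟨_, rfl, ?_⟩
  have h1 : (M₀.comap k.emb.toHom).map (x.emb.comp k.emb).toHom = M₀.map x.emb.toHom := by
    ext z
    constructor
    · rintro ⟨y, hy, rfl⟩
      exact ⟨k y, hy, rfl⟩
    · rintro ⟨y, hy, rfl⟩
      obtain ⟨y, rfl⟩ := hk y
      exact ⟨y, hy, rfl⟩
  have h2 : (x.emb.comp k.emb).toHom.range = x.emb.toHom.range := by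
    ext z
    constructor
    · rintro ⟨y, rfl⟩
      exact ⟨k y, rfl⟩
    · rintro ⟨y, rfl⟩
      obtain ⟨y, rfl⟩ := hk y
      exact ⟨y, rfl⟩
  change s.nf _ (x.emb.comp k.emb).toHom.range x.pt
  rw [h2]
  exact h1 ▸ hx

theorem bs_pull_of_surjective (H : Ctx K s lam θ) {p : K.GType M} (hp : p ∈ s.bs M)
    (k : SEmb K M' M) (hk : Function.Surjective k) : p.pull k ∈ s.bs M' := by
  obtain ⟨N, iN, i, a, rfl⟩ := p.exists_tp
  obtain ⟨e, he, he'⟩ : ∃ e : M ≃[L] M', (∀ m, k (e m) = m) ∧ ∀ m, e (k m) = m := by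
    obtain ⟨k', h1, h2⟩ := k.exists_inverse hk
    refine ⟨⟨⟨k', k, h1, h2⟩, fun f x => k'.emb.map_fun f x, fun r x => k'.emb.map_rel r x⟩,
      h1, h2⟩
  refine H.good.bs_iso i.emb i.strong (i.comp k).emb (i.comp k).strong e
    (FirstOrder.Language.Equiv.refl L _) ?_ a hp
  intro m
  change i m = i (k (e m))
  rw [he]

/-- The inverse of a strong embedding, on its range. -/
theorem exists_range_inverse (d : SEmb K A M) : ∃ k : SEmb K d.range A, Function.Surjective k ∧
    d.comp k = SEmb.ofSub d.strong_range := by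
  obtain ⟨k, hk⟩ := SEmb.exists_factor d (SEmb.ofSub d.strong_range) fun x => x.2
  refine ⟨k, fun x => ⟨⟨d x, x, rfl⟩, d.injective ?_⟩, hk⟩
  exact DFunLike.congr_fun hk _

theorem dnf_uniq (H : Ctx K s lam θ) {p q : K.GType M} (d : SEmb K A M)
    (hp : s.DoesNotFork p d.range) (hq : s.DoesNotFork q d.range) (h : p.pull d = q.pull d) :
    p = q := by
  obtain ⟨k, -, hk⟩ := exists_range_inverse d
  refine H.good.uniqueness d.range d.strong_range p q hp hq ?_
  change p.pull (SEmb.ofSub d.strong_range) = q.pull (SEmb.ofSub d.strong_range)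
  rw [← hk, ← GType.pull_pull, h, GType.pull_pull]

theorem dnf_trans (H : Ctx K s lam θ) {p : K.GType M} (d : SEmb K B M) (c : SEmb K A B)
    (hp : s.DoesNotFork p d.range) (hpd : s.DoesNotFork (p.pull d) c.range) :
    s.DoesNotFork p (d.comp c).range := by
  obtain ⟨k, hks, hk⟩ := exists_range_inverse d
  refine H.good.transitivity (d.comp c).range d.range d.strong_range ?_ p hp ?_
  · rw [Strong.le_iff (SEmb.strong_range _) d.strong_range]
    rintro _ ⟨y, rfl⟩
    exact ⟨c y, rfl⟩
  · have h1 := dnf_pull_of_surjective hpd k hks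
    rw [GType.pull_pull, hk] at h1
    suffices hS : (d.comp c).range.comap d.range.subtype.toHom = c.range.comap k.emb.toHom by
      rw [hS]
      exact h1
    ext z
    have hz : d (k z) = (z : M) := DFunLike.congr_fun hk z
    constructor
    · rintro ⟨y, hy⟩
      refine ⟨y, d.injective ?_⟩
      exact Eq.trans hy hz.symm
    · rintro ⟨y, hy⟩
      refine ⟨y, ?_⟩
      exact (congrArg d hy).trans hz

theorem dnf_exists (H : Ctx K s lam θ) {p : K.GType A} (hp : p ∈ s.bs A) (d : SEmb K A M)
    (hM : #M = lam) : ∃ q : K.GType M, s.DoesNotFork q d.range ∧ q.pull d = p := by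
  obtain ⟨k, hks, hk⟩ := exists_range_inverse d
  obtain ⟨q, -, h1, h2⟩ := H.good.existence d.range d.strong_range
    (inF_succ_iff.2 ⟨d.mem_right, hM⟩) _ (H.bs_pull_of_surjective hp k hks)
  refine ⟨q, h1, ?_⟩
  have h3 : q.pull (SEmb.ofSub d.strong_range) = p.pull k := h2
  rw [← hk, ← GType.pull_pull] at h3
  exact GType.pull_injective_of_surjective k hks h3

end

/-! ### Free types -/

section free

variable {A B X Y M : Type u} [L.Structure A] [L.Structure B] [L.Structure X] [L.Structure Y]
  [L.Structure M]

/-- The type `p` over `X` is free over `A`, a model of size `lam` embedded in `X` by `e`: its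
restrictions to the submodels of `X` of size `lam` that contain `A` do not fork over `A`. -/
def Fr (s : K.Frame) (lam : Cardinal.{u}) (e : SEmb K A X) (p : K.GType X) : Prop :=
  #A = lam ∧ ∀ (M : Type u) [L.Structure M] (m : SEmb K M X) (d : SEmb K A M), #M = lam →
    m.comp d = e → s.DoesNotFork (p.pull m) d.range

theorem Fr.pull {j : SEmb K Y X} {e : SEmb K A Y} {p : K.GType X}
    (h : Fr s lam (j.comp e) p) : Fr s lam e (p.pull j) :=
  ⟨h.1, fun M _ m d hM hd => by
    rw [GType.pull_pull]
    exact h.2 M (j.comp m) d hM (by rw [SEmb.comp_assoc, hd])⟩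

theorem Fr.base (H : Ctx K s lam θ) {c : SEmb K A B} {e : SEmb K B X} {p : K.GType X}
    (h : Fr s lam (e.comp c) p) (hB : #B = lam) : Fr s lam e p :=
  ⟨hB, fun M _ m d hM hd => by
    have h1 := h.2 M m (d.comp c) hM (by rw [← SEmb.comp_assoc, hd])
    have h2 := H.dnf_mono (d.comp c) c d (SEmb.refl m.mem_left) (fun _ => rfl) h1
    rwa [GType.pull_refl] at h2⟩

theorem fr_iff (H : Ctx K s lam θ) {e : SEmb K A X} {p : K.GType X} (hA : #A = lam)
    (hX : #X = lam) : Fr s lam e p ↔ s.DoesNotFork p e.range := by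
  constructor
  · intro h
    have h1 := h.2 X (SEmb.refl e.mem_right) e hX rfl
    rwa [GType.pull_refl] at h1
  · intro h
    refine ⟨hA, fun M _ m d hM hd => ?_⟩
    subst hd
    exact H.dnf_mono (m.comp d) (SEmb.refl d.mem_left) d m (fun _ => rfl) h

/-- A submodel of `X` of size `lam` containing given small submodels. -/
theorem exists_common (H : Ctx K s lam θ) (e : SEmb K A X) (f : SEmb K B X) (hA : #A ≤ lam)
    (hB : #B ≤ lam) (hX : lam ≤ #X) (D : Set X) (hD : #D ≤ lam) :
    ∃ (M : Type u) (_ : L.Structure M) (m : SEmb K M X) (d : SEmb K A M) (d' : SEmb K B M),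
      #M = lam ∧ m.comp d = e ∧ m.comp d' = f ∧ ∀ x ∈ D, x ∈ m.range := by
  obtain ⟨M, iM, m, hM, hm⟩ := SEmb.exists_small e.mem_right H.LS_le
    ((Set.range e ∪ Set.range f) ∪ D) (mk_union_le_of_le H.aleph0_le (mk_union_le_of_le H.aleph0_le
      (Cardinal.mk_range_le.trans hA) (Cardinal.mk_range_le.trans hB)) hD) hX
  obtain ⟨d, hd⟩ := SEmb.exists_factor m e fun x => hm _ (Or.inl (Or.inl ⟨x, rfl⟩))
  obtain ⟨d', hd'⟩ := SEmb.exists_factor m f fun x => hm _ (Or.inl (Or.inr ⟨x, rfl⟩))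
  exact ⟨M, iM, m, d, d', hM, hd, hd', fun x hx => hm _ (Or.inr hx)⟩

theorem Fr.le (h : Fr s lam (A := A) (X := X) e p) : lam ≤ #X := h.1 ▸ e.mk_le

/-- Free extensions are unique. By tameness it suffices to compare restrictions to models of
size `lam`. -/
theorem Fr.uniq (H : Ctx K s lam θ) {e : SEmb K A X} {p q : K.GType X}
    (hX : ((#X : Cardinal.{u}) : WithTop Cardinal.{u}) < θ) (hp : Fr s lam e p)
    (hq : Fr s lam e q) (h : p.pull e = q.pull e) : p = q := by
  by_contra hne
  obtain ⟨S, hS, hSc, hS'⟩ := H.tame X ⟨e.mem_right, H.LS_le.trans hp.le, hX⟩ p q hne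
  obtain ⟨M, iM, m, d, d', hM, hd, hd', -⟩ := H.exists_common e (SEmb.ofSub hS) hp.1.le hSc
    hp.le ∅ (by simp)
  apply hS'
  change p.pull (SEmb.ofSub hS) = q.pull (SEmb.ofSub hS)
  rw [← hd', ← GType.pull_pull, ← GType.pull_pull q]
  congr 1
  refine H.dnf_uniq d (hp.2 M m d hM hd) (hq.2 M m d hM hd) ?_
  rw [GType.pull_pull, GType.pull_pull, hd, h]

/-- Transitivity of freeness. -/
theorem Fr.trans (H : Ctx K s lam θ) {j : SEmb K X Y} {e' : SEmb K B X} {e : SEmb K A X}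
    {p : K.GType Y} (hp : Fr s lam (j.comp e') p) (hpj : Fr s lam e (p.pull j)) :
    Fr s lam (j.comp e) p := by
  refine ⟨hpj.1, fun M _ m d hM hd => ?_⟩
  obtain ⟨X₀, _, x₀, dA, dB, hX₀, hdA, hdB, -⟩ := H.exists_common e e' hpj.1.le hp.1.le hpj.le
    ∅ (by simp)
  obtain ⟨M', _, m', dX, dM, hM', hdX, hdM, -⟩ := H.exists_common (j.comp x₀) m hX₀.le hM.le hp.le
    ∅ (by simp)
  have h1 := hp.2 M' m' (dX.comp dB) hM' (by rw [← SEmb.comp_assoc, hdX, SEmb.comp_assoc, hdB])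
  have h2 := H.dnf_mono (dX.comp dB) dB dX (SEmb.refl m'.mem_left) (fun _ => rfl) h1
  rw [GType.pull_refl] at h2
  have h3 := hpj.2 X₀ x₀ dA hX₀ hdA
  have h4 := H.dnf_trans dX dA h2 (by rwa [GType.pull_pull, hdX, ← GType.pull_pull])
  have h5 := H.dnf_mono (dX.comp dA) (SEmb.refl d.mem_left) d dM (fun x => by
    apply m'.injective
    have e1 : m' (dM (d x)) = m (d x) := DFunLike.congr_fun hdM _
    have e2 : m (d x) = j (e x) := DFunLike.congr_fun hd x
    have e3 : m' (dX (dA x)) = j (x₀ (dA x)) := DFunLike.congr_fun hdX _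
    have e4 : x₀ (dA x) = e x := DFunLike.congr_fun hdA _
    change m' (dM (d x)) = m' (dX (dA x))
    rw [e1, e2, e3, e4]) h4
  rwa [GType.pull_pull, hdM] at h5

end free

end Ctx

/-! ### Chains of submodels: local character, continuity, density -/

/-- `⟨C i : i < δ⟩` is an increasing continuous chain of strong submodels of `X`, `δ` is a limit
ordinal, and the union of the chain is `X`. -/
structure Chain (K : AEC.{u} L) {X : Type u} [L.Structure X] (δ : Ordinal.{u})
    (C : Ordinal.{u} → L.Substructure X) : Prop where
  lim : Order.IsSuccLimit δ
  strong : ∀ i < δ, K.Strong (C i)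
  mono : ∀ i j, i ≤ j → j < δ → C i ≤ C j
  cont : ∀ i < δ, Order.IsSuccLimit i → ∀ x ∈ C i, ∃ j < i, x ∈ C j
  top : ∀ x, ∃ i < δ, x ∈ C i

namespace Ctx

variable {s : K.Frame} {lam : Cardinal.{u}} {θ : WithTop Cardinal.{u}}

section

variable {A X Y N : Type u} [L.Structure A] [L.Structure X] [L.Structure Y] [L.Structure N]

open Classical in
/-- The trace on `Y` of a chain `S` of submodels of `X`, where `Y` is embedded in `X` by `y`. -/
noncomputable def trace (δ : Ordinal.{u}) (y : SEmb K Y X) (S : Ordinal.{u} → L.Substructure X)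
    (i : Ordinal.{u}) : L.Substructure Y := if i < δ then (S i).comap y.emb.toHom else ⊤

theorem mem_trace {δ : Ordinal.{u}} {y : SEmb K Y X} {S : Ordinal.{u} → L.Substructure X}
    {i : Ordinal.{u}} (hi : i < δ) {z : Y} : z ∈ trace δ y S i ↔ y z ∈ S i := by
  rw [trace, if_pos hi]
  rfl

theorem trace_of_not_lt {δ : Ordinal.{u}} {y : SEmb K Y X} {S : Ordinal.{u} → L.Substructure X}
    {i : Ordinal.{u}} (hi : ¬ i < δ) : trace δ y S i = ⊤ := if_neg hi

theorem strong_trace {δ : Ordinal.{u}} (y : SEmb K Y X) (S : Ordinal.{u} → L.Substructure X)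
    (hS : ∀ i < δ, K.Strong (S i)) (hle : ∀ i < δ, S i ≤ y.range) (i : Ordinal.{u}) :
    K.Strong (trace δ y S i) := by
  by_cases hi : i < δ
  · rw [trace, if_pos hi]
    exact y.strong_comap (hS i hi) (hle i hi)
  · rw [trace, if_neg hi]
    exact K.strong_top y.mem_left

theorem isChain_trace {δ : Ordinal.{u}} (y : SEmb K Y X)
    (S : Ordinal.{u} → L.Substructure X) (hS : ∀ i < δ, K.Strong (S i))
    (hle : ∀ i < δ, S i ≤ y.range) (hm : ∀ i j, i ≤ j → j < δ → S i ≤ S j)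
    (hc : ∀ i < δ, Order.IsSuccLimit i → ∀ x ∈ S i, ∃ j < i, x ∈ S j)
    (ht : ∀ z, ∃ i < δ, y z ∈ S i) (hcard : ∀ i < δ, #(S i) = lam) (hY : #Y = lam) :
    K.IsChain lam ((Order.succ lam : Cardinal.{u}) : WithTop Cardinal.{u}) δ (trace δ y S) := by
  have hst := strong_trace y S hS hle
  have hmono : ∀ i j, i ≤ j → j ≤ δ → trace δ y S i ≤ trace δ y S j := by
    intro i j hij hj
    by_cases hjδ : j < δ
    · intro z hz
      rw [mem_trace (hij.trans_lt hjδ)] at hz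
      rw [mem_trace hjδ]
      exact hm i j hij hjδ hz
    · rw [trace_of_not_lt hjδ]
      exact le_top
  refine ⟨fun i hi => inF_succ_iff.2 ⟨(hst i).mem, ?_⟩, fun i _ => hst i, hmono, ?_,
    trace_of_not_lt (lt_irrefl _)⟩
  · by_cases hiδ : i < δ
    · rw [← hcard i hiδ]
      refine Cardinal.mk_congr (Equiv.ofBijective
        (fun z : trace δ y S i => (⟨y z.1, (mem_trace hiδ).1 z.2⟩ : S i)) ⟨?_, ?_⟩)
      · intro a b h
        exact Subtype.ext (y.injective (congrArg Subtype.val h))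
      · rintro ⟨x, hx⟩
        obtain ⟨z, rfl⟩ := hle i hiδ hx
        exact ⟨⟨z, (mem_trace hiδ).2 hx⟩, rfl⟩
    · rw [trace_of_not_lt hiδ, ← hY]
      exact Cardinal.mk_univ
  · intro i hi hlim
    apply Set.Subset.antisymm
    · intro z hz
      rw [Set.mem_iUnion₂]
      rcases hi.lt_or_eq with hiδ | rfl
      · obtain ⟨j, hj, hzj⟩ := hc i hiδ hlim _ ((mem_trace hiδ).1 hz)
        exact ⟨j, hj, (mem_trace (hj.trans hiδ)).2 hzj⟩
      · obtain ⟨j, hj, hzj⟩ := ht z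
        exact ⟨j, hj, (mem_trace hj).2 hzj⟩
    · exact Set.iUnion₂_subset fun j hj => hmono j i hj.le hi

/-- A small set is contained in a submodel of size `lam` on which a given chain induces a chain of
models of size `lam`. -/
theorem exists_small_chain (H : Ctx K s lam θ) {δ : Ordinal.{u}}
    {C : Ordinal.{u} → L.Substructure X} (hC : Chain K δ C) (h0 : lam ≤ #(C 0)) (D : Set X)
    (hD : #D ≤ lam) :
    ∃ (Y : Type u) (_ : L.Structure Y) (y : SEmb K Y X) (C' : Ordinal.{u} → L.Substructure Y),
      #Y = lam ∧ (∀ x ∈ D, x ∈ y.range) ∧ (∀ i, K.Strong (C' i)) ∧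
      K.IsChain lam ((Order.succ lam : Cardinal.{u}) : WithTop Cardinal.{u}) δ C' ∧
      ∀ i < δ, ∀ z, z ∈ C' i ↔ y z ∈ C i := by
  have hX : K.Mem X := (K.mem_of_strong _ (hC.strong 0 hC.lim.bot_lt)).2
  obtain ⟨F, hF, hcl⟩ := exists_skolem_chain hX δ C hC.strong hC.mono
  obtain ⟨E, hE, hEc⟩ := Cardinal.le_mk_iff_exists_subset.1 h0
  have hcard : #(hull F (D ∪ E)) ≤ lam :=
    mk_hull_le H.aleph0_le (fun t => (hF t).trans H.LS_le)
      (mk_union_le_of_le H.aleph0_le hD hEc.le)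
  obtain ⟨S, hS, hSs, hSC⟩ := hcl _ (cl_hull F (D ∪ E))
  have hsub : D ∪ E ⊆ S := hS ▸ subset_hull F (D ∪ E)
  have hScard : #S = lam := by
    refine le_antisymm ?_ ?_
    · have : #(S : Set X) ≤ lam := by rw [hS]; exact hcard
      exact this
    · rw [← hEc]
      exact Cardinal.mk_le_mk_of_subset (Set.subset_union_right.trans hsub)
  refine ⟨S, inferInstance, SEmb.ofSub hSs, trace δ (SEmb.ofSub hSs) (fun i => S ⊓ C i), hScard,
    fun x hx => by rw [SEmb.range_ofSub]; exact hsub (Or.inl hx),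
    strong_trace _ _ hSC fun i hi => by rw [SEmb.range_ofSub]; exact inf_le_left,
    isChain_trace _ _ hSC (fun i hi => by rw [SEmb.range_ofSub]; exact inf_le_left)
      (fun i j hij hj => inf_le_inf_left S (hC.mono i j hij hj)) ?_ ?_ ?_ hScard, ?_⟩
  · rintro i hi hlim x ⟨hxS, hx⟩
    obtain ⟨j, hj, hxj⟩ := hC.cont i hi hlim x hx
    exact ⟨j, hj, hxS, hxj⟩
  · intro z
    obtain ⟨i, hi, hz⟩ := hC.top z.1
    exact ⟨i, hi, z.2, hz⟩
  · intro i hi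
    refine le_antisymm ?_ ?_
    · rw [← hScard]
      exact Cardinal.mk_le_mk_of_subset fun x hx => hx.1
    · rw [← hEc]
      exact Cardinal.mk_le_mk_of_subset fun x hx =>
        ⟨hsub (Or.inr hx), hC.mono 0 i zero_le hi (hE hx)⟩
  · intro i hi z
    rw [mem_trace hi]
    exact ⟨fun h => h.2, fun h => ⟨z.2, h⟩⟩

/-- Local character. -/
theorem Fr.exists_base_in_chain (H : Ctx K s lam θ) {δ : Ordinal.{u}}
    {C : Ordinal.{u} → L.Substructure X} (hC : Chain K δ C) (h0 : lam ≤ #(C 0)) {e : SEmb K A X}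
    {p : K.GType X} (hp : Fr s lam e p) :
    ∃ i, ∃ hi : i < δ, ∃ (B : Type u) (_ : L.Structure B) (e' : SEmb K B (C i)),
      Fr s lam ((SEmb.ofSub (hC.strong i hi)).comp e') p := by
  obtain ⟨Y, _, y, C', hY, hDy, hst, hch, hmem⟩ := H.exists_small_chain hC h0 (Set.range e)
    (Cardinal.mk_range_le.trans hp.1.le)
  obtain ⟨k, hk⟩ := SEmb.exists_factor y e fun x => hDy _ ⟨x, rfl⟩
  have h1 : Fr s lam y p := Fr.base H (c := k) (by rwa [hk]) hY
  have h2 : Fr s lam k (p.pull y) := Fr.pull (by rwa [hk])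
  have h3 := H.dnf_bs k ((fr_iff H hp.1 hY).1 h2)
  obtain ⟨i, hi, h4⟩ := H.good.localCharacter δ hC.lim C' hch _ h3
  obtain ⟨e', he'⟩ := SEmb.exists_factor (SEmb.ofSub (hC.strong i hi)) (y.comp (SEmb.ofSub (hst i)))
    (fun x => by rw [SEmb.range_ofSub]; exact (hmem i hi x).1 x.2)
  refine ⟨i, hi, C' i, inferInstance, e', ?_⟩
  rw [he']
  have hcard : #(C' i) = lam := (inF_succ_iff.1 (hch.inF i hi.le)).2
  refine Fr.trans H (e' := SEmb.refl y.mem_left) (by rwa [SEmb.comp_refl]) ?_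
  rw [fr_iff H hcard hY, SEmb.range_ofSub]
  exact h4

/-- Continuity: freeness is preserved by unions of chains. -/
theorem Fr.of_chain (H : Ctx K s lam θ) {δ : Ordinal.{u}}
    {C : Ordinal.{u} → L.Substructure X} (hC : Chain K δ C) {e : SEmb K A X}
    {p : K.GType X} (he : ∀ a, e a ∈ C 0)
    (hp : ∀ i (hi : i < δ) (e' : SEmb K A (C i)), (SEmb.ofSub (hC.strong i hi)).comp e' = e →
      Fr s lam e' (p.pull (SEmb.ofSub (hC.strong i hi)))) : Fr s lam e p := by
  have hfac : ∀ i (hi : i < δ), ∃ e' : SEmb K A (C i),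
      (SEmb.ofSub (hC.strong i hi)).comp e' = e := fun i hi =>
    ⟨e.lift (hC.strong i hi) fun x => hC.mono 0 i zero_le hi (he x), rfl⟩
  have hA : #A = lam := by
    obtain ⟨e', he'⟩ := hfac 0 hC.lim.bot_lt
    exact (hp 0 hC.lim.bot_lt e' he').1
  have h0 : lam ≤ #(C 0) := by
    obtain ⟨e', he'⟩ := hfac 0 hC.lim.bot_lt
    exact hA ▸ e'.mk_le
  refine ⟨hA, fun M _ m d hM hd => ?_⟩
  obtain ⟨Y, _, y, C', hY, hDy, hst, hch, hmem⟩ := H.exists_small_chain hC h0 (Set.range m)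
    (Cardinal.mk_range_le.trans hM.le)
  obtain ⟨k, hk⟩ := SEmb.exists_factor y m fun x => hDy _ ⟨x, rfl⟩
  have hcard : ∀ i ≤ δ, #(C' i) = lam := fun i hi => (inF_succ_iff.1 (hch.inF i hi)).2
  have hkd : ∀ i < δ, ∀ a, (k.comp d) a ∈ C' i := by
    intro i hi a
    change k (d a) ∈ C' i
    rw [hmem i hi]
    have h1 : y (k (d a)) = e a := by
      rw [← hd, ← hk]
      rfl
    rw [h1]
    exact hC.mono 0 i zero_le hi (he a)
  let q : K.GType Y := p.pull y
  have hyk : ∀ i (hi : i < δ), ∀ x, (y.comp (SEmb.ofSub (hst i))) x ∈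
      (SEmb.ofSub (hC.strong i hi)).range := by
    intro i hi x
    rw [SEmb.range_ofSub]
    exact (hmem i hi x).1 x.2
  -- the restriction to the trace of `C i` does not fork over `A`
  have hA' : ∀ i (hi : i < δ), s.DoesNotFork (q.pull (SEmb.ofSub (hst i)))
      ((k.comp d).lift (hst i) (hkd i hi)).range := by
    intro i hi
    obtain ⟨f, hf⟩ := SEmb.exists_factor (SEmb.ofSub (hC.strong i hi))
      (y.comp (SEmb.ofSub (hst i))) (hyk i hi)
    have h1 := hp i hi (f.comp ((k.comp d).lift (hst i) (hkd i hi))) (by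
      rw [← SEmb.comp_assoc, hf, SEmb.comp_assoc, SEmb.ofSub_comp_lift, ← SEmb.comp_assoc, hk, hd])
    have h2 := h1.pull
    rw [GType.pull_pull, hf, ← GType.pull_pull] at h2
    exact (fr_iff H hA (hcard i hi.le)).1 h2
  have hcontin := (H.good.continuity δ hC.lim C' hch
    (fun i => q.pull (SEmb.ofSub (hst i)))
    (fun i hi => H.dnf_bs _ (hA' i hi))
    (fun i j hji hi => GType.pull_pull q (SEmb.ofSub (hst i))
      (SEmb.incl (hch.mono j i hji.le hi.le) (hst j) (hst i)))).2 (fun i hi => by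
        have hle := hch.mono 0 i zero_le hi.le
        have h1 := H.dnf_mono ((k.comp d).lift (hst i) (hkd i hi))
          ((k.comp d).lift (hst 0) (hkd 0 hC.lim.bot_lt)) (SEmb.incl hle (hst 0) (hst i))
          (SEmb.refl (hst i).mem) (fun _ => rfl) (hA' i hi)
        rw [GType.pull_refl] at h1
        have h2 : (SEmb.incl hle (hst 0) (hst i)).range = (C' 0).comap (C' i).subtype.toHom := by
          ext z
          exact ⟨fun ⟨w, hw⟩ => hw ▸ w.2, fun hz => ⟨⟨z, hz⟩, rfl⟩⟩
        rwa [h2] at h1) q (fun i hi => rfl)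
  have h5 : s.DoesNotFork q (SEmb.ofSub (hst 0)).range := by
    rw [SEmb.range_ofSub]
    exact hcontin
  have h6 := H.dnf_trans (SEmb.ofSub (hst 0)) _ h5 (hA' 0 hC.lim.bot_lt)
  rw [SEmb.ofSub_comp_lift] at h6
  have h7 := H.dnf_mono (k.comp d) (SEmb.refl d.mem_left) d k (fun _ => rfl) h6
  rwa [GType.pull_pull, hk] at h7

/-- Density of free types. Otherwise a chain of length `ω` of submodels of size `lam`, each
containing witnesses of forking over the previous ones, contradicts density and local character
of the given frame. -/
theorem exists_fr_of_not_surjective (H : Ctx K s lam θ) (i : SEmb K X N) (hX : lam ≤ #X)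
    (hi : ¬ Function.Surjective i) : ∃ (a : N) (A : Type u) (_ : L.Structure A) (e : SEmb K A X),
      Fr s lam e (i.tp a) := by
  classical
  by_contra! hcon
  obtain ⟨b₀, hb₀⟩ : ∃ b, b ∉ i.range := by
    by_contra! h
    exact hi fun b => h b
  have hbad : ∀ (b : N) (Z : L.Substructure N) (hZ : K.Strong Z) (hZX : Z ≤ i.range), #Z = lam →
      ∃ (T : L.Substructure N) (hT : K.Strong T) (hZT : Z ≤ T), T ≤ i.range ∧ #T = lam ∧
        ¬ s.DoesNotFork ((SEmb.ofSub hT).tp b) (SEmb.incl hZT hZ hT).range := by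
    intro b Z hZ hZX hZc
    obtain ⟨e, he⟩ := SEmb.exists_factor i (SEmb.ofSub hZ) fun x => hZX x.2
    have h1 := hcon b Z inferInstance e
    unfold Fr at h1
    push Not at h1
    obtain ⟨M, _, m, d, hM, hd, hn⟩ := h1 hZc
    have himd : (i.comp m).comp d = SEmb.ofSub hZ := by rw [SEmb.comp_assoc, hd, he]
    have hle : Z ≤ (i.comp m).range := fun x hx => ⟨d ⟨x, hx⟩, DFunLike.congr_fun himd ⟨x, hx⟩⟩
    refine ⟨(i.comp m).range, (i.comp m).strong_range, hle, ?_, ?_, ?_⟩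
    · rintro _ ⟨x, rfl⟩
      exact ⟨m x, rfl⟩
    · rw [SEmb.mk_range, hM]
    · intro hdnf
      apply hn
      let r : SEmb K M (i.comp m).range := (i.comp m).lift (i.comp m).strong_range fun x => ⟨x, rfl⟩
      have h2 := H.dnf_mono (SEmb.incl hle hZ (i.comp m).strong_range) (SEmb.refl hZ.mem) d
        r (fun x => Subtype.ext
        (DFunLike.congr_fun himd x)) hdnf
      exact h2
  choose! T hT using fun b Z (h : K.Strong Z ∧ Z ≤ i.range ∧ #Z = lam) =>
    hbad b Z h.1 h.2.1 h.2.2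
  obtain ⟨F, hF, hcl⟩ := exists_skolem_chain i.mem_right 1 (fun _ => i.range)
    (fun _ _ => i.strong_range) (fun _ _ _ _ => le_rfl)
  -- the witnesses added at each stage
  let W : N → Set N → Set N := fun b Y =>
    if h : ∃ Z : L.Substructure N, (Z : Set N) = Y ∩ i.range ∧ K.Strong Z ∧ Z ≤ i.range ∧ #Z = lam
    then T b h.choose else ∅
  let w : Ordinal.{u} → Set N → Set N := fun _ Y => ⋃ b : Y, W b Y
  have hW : ∀ b Y, #(W b Y) ≤ lam := by
    intro b Y
    by_cases h : ∃ Z : L.Substructure N, (Z : Set N) = Y ∩ i.range ∧ K.Strong Z ∧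
      Z ≤ i.range ∧ #Z = lam
    · have h1 := h.choose_spec
      obtain ⟨-, -, -, h2, -⟩ := hT b h.choose h1.2
      simp only [W, dif_pos h]
      exact h2.le
    · simp only [W, dif_neg h]
      simp
  obtain ⟨E, hE, hEc⟩ := Cardinal.le_mk_iff_exists_subset.1 (i.mk_range.symm ▸ hX : lam ≤ #i.range)
  let Y : Ordinal.{u} → Set N := filtration F (insert b₀ E) w
  have hDc : #(insert b₀ E : Set N) ≤ lam := by
    refine (Cardinal.mk_insert_le).trans ?_
    exact Cardinal.add_le_of_le H.aleph0_le hEc.le (Cardinal.one_le_aleph0.trans H.aleph0_le)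
  have hYc : ∀ n ≤ Ordinal.omega0.{u}, #(Y n) ≤ lam := fun n hn =>
    mk_filtration_le H.aleph0_le (fun t => (hF t).trans H.LS_le) hDc
      (fun _ Y hY => mk_iUnion_le_of_le H.aleph0_le _ hY fun b => hW b Y)
      ((Ordinal.card_le_card hn).trans (by rw [Ordinal.card_omega0]; exact H.aleph0_le))
  choose S hS hSs hSX using fun n => hcl (Y n) (cl_filtration n)
  have hSX' : ∀ n, K.Strong (S n ⊓ i.range) := fun n => hSX n 0 zero_lt_one
  have hSm : ∀ n m, n ≤ m → S n ≤ S m := fun n m h => by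
    rw [← SetLike.coe_subset_coe, hS, hS]
    exact filtration_mono h
  have hSE : ∀ n, insert b₀ E ⊆ (S n : Set N) := fun n => by
    rw [hS]
    exact subset_filtration n
  have hcard : ∀ n ≤ Ordinal.omega0.{u}, #(S n ⊓ i.range : L.Substructure N) = lam := by
    intro n hn
    refine le_antisymm ?_ ?_
    · refine le_trans ?_ (hYc n hn)
      refine Cardinal.mk_le_mk_of_subset (?_ : ((S n ⊓ i.range : L.Substructure N) : Set N) ⊆ Y n)
      rw [← hS n]
      exact fun x hx => hx.1
    · rw [← hEc]
      exact Cardinal.mk_le_mk_of_subset fun x hx => ⟨hSE n (Or.inr hx), hE hx⟩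
  have hScard : #(S Ordinal.omega0) = lam := by
    refine le_antisymm ?_ ?_
    · have : #(S Ordinal.omega0 : Set N) ≤ lam := by rw [hS]; exact hYc _ le_rfl
      exact this
    · rw [← hcard Ordinal.omega0 le_rfl]
      exact Cardinal.mk_le_mk_of_subset fun x hx => hx.1
  have hlimω : Order.IsSuccLimit Ordinal.omega0.{u} := Ordinal.isSuccLimit_omega0
  have hSω : ∀ x ∈ S Ordinal.omega0, ∃ n < Ordinal.omega0.{u}, x ∈ S n := by
    intro x hx
    have hx' : x ∈ filtration F (insert b₀ E) w Ordinal.omega0 :=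
      (Set.ext_iff.1 (hS Ordinal.omega0) x).1 hx
    rw [filtration_limit hlimω, Set.mem_iUnion₂] at hx'
    obtain ⟨n, hn, h⟩ := hx'
    exact ⟨n, hn, by rw [← SetLike.mem_coe, hS]; exact h⟩
  set Sω := S Ordinal.omega0 with hSωdef
  set P := Sω ⊓ i.range with hP
  have hPS : P ≤ Sω := inf_le_left
  have hPs : K.Strong P := hSX' _
  -- density in the union, of size `lam`
  obtain ⟨b, hb⟩ : ∃ b : Sω, (SEmb.incl hPS hPs (hSs _)).tp b ∈ s.bs P := by
    have h1 := H.good.density (SEmb.incl hPS hPs (hSs _)).range (SEmb.strong_range _)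
      (inF_succ_iff.2 ⟨(SEmb.strong_range _).mem, by
        rw [SEmb.mk_range]; exact hcard _ le_rfl⟩)
      (inF_succ_iff.2 ⟨(hSs _).mem, hScard⟩) (by
        intro h
        have : (⟨b₀, hSE _ (Or.inl rfl)⟩ : Sω) ∈ (SEmb.incl hPS hPs (hSs _)).range := by
          rw [h]; trivial
        obtain ⟨z, hz⟩ := this
        apply hb₀
        have h2 : (z : N) = b₀ := congrArg Subtype.val hz
        rw [← h2]
        exact z.2.2)
    obtain ⟨b, hb⟩ := h1
    refine ⟨b, ?_⟩
    let r : SEmb K P (SEmb.incl hPS hPs (hSs _)).range :=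
      (SEmb.incl hPS hPs (hSs _)).lift (SEmb.strong_range _) fun x => ⟨x, rfl⟩
    exact H.bs_pull_of_surjective hb r fun ⟨x, z, hz⟩ => ⟨z, Subtype.ext hz⟩
  have hb' : (SEmb.ofSub hPs).tp (b : N) ∈ s.bs P := by
    rw [← SEmb.tp_comp (SEmb.ofSub (hSs Ordinal.omega0))] at hb
    exact hb
  -- local character for the chain of traces
  have hle : ∀ n < Ordinal.omega0.{u}, S n ⊓ i.range ≤ (SEmb.ofSub hPs).range := fun n hn => by
    rw [SEmb.range_ofSub]
    exact inf_le_inf_right _ (hSm _ _ hn.le)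
  have hch := isChain_trace (lam := lam) (SEmb.ofSub hPs) (fun n => S n ⊓ i.range)
    (fun n _ => hSX' n) hle (fun n m h _ => inf_le_inf_right _ (hSm n m h))
    (fun n hn hlim => absurd hn (not_lt.2 (Ordinal.omega0_le_of_isSuccLimit hlim)))
    (fun z => by
      obtain ⟨n, hn, h⟩ := hSω z z.2.1
      exact ⟨n, hn, h, z.2.2⟩) (fun n hn => hcard n hn.le) (hcard _ le_rfl)
  obtain ⟨n, hn, hdnf⟩ := H.good.localCharacter _ hlimω _ hch _ hb'
  obtain ⟨m, hm, hbm⟩ := hSω b b.2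
  let k := max n m
  have hk : k < Ordinal.omega0.{u} := max_lt hn hm
  have hZ : K.Strong (S k ⊓ i.range) ∧ S k ⊓ i.range ≤ i.range ∧
      #(S k ⊓ i.range : L.Substructure N) = lam := ⟨hSX' k, inf_le_right, hcard k hk.le⟩
  obtain ⟨hTs, hZT, hTX, hTc, hTn⟩ := hT b _ hZ
  -- the witness of forking lies in the next stage
  have hTsub : (T b (S k ⊓ i.range) : Set N) ⊆ S (Order.succ k) := by
    have hex : ∃ Z : L.Substructure N, (Z : Set N) = Y k ∩ i.range ∧ K.Strong Z ∧
        Z ≤ i.range ∧ #Z = lam := ⟨S k ⊓ i.range, by rw [← hS k]; rfl, hZ⟩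
    have hch : hex.choose = S k ⊓ i.range := by
      apply SetLike.coe_injective
      rw [hex.choose_spec.1, ← hS k]
      rfl
    rw [hS]
    refine Set.Subset.trans ?_ (witness_subset_filtration (Order.lt_succ k))
    have hbY : (b : N) ∈ Y k := by
      rw [← hS k]
      exact hSm m k (le_max_right _ _) hbm
    refine Set.Subset.trans ?_ (Set.subset_iUnion (fun b : Y k => W b (Y k)) ⟨b, hbY⟩)
    simp only [W, dif_pos hex, hch]
    exact subset_rfl
  have hTP : T b (S k ⊓ i.range) ≤ P := fun x hx =>
    ⟨hSm _ _ (hlimω.succ_lt hk).le (hTsub hx), hTX hx⟩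
  apply hTn
  have htr : trace Ordinal.omega0 (SEmb.ofSub hPs) (fun n => S n ⊓ i.range) n =
      (SEmb.incl (inf_le_inf_right i.range (hSm n _ hn.le)) (hSX' n) hPs).range := by
    ext z
    rw [mem_trace hn]
    exact ⟨fun h => ⟨⟨z, h⟩, rfl⟩, fun ⟨w, hw⟩ => hw ▸ w.2⟩
  rw [htr] at hdnf
  have h9 := H.dnf_mono _
    (SEmb.incl (inf_le_inf_right i.range (hSm n k (le_max_left _ _))) (hSX' n) (hSX' k))
    (SEmb.incl hZT (hSX' k) hTs) (SEmb.incl hTP hTs hPs) (fun _ => rfl) hdnf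
  exact h9

end

end Ctx

/-! ### Chains given by embeddings -/

section cover

variable {X : Type u} [L.Structure X] {δ : Ordinal.{u}} {B : Ordinal.{u} → Type u}
  [∀ j, L.Structure (B j)]

open Classical in
/-- The chain of the images of the embeddings `c j`. -/
noncomputable def coverChain (c : ∀ j, j < δ → SEmb K (B j) X) (j : Ordinal.{u}) :
    L.Substructure X := if h : j < δ then (c j h).range else ⊤

theorem coverChain_eq (c : ∀ j, j < δ → SEmb K (B j) X) {j : Ordinal.{u}} (hj : j < δ) :
    coverChain c j = (c j hj).range := dif_pos hj

open Classical in
/-- A continuous modification of an increasing chain: at limit ordinals the union is taken. -/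
noncomputable def contChain (C : Ordinal.{u} → L.Substructure X) (i : Ordinal.{u}) :
    L.Substructure X := if Order.IsSuccLimit i then ⨆ j : Set.Iio i, C j.1 else C i

theorem mem_contChain_limit {C : Ordinal.{u} → L.Substructure X} {i : Ordinal.{u}}
    (hm : ∀ j k, j ≤ k → k < i → C j ≤ C k) (hl : Order.IsSuccLimit i) {x : X} :
    x ∈ contChain C i ↔ ∃ j < i, x ∈ C j := by
  have : Nonempty (Set.Iio i) := ⟨⟨0, hl.bot_lt⟩⟩
  rw [contChain, if_pos hl, FirstOrder.Language.Substructure.mem_iSup_of_directed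
    (Monotone.directed_le fun (j k : Set.Iio i) h => hm j.1 k.1 h k.2)]
  exact ⟨fun ⟨j, h⟩ => ⟨j.1, j.2, h⟩, fun ⟨j, hj, h⟩ => ⟨⟨j, hj⟩, h⟩⟩

theorem contChain_of_not_limit (C : Ordinal.{u} → L.Substructure X) {i : Ordinal.{u}}
    (h : ¬ Order.IsSuccLimit i) : contChain C i = C i := if_neg h

theorem contChain_le {C : Ordinal.{u} → L.Substructure X} {i : Ordinal.{u}}
    (hm : ∀ j k, j ≤ k → k ≤ i → C j ≤ C k) : contChain C i ≤ C i := by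
  by_cases h : Order.IsSuccLimit i
  · intro x hx
    obtain ⟨j, hj, hx⟩ := (mem_contChain_limit (fun j k h h' => hm j k h h'.le) h).1 hx
    exact hm j i hj.le le_rfl hx
  · rw [contChain_of_not_limit C h]

theorem chain_contChain {C : Ordinal.{u} → L.Substructure X} (hδ : Order.IsSuccLimit δ)
    (hC : ∀ i < δ, K.Strong (C i)) (hm : ∀ i j, i ≤ j → j < δ → C i ≤ C j)
    (ht : ∀ x, ∃ i < δ, x ∈ C i) : Chain K δ (contChain C) := by
  have hm' : ∀ i < δ, ∀ j k, j ≤ k → k < i → C j ≤ C k := fun i hi j k h hk =>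
    hm j k h (hk.trans hi)
  refine ⟨hδ, fun i hi => ?_, fun i j hij hj => ?_, fun i hi hl x hx => ?_, fun x => ?_⟩
  · by_cases h : Order.IsSuccLimit i
    · refine strong_iUnion_chain h C (fun j hj => hC j (hj.trans hi)) (hm' i hi) _ ?_
      ext x
      simp only [SetLike.mem_coe, mem_contChain_limit (hm' i hi) h, Set.mem_iUnion, exists_prop]
    · rw [contChain_of_not_limit C h]
      exact hC i hi
  · rcases hij.eq_or_lt with rfl | hlt
    · exact le_rfl
    · intro x hx
      have h1 : x ∈ C i :=
        contChain_le (fun j k h hk => hm j k h (hk.trans_lt (hij.trans_lt hj))) hx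
      by_cases h : Order.IsSuccLimit j
      · exact (mem_contChain_limit (hm' j hj) h).2 ⟨i, hlt, h1⟩
      · rw [contChain_of_not_limit C h]
        exact hm i j hij hj h1
  · obtain ⟨j, hj, hx⟩ := (mem_contChain_limit (hm' i hi) hl).1 hx
    refine ⟨Order.succ j, hl.succ_lt hj, ?_⟩
    rw [contChain_of_not_limit C (Order.not_isSuccLimit_succ j)]
    exact hm j _ (Order.le_succ j) ((hl.succ_lt hj).trans hi) hx
  · obtain ⟨i, hi, hx⟩ := ht x
    refine ⟨Order.succ i, hδ.succ_lt hi, ?_⟩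
    rw [contChain_of_not_limit C (Order.not_isSuccLimit_succ i)]
    exact hm i _ (Order.le_succ i) (hδ.succ_lt hi) hx

/-- Freeness is preserved by unions of increasing, not necessarily continuous, chains. -/
theorem Ctx.Fr.of_cover {s : K.Frame} {lam : Cardinal.{u}} {θ : WithTop Cardinal.{u}}
    (H : Ctx K s lam θ) {A : Type u} [L.Structure A] {e : SEmb K A X} {p : K.GType X}
    (hδ : Order.IsSuccLimit δ) (c : ∀ j, j < δ → SEmb K (B j) X)
    (hm : ∀ j k (hjk : j ≤ k) (hk : k < δ) x, c j (hjk.trans_lt hk) x ∈ (c k hk).range)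
    (hs : ∀ x, ∃ j, ∃ hj : j < δ, x ∈ (c j hj).range)
    (he : ∀ a, e a ∈ (c 0 hδ.bot_lt).range)
    (hp : ∀ j (hj : j < δ) (e' : SEmb K A (B j)), (c j hj).comp e' = e →
      Ctx.Fr s lam e' (p.pull (c j hj))) : Ctx.Fr s lam e p := by
  have hm' : ∀ i j, i ≤ j → j < δ → coverChain c i ≤ coverChain c j := fun i j hij hj => by
    rw [coverChain_eq c (hij.trans_lt hj), coverChain_eq c hj]
    rintro _ ⟨x, rfl⟩
    exact hm i j hij hj x
  have hC := chain_contChain (K := K) hδ (C := coverChain c)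
    (fun i hi => by rw [coverChain_eq c hi]; exact (c i hi).strong_range) hm'
    (fun x => by
      obtain ⟨j, hj, h⟩ := hs x
      exact ⟨j, hj, by rw [coverChain_eq c hj]; exact h⟩)
  have hle : ∀ i (hi : i < δ), contChain (coverChain c) i ≤ (c i hi).range := fun i hi => by
    rw [← coverChain_eq c hi]
    exact contChain_le fun j k h hk => hm' j k h (hk.trans_lt hi)
  refine Ctx.Fr.of_chain H hC (fun a => ?_) fun i hi e' he' => ?_
  · have h0 : ¬ Order.IsSuccLimit (0 : Ordinal.{u}) := fun h => h.ne_bot rfl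
    rw [contChain_of_not_limit _ h0, coverChain_eq c (j := 0) hδ.bot_lt]
    exact he a
  · obtain ⟨k, hk⟩ := SEmb.exists_factor (c i hi) (SEmb.ofSub (hC.strong i hi))
      fun x => hle i hi x.2
    have h1 := hp i hi (k.comp e') (by rw [← SEmb.comp_assoc, hk, he'])
    have h2 := h1.pull
    rwa [GType.pull_pull, hk] at h2

end cover

/-! ### Filtrations -/

section filtrations

variable {X : Type u} [L.Structure X]

/-- A model is the union of a continuous chain of smaller strong submodels, which can be taken
closed under a given operation `F` and containing the witnesses prescribed by `w`. The last clause
bounds the sizes from below, so that the union of the first `i` members of the chain is not larger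
than the `i`-th. -/
theorem exists_filtration (hX : K.Mem X) {κ : Cardinal.{u}} (hLS : K.LS ≤ κ) (hκ : κ < #X)
    (F : Finset X → Set X) (hF : ∀ t, #(F t) ≤ κ) (D : Set X) (hD : #D ≤ κ) (w : Set X → Set X)
    (hw : ∀ c, κ ≤ c → ∀ Y : Set X, #Y ≤ c → #(w Y) ≤ c) :
    ∃ C : Ordinal.{u} → L.Substructure X, Chain K (#X).ord C ∧ (∀ i, Cl F (C i)) ∧
      (∀ i, K.Strong (C i)) ∧ (∀ i, D ⊆ C i) ∧ (∀ i < (#X).ord, #(C i) < #X) ∧ (∀ i, κ ≤ #(C i)) ∧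
      (∀ i j, i < j → w (C i) ⊆ C j) ∧ ∀ i < (#X).ord, i.card ≤ #(C i) := by
  have hinf : ℵ₀ ≤ κ := (LS_spec K).1.trans hLS
  obtain ⟨F', hF', hcl⟩ := exists_skolem hX
  obtain ⟨r, hr, hr1, hr2⟩ := exists_rank X
  obtain ⟨E, hE⟩ := Cardinal.le_mk_iff_exists_set.1 hκ.le
  let F₁ : Finset X → Set X := fun t => F t ∪ F' t
  -- stage `j` also adds the element of rank `j`: the union is `X`, and `|i| ≤ |C i|`
  let w₁ : Ordinal.{u} → Set X → Set X := fun j Y => w Y ∪ {x | r x = j}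
  have hw₁ : ∀ c, κ ≤ c → ∀ j (Y : Set X), #Y ≤ c → #(w₁ j Y) ≤ c := by
    intro c hc j Y hY
    refine mk_union_le_of_le (hinf.trans hc) (hw c hc Y hY) ?_
    have : Subsingleton {x | r x = j} := ⟨fun a b => Subtype.ext (hr (a.2.trans b.2.symm))⟩
    exact (Cardinal.le_one_iff_subsingleton.2 this).trans
      (Cardinal.one_le_aleph0.trans (hinf.trans hc))
  have hF₁ : ∀ t, #(F₁ t) ≤ κ := fun t => mk_union_le_of_le hinf (hF t) ((hF' t).trans hLS)
  choose C hC hCs using fun i => hcl (filtration F₁ (D ∪ E) w₁ i)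
    (Cl.mono (fun t => Set.subset_union_right) (cl_filtration i))
  have hmono : ∀ i j, i ≤ j → C i ≤ C j := fun i j h => by
    rw [← SetLike.coe_subset_coe, hC, hC]
    exact filtration_mono h
  refine ⟨C, ⟨Cardinal.isSuccLimit_ord (hinf.trans hκ.le), fun i _ => hCs i,
    fun i j h _ => hmono i j h, ?_, ?_⟩, ?_, hCs, ?_, ?_, ?_, ?_, ?_⟩
  · intro i _ hlim x hx
    have hx' := (Set.ext_iff.1 (hC i) x).1 hx
    rw [filtration_limit hlim, Set.mem_iUnion₂] at hx'
    obtain ⟨j, hj, h⟩ := hx'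
    exact ⟨j, hj, (Set.ext_iff.1 (hC j) x).2 h⟩
  · intro x
    refine ⟨Order.succ (r x), (Cardinal.isSuccLimit_ord (hinf.trans hκ.le)).succ_lt (hr1 x), ?_⟩
    refine (Set.ext_iff.1 (hC _) x).2 (witness_subset_filtration (Order.lt_succ (r x)) ?_)
    exact Or.inr rfl
  · intro i
    rw [hC]
    exact Cl.mono (fun t => Set.subset_union_left) (cl_filtration i)
  · intro i
    rw [hC]
    exact Set.subset_union_left.trans (subset_filtration i)
  · intro i hi
    have h1 : #(C i : Set X) ≤ max κ i.card := by
      rw [hC]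
      refine mk_filtration_le (hinf.trans (le_max_left _ _)) (fun t => (hF₁ t).trans
        (le_max_left _ _)) ?_ (hw₁ _ (le_max_left _ _)) (le_max_right _ _)
      exact (mk_union_le_of_le hinf hD hE.le).trans (le_max_left _ _)
    exact h1.trans_lt (max_lt hκ (Cardinal.lt_ord.1 hi))
  · intro i
    have h1 : #E ≤ #(C i : Set X) := by
      rw [hC]
      exact Cardinal.mk_le_mk_of_subset (Set.subset_union_right.trans (subset_filtration i))
    exact hE ▸ h1
  · intro i j hij
    rw [hC, hC]
    exact Set.subset_union_left.trans (witness_subset_filtration (w := w₁) hij)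
  · intro i hi
    -- `C i` contains the elements with rank below `i`
    choose x hx using fun j : Set.Iio i => hr2 j.1 (j.2.trans hi)
    have hxC : ∀ j, x j ∈ C i := fun j => (Set.ext_iff.1 (hC i) _).2
      (witness_subset_filtration j.2 (Or.inr (hx j)))
    have h1 := Cardinal.mk_le_of_injective
      (f := fun t : i.ToType => (⟨x (Ordinal.ToType.mk.symm t), hxC _⟩ : C i))
      fun t t' h => by
        have h2 : x (Ordinal.ToType.mk.symm t) = x (Ordinal.ToType.mk.symm t') :=
          congrArg Subtype.val h
        refine Ordinal.ToType.mk.symm.injective (Subtype.ext ?_)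
        rw [← hx, ← hx, h2]
    simpa using h1

end filtrations

/-! ### Towers over a chain -/

section chainTower

variable {Y : Type u} [L.Structure Y]

/-- A pointed extension of a member of a chain, with a distinguished substructure. -/
structure ChainExt (K : AEC.{u} L) {Y : Type u} [L.Structure Y]
    (C : Ordinal.{u} → L.Substructure Y) where
  idx : Ordinal.{u}
  carrier : Type u
  [str : L.Structure carrier]
  emb : SEmb K (C idx) carrier
  sub : L.Substructure carrier
  pt : carrier

attribute [instance] ChainExt.str

variable {C : Ordinal.{u} → L.Substructure Y}

/-- A strong embedding of extensions of members of a chain that respects all the data. -/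
structure ChainExt.Compat (o o' : ChainExt K C) (g : SEmb K o.carrier o'.carrier) : Prop where
  le : C o.idx ≤ C o'.idx
  emb : ∀ (x : C o.idx) (x' : C o'.idx), (x : Y) = x' → g (o.emb x) = o'.emb x'
  sub : ∀ x ∈ o.sub, g x ∈ o'.sub
  pt : g o.pt = o'.pt

theorem ChainExt.Compat.comp {o o' o'' : ChainExt K C} {f : SEmb K o.carrier o'.carrier}
    {g : SEmb K o'.carrier o''.carrier} (hg : o'.Compat o'' g) (hf : o.Compat o' f) :
    o.Compat o'' (g.comp f) :=
  ⟨hf.le.trans hg.le, fun x x'' hx => by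
    rw [SEmb.comp_apply, hf.emb x ⟨x, hf.le x.2⟩ rfl]
    exact hg.emb _ _ hx, fun x hx => hg.sub _ (hf.sub x hx), by
    rw [SEmb.comp_apply, hf.pt, hg.pt]⟩

/-- `W` is the direct limit of a continuous system of extensions of the `C j`, `j < i`. The union of
these `C j` is embedded in `W` by `f`; it is `Z`, regarded as a submodel of `Y` by `ζ`. -/
structure ChainLimit (κ : Cardinal.{u}) (P : ChainExt K C → Prop)
    (E : ∀ o o' : ChainExt K C, SEmb K o.carrier o'.carrier → Prop) (i : Ordinal.{u})
    {Z W : Type u} [L.Structure Z] [L.Structure W] (ζ : SEmb K Z Y) (f : SEmb K Z W)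
    (sub : L.Substructure W) (pt : W) where
  ob : Ordinal.{u} → ChainExt K C
  idx : ∀ j < i, (ob j).idx = j
  size : ∀ j < i, #(ob j).carrier ≤ κ
  good : ∀ j < i, P (ob j)
  map : ∀ j k, j ≤ k → k < i → SEmb K (ob j).carrier (ob k).carrier
  compat : ∀ j k (h : j ≤ k) (hk : k < i), (ob j).Compat (ob k) (map j k h hk)
  ext : ∀ j k (h : j < k) (hk : k < i), E (ob j) (ob k) (map j k h.le hk)
  r : ∀ j, j < i → SEmb K (ob j).carrier W
  r_map : ∀ j k (h : j ≤ k) (hk : k < i) x, r k hk (map j k h hk x) = r j (h.trans_lt hk) x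
  r_emb : ∀ j (hj : j < i) (x : C (ob j).idx) (z : Z), (x : Y) = ζ z →
    r j hj ((ob j).emb x) = f z
  r_sub : ∀ j (hj : j < i), ∀ x ∈ (ob j).sub, r j hj x ∈ sub
  r_pt : ∀ j (hj : j < i), r j hj (ob j).pt = pt
  cover : ∀ x, ∃ j, ∃ hj : j < i, ∃ y, r j hj y = x
  sub_cover : ∀ x ∈ sub, ∃ j, ∃ hj : j < i, ∃ y ∈ (ob j).sub, r j hj y = x
  cont : ∀ k (hk : k < i), Order.IsSuccLimit k → ∀ x, ∃ j, ∃ hj : j < k, ∃ y,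
    r j (hj.trans hk) y = r k hk x

/-- The direct limit `R` of a tower of extensions of the `C j`, with the images of the distinguished
points and the union of the images of the distinguished substructures, is a `ChainLimit`. -/
theorem exists_chainLimit {κ : Cardinal.{u}} {P : ChainExt K C → Prop}
    {E : ∀ o o' : ChainExt K C, SEmb K o.carrier o'.carrier → Prop} {δ : Ordinal.{u}}
    (hC : Chain K δ C)
    (Q : Ordinal.{u} → ChainExt K C → Prop)
    (hQ : ∀ i o, Q i o → o.idx = i ∧ #o.carrier ≤ κ ∧ P o)
    (T : Ordinal.{u} → Ordinal.{u} → ∀ o o' : ChainExt K C, SEmb K o.carrier o'.carrier → Prop)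
    (hT : ∀ i j o o' g, T i j o o' g → o.Compat o' g ∧ (i < j → E o o' g))
    {i : Ordinal.{u}} (hi : i ≤ δ) (hl : Order.IsSuccLimit i)
    (S : Tower ChainExt.carrier K Q T i) {R : Type u} [L.Structure R]
    (e : ∀ j, j < i → SEmb K (S.ob j).carrier R)
    (he : ∀ j k (h : j ≤ k) (hk : k < i) x, e k hk (S.map j k h hk x) = e j (h.trans_lt hk) x)
    (hs : ∀ r : R, ∃ j, ∃ hj : j < i, ∃ x, e j hj x = r)
    {Z : Type u} [L.Structure Z] (ζ : SEmb K Z Y) (hCZ : ∀ j < i, ∀ x ∈ C j, x ∈ ζ.range)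
    (hZ : ∀ z, ∃ j < i, ζ z ∈ C j) :
    ∃ (f : SEmb K Z R) (sub : L.Substructure R) (pt : R)
      (Lm : ChainLimit κ P E i ζ f sub pt), Lm.ob = S.ob ∧ HEq Lm.r e := by
  have hjδ : ∀ j, j < i → j < δ := fun j hj => hj.trans_le hi
  have hcast : ∀ j (hj : j < i), ∃ k : SEmb K (C j) (S.ob j).carrier,
      ∀ (x : C j) (x' : C (S.ob j).idx), (x : Y) = x' → k x = (S.ob j).emb x' := by
    intro j hj
    have h1 := (hQ _ _ (S.good j hj)).1
    generalize S.ob j = o at h1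
    subst h1
    exact ⟨o.emb, fun x x' h => congrArg o.emb (Subtype.ext h)⟩
  choose k hk using hcast
  have hCj : ∀ j, j < i → C (S.ob j).idx = C j := fun j hj => by rw [(hQ _ _ (S.good j hj)).1]
  choose z hz using fun j (hj : j < i) => SEmb.exists_factor ζ
    (SEmb.ofSub (hC.strong j (hjδ j hj))) fun x => hCZ j hj x x.2
  have hz' : ∀ j hj x, ζ (z j hj x) = x := fun j hj x => DFunLike.congr_fun (hz j hj) x
  obtain ⟨f, hf⟩ := exists_glue (A := fun j => C j) hl
    (fun j l hjl hli => SEmb.incl (hC.mono j l hjl (hjδ l hli)) (hC.strong j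
      (hjδ j (hjl.trans_lt hli))) (hC.strong l (hjδ l hli)))
    z
    (fun j l h hl' x => ζ.injective (by rw [hz', hz']; rfl))
    (fun r => by
      obtain ⟨j, hj, hr⟩ := hZ r
      exact ⟨j, hj, ⟨ζ r, hr⟩, ζ.injective (hz' _ _ _)⟩)
    (fun j hj => (e j hj).comp (k j hj))
    (fun j l h hl' x => by
      have hx1 : (x : Y) ∈ C (S.ob j).idx := (hCj j (h.trans_lt hl')).ge x.2
      have hx2 : (x : Y) ∈ C (S.ob l).idx := (hCj l hl').ge (hC.mono j l h (hjδ l hl') x.2)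
      simp only [SEmb.comp_apply]
      rw [hk l hl' _ ⟨x, hx2⟩ rfl, hk j _ x ⟨x, hx1⟩ rfl, ← he j l h hl']
      rw [(hT _ _ _ _ _ (S.trans j l h hl')).1.emb ⟨x, hx1⟩ ⟨x, hx2⟩ rfl])
  have hpt : ∀ j (hj : j < i), e j hj (S.ob j).pt = e 0 hl.bot_lt (S.ob 0).pt := fun j hj => by
    rw [← (hT _ _ _ _ _ (S.trans 0 j zero_le hj)).1.pt, he]
  have hd : Directed (· ≤ ·) fun j : Set.Iio i => (S.ob j).sub.map (e j.1 j.2).emb.toHom := by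
    refine Monotone.directed_le fun j l hjl => ?_
    rintro _ ⟨x, hx, rfl⟩
    exact ⟨S.map j.1 l.1 hjl l.2 x, (hT _ _ _ _ _ (S.trans _ _ hjl l.2)).1.sub x hx,
      he _ _ _ _ _⟩
  have : Nonempty (Set.Iio i) := ⟨⟨0, hl.bot_lt⟩⟩
  refine ⟨f, ⨆ j : Set.Iio i, (S.ob j).sub.map (e j.1 j.2).emb.toHom, e 0 hl.bot_lt (S.ob 0).pt,
    { ob := S.ob
      idx := fun j hj => (hQ _ _ (S.good j hj)).1
      size := fun j hj => (hQ _ _ (S.good j hj)).2.1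
      good := fun j hj => (hQ _ _ (S.good j hj)).2.2
      map := S.map
      compat := fun j k h hk => (hT _ _ _ _ _ (S.trans j k h hk)).1
      ext := fun j k h hk => (hT _ _ _ _ _ (S.trans j k h.le hk)).2 h
      r := e
      r_map := he
      r_emb := ?_
      r_sub := fun j hj x hx => ?_
      r_pt := hpt
      cover := hs
      sub_cover := fun x hx => ?_
      cont := fun l hl' hlim x => ?_ }, rfl, HEq.rfl⟩
  · intro j hj x x' hx
    have hxj : (x : Y) ∈ C j := (hCj j hj).le x.2
    have h1 := hf j hj ⟨x, hxj⟩
    have h2 : z j hj ⟨x, hxj⟩ = x' := ζ.injective (by rw [hz']; exact hx)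
    rw [h2] at h1
    rw [h1, SEmb.comp_apply, hk j hj ⟨x, hxj⟩ x rfl]
  · rw [FirstOrder.Language.Substructure.mem_iSup_of_directed hd]
    exact ⟨⟨j, hj⟩, x, hx, rfl⟩
  · rw [FirstOrder.Language.Substructure.mem_iSup_of_directed hd] at hx
    obtain ⟨j, y, hy, rfl⟩ := hx
    exact ⟨j.1, j.2, y, hy, rfl⟩
  · obtain ⟨j, hj, y, rfl⟩ := S.cont l hl' hlim x
    exact ⟨j, hj, y, (he _ _ _ _ _).symm⟩

/-- Construction of a continuous system of extensions of the members of a chain, together with its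
direct limit. The relation `E` is to hold between an extension and the next one; `P` is to
hold throughout. By `hEl`, `E` then holds between an extension and all later ones. By `hEr`, it
can be transferred along isomorphisms of the first argument; this is needed since a limit stage is
determined by the earlier ones up to isomorphism only. -/
theorem exists_chain_tower {κ : Cardinal.{u}} (hκ : ℵ₀ ≤ κ) (P : ChainExt K C → Prop)
    (E : ∀ o o' : ChainExt K C, SEmb K o.carrier o'.carrier → Prop) {δ : Ordinal.{u}}
    (hC : Chain K δ C) (hδ : ∀ i < δ, i.card ≤ κ) (hCs : ∀ i, K.Strong (C i))
    (hEl : ∀ (o o' o'' : ChainExt K C) (f : SEmb K o.carrier o'.carrier)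
      (g : SEmb K o'.carrier o''.carrier), o.Compat o' f → o'.Compat o'' g → E o o' f →
      E o o'' (g.comp f))
    (hEr : ∀ (o o' o'' : ChainExt K C) (f : SEmb K o.carrier o'.carrier)
      (g : SEmb K o'.carrier o''.carrier), Function.Surjective f → o.idx = o'.idx → o.Compat o' f →
      o'.Compat o'' g → E o' o'' g → E o o'' (g.comp f))
    (h0 : ∃ o : ChainExt K C, o.idx = 0 ∧ #o.carrier ≤ κ ∧ P o)
    (hs : ∀ o : ChainExt K C, Order.succ o.idx < δ → #o.carrier ≤ κ → P o →
      ∃ (o' : ChainExt K C) (g : SEmb K o.carrier o'.carrier), o'.idx = Order.succ o.idx ∧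
        #o'.carrier ≤ κ ∧ P o' ∧ o.Compat o' g ∧ E o o' g)
    (hl : ∀ o : ChainExt K C, o.idx < δ → Order.IsSuccLimit o.idx → #o.carrier ≤ κ →
      ChainLimit κ P E o.idx (SEmb.ofSub (hCs o.idx)) o.emb o.sub o.pt → P o) :
    ∃ (W : Type u) (_ : L.Structure W) (f : SEmb K Y W) (sub : L.Substructure W) (pt : W),
      Nonempty (ChainLimit κ P E δ (SEmb.refl f.mem_left) f sub pt) := by
  let Q : Ordinal.{u} → ChainExt K C → Prop := fun i o => o.idx = i ∧ #o.carrier ≤ κ ∧ P o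
  -- maps from a stage to itself are isomorphisms, so that `hEr` applies to them
  let T : Ordinal.{u} → Ordinal.{u} → ∀ o o' : ChainExt K C, SEmb K o.carrier o'.carrier → Prop :=
    fun i j o o' g => (i = j → Function.Surjective g ∧ o.idx = o'.idx) ∧ o.Compat o' g ∧
      (i < j → E o o' g)
  have hQ : ∀ i o, Q i o → o.idx = i ∧ #o.carrier ≤ κ ∧ P o := fun i o h => h
  have hT : ∀ i j o o' g, T i j o o' g → o.Compat o' g ∧ (i < j → E o o' g) :=
    fun i j o o' g h => h.2
  obtain ⟨S⟩ := exists_tower (K := K) (car := ChainExt.carrier) hκ hδ Q T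
    (fun i o _ => o.emb.mem_right) (fun i o h => h.2.1)
    (fun i o h => ⟨fun _ => ⟨fun x => ⟨x, rfl⟩, rfl⟩, ⟨le_rfl, fun x x' hx => by
      rw [SEmb.refl_apply]
      exact congrArg o.emb (Subtype.ext hx), fun x hx => hx, rfl⟩, fun h => absurd h (lt_irrefl _)⟩)
    (fun i j k o o' o'' f g hij hjk hf hg => ⟨fun hik => by
      have h1 : i = j := le_antisymm hij (hik ▸ hjk)
      exact ⟨(hg.1 (h1 ▸ hik)).1.comp (hf.1 h1).1, (hf.1 h1).2.trans (hg.1 (h1 ▸ hik)).2⟩,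
        hg.2.1.comp hf.2.1, fun hik => by
      rcases hij.eq_or_lt with rfl | hij
      · exact hEr _ _ _ _ _ (hf.1 rfl).1 (hf.1 rfl).2 hf.2.1 hg.2.1 (hg.2.2 hik)
      · exact hEl _ _ _ _ _ hf.2.1 hg.2.1 (hf.2.2 hij)⟩)
    h0
    (fun i o hi ho => by
      obtain ⟨rfl, ho1, ho2⟩ := ho
      obtain ⟨o', g, h1, h2, h3, h4, h5⟩ := hs o hi ho1 ho2
      exact ⟨o', g, ⟨h1, h2, h3⟩, fun h => absurd h (Order.lt_succ _).ne, h4, fun _ => h5⟩)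
    (fun i hi hl' S R _ e he hs' hR => by
      obtain ⟨f, sub, pt, Lm, hob, hr⟩ := exists_chainLimit (κ := κ) (P := P) (E := E) hC Q hQ T hT
        hi.le hl' S e he hs'
        (SEmb.ofSub (hCs i)) (fun j hj x hx => by
          rw [SEmb.range_ofSub]; exact hC.mono j i hj.le hi hx)
        (fun x => hC.cont i hi hl' x x.2)
      let o : ChainExt K C := ⟨i, R, f, sub, pt⟩
      refine ⟨o, SEmb.refl f.mem_right, fun x => ⟨x, rfl⟩,
        ⟨rfl, hR, hl o hi hl' hR Lm⟩, ?_⟩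
      have hcompat : ∀ j (hj : j < i), (S.ob j).Compat o (e j hj) := by
        obtain ⟨ob, a1, a2, a3, a4, a5, a6, r, a7, a8, a9, a10, a11, a12, a13⟩ := Lm
        simp only at hob hr
        subst hob
        obtain rfl := eq_of_heq hr
        intro j hj
        refine ⟨?_, fun x x' hx => a8 j hj x x' hx, a9 j hj, a10 j hj⟩
        rw [a1 j hj]
        exact hC.mono j i hj.le hi
      intro j hj
      refine ⟨fun h => absurd h hj.ne, hcompat j hj, fun _ => ?_⟩
      have hj' : Order.succ j < i := hl'.succ_lt hj
      have h1 := hEl _ _ _ _ _ (S.trans j _ (Order.le_succ j) hj').2.1 (hcompat _ hj')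
        ((S.trans j _ (Order.le_succ j) hj').2.2 (Order.lt_succ j))
      have h2 : (e _ hj').comp (S.map j _ (Order.le_succ j) hj') = e j hj :=
        SEmb.ext fun x => he _ _ _ _ _
      rw [h2] at h1
      exact h1)
  obtain ⟨R, _, e, he, hs'⟩ := exists_colimit hC.lim S.map S.map_self S.map_map
  have hYm : K.Mem Y := (K.mem_of_strong _ (hC.strong 0 hC.lim.bot_lt)).2
  obtain ⟨f, sub, pt, Lm, -⟩ := exists_chainLimit (κ := κ) (P := P) (E := E) hC Q hQ T hT
    le_rfl hC.lim S e he hs' (SEmb.refl hYm) (fun j hj x hx => ⟨x, rfl⟩) (fun x => hC.top x)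
  exact ⟨R, inferInstance, f, sub, pt, ⟨Lm⟩⟩

end chainTower

/-- If the distinguished points of the extensions realize the types `q j` over the `C j`, then so
does the distinguished point of the limit. -/
theorem ChainLimit.tp_pull {Y : Type u} [L.Structure Y] {C : Ordinal.{u} → L.Substructure Y}
    {κ : Cardinal.{u}} {P : ChainExt K C → Prop}
    {E : ∀ o o' : ChainExt K C, SEmb K o.carrier o'.carrier → Prop} {i : Ordinal.{u}}
    {Z W : Type u} [L.Structure Z] [L.Structure W] {ζ : SEmb K Z Y} {f : SEmb K Z W}
    {sub : L.Substructure W} {pt : W} (Lm : ChainLimit κ P E i ζ f sub pt)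
    {p : ∀ i, K.GType (C i)} (hP : ∀ o : ChainExt K C, o.idx < i → P o → o.emb.tp o.pt = p o.idx)
    {j : Ordinal.{u}} (hj : j < i) (z : SEmb K (C j) Z)
    (hz : ∀ x, ζ (z x) = x) : (f.tp pt).pull z = p j := by
  have key : ∀ (o : ChainExt K C) (r : SEmb K o.carrier W), o.idx = j → P o →
      (∀ (x : C o.idx) (z : Z), (x : Y) = ζ z → r (o.emb x) = f z) → r o.pt = pt →
      (f.tp pt).pull z = p j := by
    rintro o r rfl h3 h1 h4
    rw [← hP o hj h3, SEmb.tp_pull, ← h4]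
    exact SEmb.tp_eq_of_comp r o.emb (f.comp z) (SEmb.ext fun x => h1 x (z x) (hz x).symm) _
  exact key (Lm.ob j) (Lm.r j hj) (Lm.idx j hj) (Lm.good j hj) (Lm.r_emb j hj) (Lm.r_pt j hj)

theorem ChainLimit.mk_le {Y : Type u} [L.Structure Y] {C : Ordinal.{u} → L.Substructure Y}
    {κ κ' : Cardinal.{u}} {P : ChainExt K C → Prop}
    {E : ∀ o o' : ChainExt K C, SEmb K o.carrier o'.carrier → Prop} {i : Ordinal.{u}}
    {Z W : Type u} [L.Structure Z] [L.Structure W] {ζ : SEmb K Z Y} {f : SEmb K Z W}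
    {sub : L.Substructure W} {pt : W} (Lm : ChainLimit κ P E i ζ f sub pt) (hκ' : ℵ₀ ≤ κ')
    (h : ∀ j < i, #(Lm.ob j).carrier ≤ κ') (hi : i.card ≤ κ') : #W ≤ κ' := by
  have h1 : (Set.univ : Set W) = ⋃ j : Set.Iio i, Set.range (Lm.r j.1 j.2) := by
    ext x
    simp only [Set.mem_univ, Set.mem_iUnion, true_iff]
    obtain ⟨j, hj, y, hy⟩ := Lm.cover x
    exact ⟨⟨j, hj⟩, y, hy⟩
  rw [← Cardinal.mk_univ, h1]
  exact mk_biUnion_ordinal_le hκ' hi _ fun j => Cardinal.mk_range_le.trans (h j.1 j.2)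

theorem ChainLimit.strong_sub {Y : Type u} [L.Structure Y] {C : Ordinal.{u} → L.Substructure Y}
    {κ : Cardinal.{u}} {P : ChainExt K C → Prop}
    {E : ∀ o o' : ChainExt K C, SEmb K o.carrier o'.carrier → Prop} {i : Ordinal.{u}}
    {Z W : Type u} [L.Structure Z] [L.Structure W] {ζ : SEmb K Z Y} {f : SEmb K Z W}
    {sub : L.Substructure W} {pt : W} (Lm : ChainLimit κ P E i ζ f sub pt)
    (hi : Order.IsSuccLimit i) (hs : ∀ j < i, K.Strong (Lm.ob j).sub) : K.Strong sub := by
  let c : ∀ j, j < i → SEmb K (Lm.ob j).sub W := fun j hj =>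
    (Lm.r j hj).comp (SEmb.ofSub (hs j hj))
  refine strong_iUnion_chain hi (coverChain c) (fun j hj => ?_) (fun j k hjk hk => ?_) _ ?_
  · rw [coverChain_eq c hj]
    exact (c j hj).strong_range
  · rw [coverChain_eq c (hjk.trans_lt hk), coverChain_eq c hk]
    rintro _ ⟨y, rfl⟩
    exact ⟨⟨Lm.map j k hjk hk y, (Lm.compat j k hjk hk).sub _ y.2⟩, Lm.r_map j k hjk hk y⟩
  · ext z
    simp only [SetLike.mem_coe, Set.mem_iUnion, exists_prop]
    constructor
    · intro hz
      obtain ⟨j, hj, y, hy, rfl⟩ := Lm.sub_cover z hz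
      exact ⟨j, hj, by rw [coverChain_eq c hj]; exact ⟨⟨y, hy⟩, rfl⟩⟩
    · rintro ⟨j, hj, hz⟩
      rw [coverChain_eq c hj] at hz
      obtain ⟨y, rfl⟩ := hz
      exact Lm.r_sub j hj y y.2

/-! ### Existence of free extensions -/

namespace Ctx

variable {s : K.Frame} {lam : Cardinal.{u}} {θ : WithTop Cardinal.{u}}

section

variable {A X Y N : Type u} [L.Structure A] [L.Structure X] [L.Structure Y] [L.Structure N]

theorem exists_tp_small (H : Ctx K s lam θ) (hX : lam ≤ #X) (p : K.GType X) :
    ∃ (N : Type u) (_ : L.Structure N) (i : SEmb K X N) (a : N), #N ≤ #X ∧ i.tp a = p := by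
  obtain ⟨N, _, i, a, rfl⟩ := p.exists_tp
  obtain ⟨V, _, f, v, h, hV, hf, rfl⟩ := H.exists_shrink i hX a
  exact ⟨V, inferInstance, f, v, hV, (SEmb.tp_eq_of_comp h f i (SEmb.ext hf) v).symm⟩

/-- A coherent sequence of types over the members of a continuous chain, in which every member
with a limit index is determined by the earlier ones, is the sequence of restrictions of a type
over the union. -/
theorem exists_type_of_chain (H : Ctx K s lam θ) {δ : Ordinal.{u}}
    {C : Ordinal.{u} → L.Substructure Y} (hC : Chain K δ C) (hCs : ∀ i, K.Strong (C i))
    (h0 : lam ≤ #(C 0))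
    (hY : ((#Y : Cardinal.{u}) : WithTop Cardinal.{u}) < θ) (hδ : δ.card ≤ #Y)
    (q : ∀ i, K.GType (C i))
    (hq : ∀ j i (hji : j ≤ i) (hi : i < δ),
      (q i).pull (SEmb.incl (hC.mono j i hji hi) (hCs j) (hCs i)) = q j)
    (hlim : ∀ i (hi : i < δ), Order.IsSuccLimit i → ∀ p : K.GType (C i),
      (∀ j (hj : j < i), p.pull (SEmb.incl (hC.mono j i hj.le hi) (hCs j) (hCs i)) = q j) →
        p = q i) :
    ∃ p : K.GType Y, ∀ i < δ, p.pull (SEmb.ofSub (hCs i)) = q i := by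
  have hCY : ∀ i, #(C i) ≤ #Y := fun i => Cardinal.mk_set_le _
  have hC0 : ∀ i < δ, lam ≤ #(C i) := fun i hi =>
    h0.trans (Cardinal.mk_le_mk_of_subset (hC.mono 0 i zero_le hi))
  have hYinf : ℵ₀ ≤ #Y := H.aleph0_le.trans (h0.trans (hCY 0))
  obtain ⟨W, _, f, sub, pt, ⟨Lm⟩⟩ := exists_chain_tower hYinf (fun o => o.emb.tp o.pt = q o.idx)
    (fun _ _ _ => True) hC (fun i hi => (Ordinal.card_le_card hi.le).trans hδ) hCs
    (fun _ _ _ _ _ _ _ _ => trivial) (fun _ _ _ _ _ _ _ _ _ _ => trivial)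
    (by
      obtain ⟨N, _, i, a, hN, ha⟩ := H.exists_tp_small h0 (q 0)
      exact ⟨⟨0, N, i, ⊥, a⟩, rfl, hN.trans (hCY 0), ha⟩)
    (fun o hi hW ha => by
      obtain ⟨idx, W, k, sub, a⟩ := o
      have hii : idx < δ := (Order.lt_succ idx).trans hi
      obtain ⟨V, _, k', a', hV, ha'⟩ := H.exists_tp_small (hC0 _ hi) (q (Order.succ idx))
      have h1 := hq idx (Order.succ idx) (Order.le_succ idx) hi
      rw [← ha', SEmb.tp_pull] at h1
      obtain ⟨U, _, g, g', hU, h2, h3⟩ := H.amalg_of_tp_eq hY k _ (hC0 _ hii) hW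
        (hV.trans (hCY _)) (ha.trans h1.symm)
      refine ⟨⟨Order.succ idx, U, g'.comp k', ⊤, g' a'⟩, g, rfl, hU, ?_,
        ⟨hC.mono _ _ (Order.le_succ idx) hi, ?_, fun _ _ => trivial, h3⟩, trivial⟩
      · exact (SEmb.tp_comp g' k' a').trans ha'
      · intro x x' hx
        have h4 := h2 x
        have h5 : SEmb.incl (hC.mono _ _ (Order.le_succ idx) hi) (hCs _) (hCs _) x = x' :=
          Subtype.ext hx
        rw [SEmb.comp_apply, h5] at h4
        exact h4)
    (fun o hi hl hW Lm => hlim o.idx hi hl _ fun j hj =>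
      ChainLimit.tp_pull Lm (p := q) (fun _ _ h => h) hj _ fun x => rfl)
  refine ⟨f.tp pt, fun i hi => Lm.tp_pull (p := q) (fun _ _ h => h) hi _ fun x => rfl⟩

/-- Basic types over a model of size `lam` have free extensions to all models in `K_F`. By induction
there are free extensions to the members of a filtration; they are coherent by uniqueness, and at
limits determined by the earlier ones, hence the restrictions of a type over the union, which is
free by continuity. -/
theorem exists_fr (H : Ctx K s lam θ) {p : K.GType A} (hp : p ∈ s.bs A) (hA : #A = lam)
    (e : SEmb K A Y) (hY : ((#Y : Cardinal.{u}) : WithTop Cardinal.{u}) < θ) :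
    ∃ q : K.GType Y, Fr s lam e q ∧ q.pull e = p := by
  induction hc : #Y using WellFoundedLT.induction generalizing Y with
  | ind c ih =>
  subst hc
  rcases (hA ▸ e.mk_le : lam ≤ #Y).eq_or_lt with hlam | hlam
  · obtain ⟨q, h1, h2⟩ := H.dnf_exists hp e hlam.symm
    exact ⟨q, (fr_iff H hA hlam.symm).2 h1, h2⟩
  · obtain ⟨C, hC, -, hCs, hD, hCc, hCl, -, -⟩ := exists_filtration e.mem_right H.LS_le hlam
      (fun _ => ∅) (fun _ => by simp) (Set.range e) (Cardinal.mk_range_le.trans hA.le)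
      (fun _ => ∅) (fun _ _ _ _ => by simp)
    have heC : ∀ i x, e x ∈ C i := fun i x => hD i ⟨x, rfl⟩
    have hCθ : ∀ i < (#Y).ord, ((#(C i) : Cardinal.{u}) : WithTop Cardinal.{u}) < θ := fun i hi =>
      (WithTop.coe_le_coe.2 (hCc i hi).le).trans_lt hY
    have hex : ∀ i, ∃ q : K.GType (C i), ∀ hi : i < (#Y).ord,
        Fr s lam (e.lift (hC.strong i hi) (heC i)) q ∧
          q.pull (e.lift (hC.strong i hi) (heC i)) = p := by
      intro i
      by_cases hi : i < (#Y).ord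
      · obtain ⟨q, h1, h2⟩ := ih _ (hCc i hi) (e.lift (hC.strong i hi) (heC i)) (hCθ i hi) rfl
        exact ⟨q, fun _ => ⟨h1, h2⟩⟩
      -- an arbitrary value outside the indices of the chain
      · have : Nonempty (C i) := Cardinal.mk_ne_zero_iff.1
          (Cardinal.aleph0_pos.trans_le (H.aleph0_le.trans (hCl i))).ne'
        exact ⟨(SEmb.refl (hCs i).mem).tp (Classical.arbitrary _), fun h => absurd h hi⟩
    choose q hq using hex
    have hqq : ∀ j i (hji : j ≤ i) (hi : i < (#Y).ord),
      (q i).pull (SEmb.incl (hC.mono j i hji hi) (hC.strong j (hji.trans_lt hi)) (hC.strong i hi))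
        = q j := by
      intro j i hji hi
      have hj := hji.trans_lt hi
      obtain ⟨h1, h2⟩ := hq i hi
      obtain ⟨h3, h4⟩ := hq j hj
      refine Fr.uniq H (hCθ j hj) (e := e.lift (hC.strong j hj) (heC j)) (Fr.pull ?_) h3 ?_
      · exact h1
      · rw [h4, GType.pull_pull]
        exact h2
    obtain ⟨r, hr⟩ := H.exists_type_of_chain hC hCs (hCl 0) hY (by simp) q hqq (by
      intro i hi hl r hr
      obtain ⟨h1, h2⟩ := hq i hi
      refine Fr.uniq H (hCθ i hi) (e := e.lift (hC.strong i hi) (heC i)) ?_ h1 ?_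
      · refine Fr.of_cover H hl (fun j hj => SEmb.incl (hC.mono j i hj.le hi)
          (hC.strong j (hj.trans hi)) (hC.strong i hi))
          (fun j k hjk hk x => ⟨⟨x, hC.mono j k hjk (hk.trans hi) x.2⟩, rfl⟩)
          (fun x => by
            obtain ⟨j, hj, hxj⟩ := hC.cont i hi hl x x.2
            exact ⟨j, hj, ⟨x, hxj⟩, rfl⟩)
          (fun a => ⟨⟨e a, heC 0 a⟩, rfl⟩) (fun j hj e' he' => ?_)
        rw [hr j hj]
        have : e' = e.lift (hC.strong j (hj.trans hi)) (heC j) := by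
          ext x
          exact congrArg (fun z : C i => (z : Y)) (DFunLike.congr_fun he' x)
        rw [this]
        exact (hq j (hj.trans hi)).1
      · rw [h2]
        obtain ⟨h3, h4⟩ := hq 0 hC.lim.bot_lt
        rw [← hr 0 hl.bot_lt, GType.pull_pull] at h4
        exact h4)
    refine ⟨r, Fr.of_chain H hC (heC 0) fun i hi e' he' => ?_, ?_⟩
    · rw [hr i hi]
      obtain ⟨h1, h2⟩ := hq i hi
      have : e' = e.lift (hC.strong i hi) (heC i) := by
        ext x
        exact DFunLike.congr_fun he' x
      rwa [this]
    · obtain ⟨h3, h4⟩ := hq 0 hC.lim.bot_lt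
      rw [← hr 0 hC.lim.bot_lt, GType.pull_pull] at h4
      exact h4

theorem Fr.bs (H : Ctx K s lam θ) {e : SEmb K A X} {p : K.GType X} (h : Fr s lam e p) :
    p.pull e ∈ s.bs A := by
  have h1 := h.2 A e (SEmb.refl e.mem_left) h.1 rfl
  exact H.dnf_bs _ h1

/-- An element free over `X` can be made free over a given extension `Y` of `X`, in an amalgam. -/
theorem exists_free_amalgam (H : Ctx K s lam θ) {κ : Cardinal.{u}}
    (hκ : (κ : WithTop Cardinal.{u}) < θ) (i : SEmb K X N) (a : N) {e : SEmb K A X}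
    (ha : Fr s lam e (i.tp a)) (j : SEmb K X Y) (hN : #N ≤ κ) (hY : #Y ≤ κ) :
    ∃ (W : Type u) (_ : L.Structure W) (g : SEmb K N W) (k : SEmb K Y W), #W ≤ κ ∧
      (∀ x, g (i x) = k (j x)) ∧ Fr s lam (j.comp e) (k.tp (g a)) := by
  have hlt : ∀ {c : Cardinal.{u}}, c ≤ κ → (c : WithTop Cardinal.{u}) < θ := fun h =>
    (WithTop.coe_le_coe.2 h).trans_lt hκ
  obtain ⟨q, hq, hqe⟩ := H.exists_fr (ha.bs H) ha.1 (j.comp e) (hlt hY)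
  obtain ⟨V, _, k₀, a₀, hV, rfl⟩ := H.exists_tp_small (ha.le.trans j.mk_le) q
  have h1 : i.tp a = (k₀.comp j).tp a₀ := by
    refine Fr.uniq H (hlt (i.mk_le.trans hN)) ha (Fr.pull (j := j) hq) ?_
    rw [← hqe]
    rfl
  obtain ⟨W, _, g, g', hW, h2, h3⟩ := H.amalg_of_tp_eq hκ i (k₀.comp j) ha.le hN (hV.trans hY) h1
  refine ⟨W, inferInstance, g, g'.comp k₀, hW, h2, ?_⟩
  rw [h3, SEmb.tp_comp]
  exact hq

end

end Ctx

/-! ### Symmetry and pushing elements along extensions -/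

namespace Ctx

variable {s : K.Frame} {lam : Cardinal.{u}} {θ : WithTop Cardinal.{u}}

/-- Nonforking of a type over a model of size `lam` is witnessed in every model of size `lam` in
which the type is realized. -/
theorem nf_of_dnf (H : Ctx K s lam θ) {A M N : Type u} [L.Structure A] [L.Structure M]
    [L.Structure N] (i : SEmb K M N) (hN : #N = lam) (d : SEmb K A M) (a : N)
    (h : s.DoesNotFork (i.tp a) d.range) : s.nf (i.comp d).range i.range a := by
  have hM := H.dnf_mem_left h
  obtain ⟨x, hx, hnf⟩ := h
  let z : SEmb K M x.carrier := ⟨x.emb, x.strong⟩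
  have hdom := H.good.nf_dom _ _ _ hnf
  have hxc := inF_succ_iff.1 hdom.2.2.1
  have hr : d.range.map x.emb.toHom = (z.comp d).range := (SEmb.range_comp z d).symm
  rw [hr] at hnf
  obtain ⟨W, _, g, g', hW, h1, h2⟩ := H.amalg_of_tp_eq H.lt z i hM.2.ge hxc.2.le hN.le
    (show z.tp x.pt = i.tp a from hx)
  have hWc : #W = lam := le_antisymm hW (hN ▸ g'.mk_le)
  have le_of : ∀ {U : Type u} [L.Structure U] {P Q : L.Substructure U}, K.Strong P → K.Strong Q →
      P ≤ Q → K.Le P Q := fun hP hQ hPQ => (Strong.le_iff hP hQ).2 hPQ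
  have hle : (i.comp d).range ≤ i.range := by
    rintro _ ⟨y, rfl⟩
    exact ⟨d y, rfl⟩
  have hle' : (z.comp d).range ≤ z.range := by
    rintro _ ⟨y, rfl⟩
    exact ⟨d y, rfl⟩
  -- pass up to `W`, then down to the copy of `N` in `W`
  have h3 := H.good.mono_up _ _ _ _ _ g.emb hnf
    (le_of (z.comp d).strong_range (z.comp d).strong_range le_rfl)
    (le_of (z.comp d).strong_range z.strong_range hle')
    (le_of z.strong_range z.strong_range le_rfl) g.strong (inF_succ_iff.2 ⟨g.mem_right, hWc⟩)
  have e1 : (z.comp d).range.map g.emb.toHom = (g'.comp (i.comp d)).range := by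
    rw [← SEmb.range_comp]
    congr 1
    ext y
    exact h1 (d y)
  have e2 : z.range.map g.emb.toHom = (g'.comp i).range := by
    rw [← SEmb.range_comp]
    congr 1
    ext y
    exact h1 y
  rw [e1, e2] at h3
  have hpt : g.emb x.pt = g' a := h2
  rw [hpt] at h3
  have h4 := H.good.mono_down _ (g'.comp (i.comp d)).range (g'.comp i).range _ g'.range (g' a) h3
    (le_of (SEmb.strong_range _) (SEmb.strong_range _) le_rfl)
    (le_of (SEmb.strong_range _) (SEmb.strong_range _) (by
      rintro _ ⟨y, rfl⟩
      exact ⟨d y, rfl⟩))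
    (le_of (SEmb.strong_range _) (SEmb.strong_range _) le_rfl)
    (le_of (SEmb.strong_range _) (SEmb.strong_range _) (by
      rintro _ ⟨y, rfl⟩
      exact ⟨i y, rfl⟩)) g'.strong_range ⟨a, rfl⟩
  have h5 := H.good.nf_iso g'.emb.equivRange.symm _ _ _ h4
  have e3 : ∀ y : g'.range, g' (g'.emb.equivRange.symm y) = y := fun y =>
    (g'.emb.equivRange_apply _).symm.trans
      (congrArg Subtype.val (g'.emb.equivRange.apply_symm_apply y))
  have e4 : ∀ {V : Type u} [L.Structure V] (k : SEmb K V N),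
      ((g'.comp k).range.comap g'.range.subtype.toHom).map g'.emb.equivRange.symm.toHom
        = k.range := by
    intro V _ k
    ext y
    constructor
    · rintro ⟨w, ⟨v, hv⟩, rfl⟩
      refine ⟨v, g'.injective ?_⟩
      exact Eq.trans hv (e3 w).symm
    · rintro ⟨v, rfl⟩
      exact ⟨⟨g' (k v), ⟨_, rfl⟩⟩, ⟨v, rfl⟩, g'.injective (e3 _)⟩
  rw [e4, e4] at h5
  have e5 : g'.emb.equivRange.symm (⟨g' a, ⟨a, rfl⟩⟩ : g'.range) = a := g'.injective (e3 _)
  rwa [e5] at h5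

/-- Symmetry for models of size `χ`: if `b` is free over a model `P` containing `X` and `a`, and `a`
is free over `X`, then `a` is free over a model containing `X` and `b`, in an extension. -/
def SymAt (K : AEC.{u} L) (s : K.Frame) (lam χ : Cardinal.{u}) : Prop :=
  ∀ (A A' X P N : Type u) [L.Structure A] [L.Structure A'] [L.Structure X] [L.Structure P]
    [L.Structure N] (e : SEmb K A X) (e' : SEmb K A' X) (x : SEmb K X P) (y : SEmb K P N) (b : N)
    (a : P), χ ≤ #X → #N ≤ χ → Fr s lam (x.comp e) (y.tp b) → Fr s lam e' (x.tp a) →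
    ∃ (N' R : Type u) (_ : L.Structure N') (_ : L.Structure R) (g : SEmb K N N') (r : SEmb K R N')
      (x' : SEmb K X R) (b' : R), #N' ≤ χ ∧ (∀ z, r (x' z) = g (y (x z))) ∧ r b' = g b ∧
        Fr s lam (x'.comp e') (r.tp (g (y a)))

theorem symAt_lam (H : Ctx K s lam θ) : SymAt K s lam lam := by
  intro A A' X P N _ _ _ _ _ e e' x y b a hX hN hb ha
  have hXc : #X = lam := le_antisymm (((y.comp x).mk_le).trans hN) hX
  have hNc : #N = lam := le_antisymm hN (hX.trans (y.comp x).mk_le)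
  have hPc : #P = lam := le_antisymm (y.mk_le.trans hN) (hX.trans x.mk_le)
  have hb1 : Fr s lam x (y.tp b) := Fr.base H hb hXc
  have hb2 := H.nf_of_dnf y hNc x b ((fr_iff H hXc hPc).1 hb1)
  have ha1 := (fr_iff H ha.1 hXc).1 ha
  obtain ⟨k, hks, hk⟩ := exists_range_inverse (y.comp x)
  have ha2 : K.tp (y.comp x).range (y.comp x).strong_range (y a) ∈ s.bs _ := by
    have h1 := H.bs_pull_of_surjective (H.dnf_bs _ ha1) k hks
    rw [← SEmb.tp_comp y, SEmb.tp_pull, hk] at h1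
    exact h1
  obtain ⟨N', _, j, M₁, hj, hjb, hnf⟩ := H.good.symmetry (y.comp x).range y.range
    (y.comp x).strong_range b (y a) hb2 ⟨a, rfl⟩ ha2
  have hdom := H.good.nf_dom _ _ _ hnf
  let J : SEmb K N N' := ⟨j, hj⟩
  have hle : ((y.comp x).range.map j.toHom) ≤ M₁ := hdom.2.2.2.1.1
  let x' : SEmb K X M₁ := (J.comp (y.comp x)).lift hdom.2.2.2.2 fun z =>
    hle ⟨y (x z), ⟨z, rfl⟩, rfl⟩
  have hMc : #M₁ = lam := (inF_succ_iff.1 hdom.2.1).2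
  have hNc' : #N' = lam := (inF_succ_iff.1 hdom.2.2.1).2
  refine ⟨N', M₁, inferInstance, inferInstance, J, SEmb.ofSub hdom.2.2.2.2, x', ⟨j b, hjb⟩,
    hNc'.le, fun z => rfl, rfl, ?_⟩
  rw [fr_iff H ha.1 hMc]
  refine H.dnf_trans x' e' ?_ ?_
  · refine ⟨⟨N', (SEmb.ofSub hdom.2.2.2.2).emb, (SEmb.ofSub hdom.2.2.2.2).strong, j (y a)⟩, rfl, ?_⟩
    have e1 : x'.range.map (SEmb.ofSub hdom.2.2.2.2).emb.toHom =
        (y.comp x).range.map j.toHom := by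
      rw [← SEmb.range_comp]
      exact SEmb.range_comp J (y.comp x)
    have e2 : (SEmb.ofSub hdom.2.2.2.2).emb.toHom.range = M₁ := SEmb.range_ofSub hdom.2.2.2.2
    change s.nf (x'.range.map (SEmb.ofSub hdom.2.2.2.2).emb.toHom)
      (SEmb.ofSub hdom.2.2.2.2).emb.toHom.range (j (y a))
    rw [e1, e2]
    exact hnf
  · have e1 : ((SEmb.ofSub hdom.2.2.2.2).tp (J (y a))).pull x' = x.tp a := by
      rw [SEmb.tp_pull]
      exact (SEmb.tp_eq_of_comp (J.comp y) x _ rfl a)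
    exact e1 ▸ ha1

/-- A commutative square of extensions in which a new element `a` and an old element `c` stay
free: `a`, free from `M`, becomes free from `R`, and `c`, free from `M`, becomes free from `M'`. -/
theorem SymAt.push (H : Ctx K s lam θ) {χ : Cardinal.{u}} (hχ : (χ : WithTop Cardinal.{u}) < θ)
    (hS : SymAt K s lam χ) {M M' R A D : Type u} [L.Structure M] [L.Structure M'] [L.Structure R]
    [L.Structure A] [L.Structure D] (hM : χ ≤ #M) (hM' : #M' ≤ χ) (hR : #R ≤ χ)
    (f : SEmb K M R) (c : R) (d : SEmb K D M) (hc : Fr s lam d (f.tp c)) (j : SEmb K M M') (a : M')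
    (e : SEmb K A M) (ha : Fr s lam e (j.tp a)) :
    ∃ (R' : Type u) (_ : L.Structure R') (g : SEmb K R R') (f' : SEmb K M' R'), #R' ≤ χ ∧
      (∀ x, f' (j x) = g (f x)) ∧ Fr s lam (f.comp e) (g.tp (f' a)) ∧
      Fr s lam (j.comp d) (f'.tp (g c)) := by
  obtain ⟨W₁, _, g₁, k₁, hW₁, h1, h1'⟩ := H.exists_free_amalgam hχ j a ha f hM' hR
  obtain ⟨N₂, Q, _, _, g₂, r, x', b', hN₂, h2, hb', h2'⟩ := hS A D M R W₁ e d f k₁ (g₁ a) c hM hW₁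
    h1' hc
  have htp : x'.tp b' = j.tp a := by
    rw [← SEmb.tp_comp r, hb']
    exact SEmb.tp_eq_of_comp (g₂.comp g₁) j (r.comp x')
      (SEmb.ext fun z => (congrArg g₂ (h1 z)).trans (h2 z).symm) a
  obtain ⟨W₃, _, g₃, h₃, hW₃, h3, h3'⟩ := H.amalg_of_tp_eq hχ x' j (hc.1 ▸ d.mk_le)
    (r.mk_le.trans hN₂) hM' htp
  obtain ⟨W₄, _, g₄, k₄, hW₄, h4, h4'⟩ := H.exists_free_amalgam hχ r (g₂ (k₁ c)) h2' g₃ hN₂ hW₃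
  refine ⟨W₄, inferInstance, g₄.comp (g₂.comp k₁), k₄.comp h₃, hW₄, fun x => ?_, ?_, ?_⟩
  · simp only [SEmb.comp_apply]
    rw [← h3, ← h4, h2]
  · have e1 : (k₄.comp h₃) a = g₄ (g₂ (g₁ a)) := by
      simp only [SEmb.comp_apply]
      rw [← h3', ← h4, hb']
    rw [e1]
    have e2 := SEmb.tp_eq_of_comp (g₄.comp g₂) k₁ (g₄.comp (g₂.comp k₁)) rfl (g₁ a)
    exact e2 ▸ h1'
  · have e1 : g₃.comp (x'.comp d) = h₃.comp (j.comp d) := SEmb.ext fun z => h3 (d z)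
    rw [e1] at h4'
    exact h4'.pull

end Ctx

/-! ### Free sequences -/

namespace Ctx

variable {s : K.Frame} {lam : Cardinal.{u}} {θ : WithTop Cardinal.{u}}

section

variable {A D M N X : Type u} [L.Structure A] [L.Structure D] [L.Structure M] [L.Structure N]
  [L.Structure X]

/-- Whether the distinguished point is the element `m` of the base is an invariant of the type. -/
theorem pt_eq_of_eqvGen {x y : K.PointedExt M} (h : Relation.EqvGen (K.AtEq M) x y) (m : M) :
    x.pt = x.emb m ↔ y.pt = y.emb m := by
  induction h with
  | rel x y h =>
    obtain ⟨W, _, g, g', -, -, h, hp⟩ := h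
    constructor
    · intro hx
      apply g'.injective
      rw [← hp, ← h, hx]
    · intro hx
      apply g.injective
      rw [hp, h, hx]
  | refl => rfl
  | symm _ _ _ ih => exact ih.symm
  | trans _ _ _ _ _ ih1 ih2 => exact ih1.trans ih2

/-- Free types are not realized in their domain. -/
theorem Fr.not_mem (H : Ctx K s lam θ) {e : SEmb K A X} {i : SEmb K X N} {a : N}
    (h : Fr s lam e (i.tp a)) : a ∉ i.range := by
  rintro ⟨x, rfl⟩
  obtain ⟨M, _, m, d, -, hM, hd, -, hx⟩ := H.exists_common e e h.1.le h.1.le h.le {x} (by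
    rw [Cardinal.mk_singleton]
    exact Cardinal.one_le_aleph0.trans H.aleph0_le)
  obtain ⟨z, rfl⟩ := hx x rfl
  obtain ⟨y, hy, hy'⟩ := (H.good.bs_dom _ _ (H.dnf_bs d (h.2 M m d hM hd))).2
  exact hy' ⟨z, ((pt_eq_of_eqvGen (Quot.eqvGen_exact hy) z).2 rfl).symm⟩

/-- A type which agrees with a free type on the members of a chain is equal to it. -/
theorem Fr.eq_of_cover (H : Ctx K s lam θ) {e : SEmb K A X} {p q : K.GType X}
    (hX : ((#X : Cardinal.{u}) : WithTop Cardinal.{u}) < θ) (hp : Fr s lam e p)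
    {δ : Ordinal.{u}} {B : Ordinal.{u} → Type u} [∀ j, L.Structure (B j)]
    (hδ : Order.IsSuccLimit δ) (c : ∀ j, j < δ → SEmb K (B j) X)
    (hm : ∀ j k (hjk : j ≤ k) (hk : k < δ) x, c j (hjk.trans_lt hk) x ∈ (c k hk).range)
    (hs : ∀ x, ∃ j, ∃ hj : j < δ, x ∈ (c j hj).range)
    (he : ∀ a, e a ∈ (c 0 hδ.bot_lt).range)
    (hq : ∀ j (hj : j < δ), q.pull (c j hj) = p.pull (c j hj)) : q = p := by
  refine Fr.uniq H hX (Fr.of_cover H hδ c hm hs he fun j hj e' he' => ?_) hp ?_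
  · rw [hq]
    exact Fr.pull (he' ▸ hp)
  · obtain ⟨k, hk⟩ := SEmb.exists_factor (c 0 hδ.bot_lt) e he
    rw [← hk, ← GType.pull_pull, hq, GType.pull_pull]

end

section

variable {A D M N X : Type u} [L.Structure A] [L.Structure D] [L.Structure M] [L.Structure N]
  [L.Structure X]

/-- A resolution `C` of `X` into models of size `χ`, indexed by `χ⁺`, and elements
`a i ∈ C (i + 1)` which are free from `C i` over the common base `A`. -/
structure FreeSeq (s : K.Frame) (lam χ : Cardinal.{u}) (C : Ordinal.{u} → L.Substructure X)
    (e : SEmb K A X) (a : Ordinal.{u} → X) : Prop where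
  chain : Chain K (Order.succ χ).ord C
  strong : ∀ i, K.Strong (C i)
  card_le : ∀ i < (Order.succ χ).ord, #(C i) ≤ χ
  le_card : ∀ i < (Order.succ χ).ord, χ ≤ #(C i)
  base : ∀ i z, e z ∈ C i
  mem : ∀ i < (Order.succ χ).ord, a i ∈ C (Order.succ i)
  free : ∀ i < (Order.succ χ).ord,
    Fr s lam (e.lift (strong i) (base i)) ((SEmb.ofSub (strong i)).tp (a i))

/-- Given a free sequence in `M` and a free type over `M`, the type is realized in an
extension of `M` which is the union of models `R j ≥ C j` of size `χ` such that `a j` is free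
from `R j`. Successor steps use symmetry in size `χ`, in the form `SymAt.push`; at limits the
distinguished point still realizes the given type by uniqueness and continuity. -/
theorem FreeSeq.exists_push (H : Ctx K s lam θ) {χ : Cardinal.{u}}
    (hχ : ((Order.succ χ : Cardinal.{u}) : WithTop Cardinal.{u}) < θ) (hlam : lam ≤ χ)
    (hS : SymAt K s lam χ) {C : Ordinal.{u} → L.Substructure M} {e : SEmb K A M}
    {a : Ordinal.{u} → M} (F : FreeSeq s lam χ C e a) (hM : #M ≤ Order.succ χ) (ι : SEmb K M N)
    (c : N) (d : SEmb K D M) (hd : ∀ i z, d z ∈ C i) (hc : Fr s lam d (ι.tp c)) :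
    ∃ (R : Type u) (_ : L.Structure R) (f : SEmb K M R) (sub : L.Substructure R) (c' : R),
      f.tp c' = ι.tp c ∧ Nonempty (ChainLimit χ (fun _ => True)
        (fun o o' g => ∃ x : C o'.idx, (x : M) = a o.idx ∧
          Fr s lam (o.emb.comp (e.lift (F.strong o.idx) (F.base o.idx))) (g.tp (o'.emb x)))
        (Order.succ χ).ord (SEmb.refl f.mem_left) f sub c') := by
  have hinf : ℵ₀ ≤ χ := H.aleph0_le.trans hlam
  have hχ' : (χ : WithTop Cardinal.{u}) < θ :=
    (WithTop.coe_le_coe.2 (Order.le_succ χ)).trans_lt hχ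
  have hMθ : ((#M : Cardinal.{u}) : WithTop Cardinal.{u}) < θ :=
    (WithTop.coe_le_coe.2 hM).trans_lt hχ
  have hCθ : ∀ i < (Order.succ χ).ord, ((#(C i) : Cardinal.{u}) : WithTop Cardinal.{u}) < θ :=
    fun i hi => (WithTop.coe_le_coe.2 (F.card_le i hi)).trans_lt hχ'
  let q : ∀ i, K.GType (C i) := fun i => (ι.tp c).pull (SEmb.ofSub (F.strong i))
  let dl : ∀ i, SEmb K D (C i) := fun i => d.lift (F.strong i) (hd i)
  have hq : ∀ i, Fr s lam (dl i) (q i) := fun i => Fr.pull (j := SEmb.ofSub (F.strong i)) hc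
  have hδ : ∀ i < (Order.succ χ).ord, i.card ≤ χ := fun i hi =>
    Order.lt_succ_iff.1 (Cardinal.lt_ord.1 hi)
  obtain ⟨R, _, f, sub, c', ⟨Lm⟩⟩ := exists_chain_tower hinf
    (fun o => o.emb.tp o.pt = q o.idx)
    (fun o o' g => ∃ x : C o'.idx, (x : M) = a o.idx ∧
          Fr s lam (o.emb.comp (e.lift (F.strong o.idx) (F.base o.idx))) (g.tp (o'.emb x)))
    F.chain hδ F.strong
    (fun o o' o'' f g hf hg ⟨x, hx, h⟩ => by
      refine ⟨⟨x, hg.le x.2⟩, hx, ?_⟩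
      rw [← hg.emb x ⟨x, hg.le x.2⟩ rfl, SEmb.tp_comp]
      exact h)
    (fun o o' o'' f g hfs hidx hf hg ⟨x, hx, h⟩ => by
      refine ⟨x, hx.trans (by rw [hidx]), ?_⟩
      rw [← SEmb.tp_pull]
      refine Fr.pull ?_
      have h1 : f.comp (o.emb.comp (e.lift (F.strong o.idx) (F.base o.idx))) =
          o'.emb.comp (e.lift (F.strong o'.idx) (F.base o'.idx)) :=
        SEmb.ext fun z => hf.emb _ _ rfl
      rwa [h1])
    (by
      obtain ⟨N, _, i, a, hN, ha⟩ := H.exists_tp_small (hlam.trans (F.le_card 0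
        F.chain.lim.bot_lt)) (q 0)
      exact ⟨⟨0, N, i, ⊥, a⟩, rfl, hN.trans (F.card_le 0 F.chain.lim.bot_lt), ha⟩)
    (fun o hi hW ha => by
      obtain ⟨i, W, k, sub, b⟩ := o
      have hii : i < (Order.succ χ).ord := (Order.lt_succ i).trans hi
      have hle := F.chain.mono _ _ (Order.le_succ i) hi
      let j : SEmb K (C i) (C (Order.succ i)) := SEmb.incl hle (F.strong _) (F.strong _)
      have hfree : Fr s lam (e.lift (F.strong i) (F.base i)) (j.tp ⟨a i, F.mem i hii⟩) := by
        have h1 := F.free i hii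
        exact (SEmb.tp_eq_of_comp (SEmb.ofSub (F.strong (Order.succ i))) j
          (SEmb.ofSub (F.strong i)) rfl (⟨a i, F.mem i hii⟩ : C (Order.succ i))) ▸ h1
      have hb : Fr s lam (dl i) (k.tp b) := by
        have : k.tp b = q i := ha
        rw [this]
        exact hq i
      obtain ⟨R', _, g, f', hR', h1, h2, h3⟩ := hS.push H hχ' (F.le_card i hii) (F.card_le _ hi) hW
        k b (dl i) hb j ⟨a i, F.mem i hii⟩ _ hfree
      refine ⟨⟨Order.succ i, R', f', ⊤, g b⟩, g, rfl, hR', ?_, ⟨hle, ?_, fun _ _ => trivial, rfl⟩,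
        ?_⟩
      · refine Fr.uniq H (hCθ _ hi) h3 (hq _) ?_
        have h5 : (f'.tp (g b)).pull j = q i :=
          (SEmb.tp_eq_of_comp g k (f'.comp j) (SEmb.ext fun x => (h1 x).symm) b).trans ha
        rw [← GType.pull_pull, h5]
        rfl
      · intro x x' hx
        have : j x = x' := Subtype.ext hx
        exact this ▸ (h1 x).symm
      · exact ⟨⟨a i, F.mem i hii⟩, rfl, h2⟩)
    (fun o hi hl hW Lm => by
      refine Fr.eq_of_cover H (hCθ _ hi) (hq _) hl
        (fun j hj => SEmb.incl (F.chain.mono j o.idx hj.le hi) (F.strong j) (F.strong _))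
        (fun j k hjk hk x => ⟨⟨x, F.chain.mono j k hjk (hk.trans hi) x.2⟩, rfl⟩)
        (fun x => by
          obtain ⟨j, hj, hxj⟩ := F.chain.cont o.idx hi hl x x.2
          exact ⟨j, hj, ⟨x, hxj⟩, rfl⟩)
        (fun z => ⟨⟨d z, hd 0 z⟩, rfl⟩) fun j hj => ?_
      exact ChainLimit.tp_pull Lm (p := q) (fun _ _ h => h) hj _ fun x => rfl)
  refine ⟨R, inferInstance, f, sub, c', ?_, ⟨{ Lm with good := fun _ _ => trivial }⟩⟩
  refine Fr.eq_of_cover H hMθ hc F.chain.lim (fun j _ => SEmb.ofSub (F.strong j))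
    (fun j k hjk hk x => ⟨⟨x, F.chain.mono j k hjk hk x.2⟩, rfl⟩)
    (fun x => by
      obtain ⟨j, hj, hxj⟩ := F.chain.top x
      exact ⟨j, hj, ⟨x, hxj⟩, rfl⟩)
    (fun z => ⟨⟨d z, hd 0 z⟩, rfl⟩) fun j hj => ?_
  exact ChainLimit.tp_pull Lm (p := q) (fun _ _ h => h) hj _ fun x => rfl

end

/-! ### Continuous decompositions -/

section club

variable {α : Type u} {χ : Cardinal.{u}}

/-- Regularity of `χ⁺`. -/
theorem exists_bound_of_small {χ : Cardinal.{u}} (hχ : ℵ₀ ≤ χ) {ι : Type u} (hι : #ι ≤ χ)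
    (r : ι → Ordinal.{u}) (hr : ∀ x, r x < (Order.succ χ).ord) :
    (⨆ x, Order.succ (r x)) < (Order.succ χ).ord := by
  have hreg := Cardinal.isRegular_succ hχ
  have hlim : Order.IsSuccLimit (Order.succ χ).ord :=
    Cardinal.isSuccLimit_ord (hχ.trans (Order.le_succ χ))
  refine Ordinal.iSup_lt_of_lt_cof ?_ fun x => hlim.succ_lt (hr x)
  rw [hreg.cof_ord]
  exact hι.trans_lt (Order.lt_succ χ)

open Classical in
/-- Let `C` be a continuous increasing sequence of sets of size at most `χ`, of length `χ⁺`, and `Z`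
an increasing sequence with `Z i ⊆ C i`. Sets of size at most `χ` closed under a suitable operation
are members of the sequence `C`, and meet the union of the `Z i` in the corresponding `Z i`. -/
theorem exists_club (hχ : ℵ₀ ≤ χ) (C Z : Ordinal.{u} → Set α)
    (hm : ∀ i j, i ≤ j → j < (Order.succ χ).ord → C i ⊆ C j)
    (hc : ∀ i < (Order.succ χ).ord, Order.IsSuccLimit i → ∀ x ∈ C i, ∃ j < i, x ∈ C j)
    (ht : ∀ x, ∃ i < (Order.succ χ).ord, x ∈ C i)
    (hcard : ∀ i < (Order.succ χ).ord, #(C i) ≤ χ)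
    (hZm : ∀ i j, i ≤ j → j < (Order.succ χ).ord → Z i ⊆ Z j)
    (hZC : ∀ i < (Order.succ χ).ord, Z i ⊆ C i) :
    ∃ F : Finset α → Set α, (∀ t, #(F t) ≤ χ) ∧ ∀ S : Set α, Cl F S → #S ≤ χ →
      ∃ i < (Order.succ χ).ord, S = C i ∧
        ∀ x, (x ∈ S ∧ ∃ j < (Order.succ χ).ord, x ∈ Z j) ↔ x ∈ Z i := by
  have hlim : Order.IsSuccLimit (Order.succ χ).ord :=
    Cardinal.isSuccLimit_ord (hχ.trans (Order.le_succ χ))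
  have hex : ∀ x, ∃ i < (Order.succ χ).ord, x ∈ C i ∧
      ((∃ j < (Order.succ χ).ord, x ∈ Z j) → x ∈ Z i) := by
    intro x
    obtain ⟨i, hi, hx⟩ := ht x
    by_cases h : ∃ j < (Order.succ χ).ord, x ∈ Z j
    · obtain ⟨j, hj, hxj⟩ := h
      exact ⟨max i j, max_lt hi hj, hm i _ (le_max_left _ _) (max_lt hi hj) hx,
        fun _ => hZm j _ (le_max_right _ _) (max_lt hi hj) hxj⟩
    · exact ⟨i, hi, hx, fun h' => absurd h' h⟩
  -- a set `S` that contains `C 0`, and `C (r x + 1)` for all `x ∈ S`, is `C i` for the supremum `i`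
  -- of the `r x + 1`
  choose r hr hrC hrZ using hex
  refine ⟨fun t => C 0 ∪ ⋃ x : t, C (Order.succ (r x)), fun t => ?_, fun S hS hSc => ?_⟩
  · exact mk_union_le_of_le hχ (hcard 0 hlim.bot_lt) (mk_iUnion_le_of_le hχ _
      ((Cardinal.lt_aleph0_of_finite _).le.trans hχ) fun x => hcard _ (hlim.succ_lt (hr _)))
  · have h0 : C 0 ⊆ S := Set.subset_union_left.trans (hS ∅ (by simp))
    have h1 : ∀ x ∈ S, C (Order.succ (r x)) ⊆ S := fun x hx => by
      refine Set.Subset.trans ?_ (hS {x} (by simpa using hx))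
      exact Set.Subset.trans (Set.subset_iUnion
        (fun y : ({x} : Finset α) => C (Order.succ (r y))) ⟨x, by simp⟩) Set.subset_union_right
    let i : Ordinal.{u} := ⨆ x : S, Order.succ (r x)
    have hi : i < (Order.succ χ).ord := exists_bound_of_small hχ hSc _ fun x => hr x
    have hri : ∀ x ∈ S, Order.succ (r x) ≤ i := fun x hx =>
      Ordinal.le_iSup (fun x : S => Order.succ (r x)) ⟨x, hx⟩
    have hSi : S = C i := by
      apply Set.Subset.antisymm
      · intro x hx
        exact hm _ _ ((Order.le_succ _).trans (hri x hx)) hi (hrC x)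
      · -- elements below the supremum are below one of the ordinals
        have hlt : ∀ j < i, C (Order.succ j) ⊆ S := by
          intro j hj
          obtain ⟨x, hx⟩ := (Ordinal.lt_iSup_iff).1 hj
          exact (hm _ _ (Order.succ_le_of_lt hx) (hlim.succ_lt (hr _))).trans (h1 x x.2)
        rcases Ordinal.zero_or_succ_or_isSuccLimit i with h | ⟨j, h⟩ | h
        · rw [h]
          exact h0
        · have := hlt j (h ▸ Order.lt_succ j)
          rwa [h] at this
        · intro x hx
          obtain ⟨j, hj, hxj⟩ := hc i hi h x hx
          exact hlt j hj (hm _ _ (Order.le_succ j) ((h.succ_lt hj).trans hi) hxj)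
    refine ⟨i, hi, hSi, fun x => ⟨fun ⟨hx, hxZ⟩ => ?_, fun hx => ⟨?_, i, hi, hx⟩⟩⟩
    · exact hZm _ _ ((Order.le_succ _).trans (hri x hx)) hi (hrZ x hxZ)
    · rw [hSi]
      exact hZC i hi hx

end club

end Ctx

/-! ### Submodels on which a free sequence stays free -/

namespace Ctx

variable {s : K.Frame} {lam : Cardinal.{u}} {θ : WithTop Cardinal.{u}}

section

variable {A B D M N R S X : Type u} [L.Structure A] [L.Structure B] [L.Structure D] [L.Structure M]
  [L.Structure N] [L.Structure R] [L.Structure S] [L.Structure X]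

/-- Freeness passes to smaller domains containing the base. -/
theorem Fr.of_le {r : SEmb K B N} {d : SEmb K A B} {y : N} (h : Fr s lam d (r.tp y))
    (j : SEmb K S N) (hj : ∀ z, j z ∈ r.range) (e : SEmb K A S) (he : ∀ z, j (e z) = r (d z)) :
    Fr s lam e (j.tp y) := by
  obtain ⟨k, rfl⟩ := SEmb.exists_factor r j hj
  rw [← SEmb.tp_pull]
  refine Fr.pull ?_
  have : k.comp e = d := SEmb.ext fun z => r.injective (he z)
  rwa [this]

variable {χ : Cardinal.{u}} {C : Ordinal.{u} → L.Substructure X} {e : SEmb K A X}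
  {a : Ordinal.{u} → X}

theorem FreeSeq.not_mem (F : FreeSeq s lam χ C e a) (H : Ctx K s lam θ) {i : Ordinal.{u}}
    (hi : i < (Order.succ χ).ord) : a i ∉ C i := fun h =>
  Fr.not_mem H (F.free i hi) ⟨⟨a i, h⟩, rfl⟩

/-- The index `i` is determined by the set of the `a k` in `C i`. -/
theorem FreeSeq.injective (F : FreeSeq s lam χ C e a) (H : Ctx K s lam θ) {i j : Ordinal.{u}}
    (hi : i < (Order.succ χ).ord) (hj : j < (Order.succ χ).ord)
    (h : ∀ k < (Order.succ χ).ord, a k ∈ C i ↔ a k ∈ C j) : i = j := by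
  rcases lt_trichotomy i j with hij | hij | hij
  · exact absurd ((h i hi).2 (F.chain.mono _ _ (Order.succ_le_of_lt hij) hj (F.mem i hi)))
      (F.not_mem H hi)
  · exact hij
  · exact absurd ((h j hj).1 (F.chain.mono _ _ (Order.succ_le_of_lt hij) hi (F.mem j hj)))
      (F.not_mem H hj)

theorem FreeSeq.a_injective (F : FreeSeq s lam χ C e a) (H : Ctx K s lam θ) {i j : Ordinal.{u}}
    (hi : i < (Order.succ χ).ord) (hj : j < (Order.succ χ).ord) (h : a i = a j) : i = j := by
  rcases lt_trichotomy i j with hij | hij | hij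
  · exact absurd (h ▸ F.chain.mono _ _ (Order.succ_le_of_lt hij) hj (F.mem i hi))
      (F.not_mem H hj)
  · exact hij
  · exact absurd (h ▸ F.chain.mono _ _ (Order.succ_le_of_lt hij) hi (F.mem j hj))
      (F.not_mem H hi)

theorem FreeSeq.succ_le_mk (F : FreeSeq s lam χ C e a) (H : Ctx K s lam θ) :
    Order.succ χ ≤ #X := by
  let f : (Order.succ χ).ord.ToType → X := fun t => a (Ordinal.ToType.mk.symm t).1
  have hf : Function.Injective f := fun t t' h => Ordinal.ToType.mk.symm.injective
    (Subtype.ext (F.a_injective H (Ordinal.ToType.mk.symm t).2 (Ordinal.ToType.mk.symm t').2 h))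
  simpa using Cardinal.mk_le_of_injective hf

/-- `f` embeds `X` in `M`, and the submodels of `M` of size at most `χ` that are closed under a
suitable operation meet `X` in a member `C i` of the free sequence, from which `a i` stays free. -/
def StaysFree (s : K.Frame) (lam χ : Cardinal.{u}) (C : Ordinal.{u} → L.Substructure X)
    (e : SEmb K A X) (a : Ordinal.{u} → X) (f : X → M) : Prop :=
  ∃ F : Finset M → Set M, (∀ t, #(F t) ≤ χ) ∧ ∀ (S : L.Substructure M) (hS : K.Strong S),
    Cl F S → #S ≤ χ → ∃ i < (Order.succ χ).ord, (∀ x, f x ∈ S ↔ x ∈ C i) ∧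
      ∀ e' : SEmb K A S, (∀ z, (e' z : M) = f (e z)) → Fr s lam e' ((SEmb.ofSub hS).tp (f (a i)))

/-- A free sequence stays free on its own model: small closed sets are members of the chain. -/
theorem FreeSeq.staysFree (F : FreeSeq s lam χ C e a) (hχ : ℵ₀ ≤ χ) :
    StaysFree s lam χ C e a (fun x => x) := by
  obtain ⟨G, hG, hcl⟩ := exists_club hχ (fun i => (C i : Set X)) (fun i => (C i : Set X))
    F.chain.mono F.chain.cont F.chain.top F.card_le F.chain.mono (fun _ _ => subset_rfl)
  refine ⟨G, hG, fun S hS hSG hSc => ?_⟩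
  obtain ⟨i, hi, h, -⟩ := hcl S hSG hSc
  refine ⟨i, hi, fun x => Set.ext_iff.1 h x, fun e' he' => ?_⟩
  exact (F.free i hi).of_le (SEmb.ofSub hS) (fun z => by
    rw [SEmb.range_ofSub]
    exact (Set.ext_iff.1 h z).1 z.2) e' fun z => he' z

/-- Invariance under isomorphisms. -/
theorem StaysFree.comp {f : X → M} (h : StaysFree s lam χ C e a f) (g : SEmb K M N)
    (hg : Function.Surjective g) : StaysFree s lam χ C e a (fun x => g (f x)) := by
  classical
  obtain ⟨F, hF, hcl⟩ := h
  refine ⟨fun t => g '' F (t.preimage g g.injective.injOn), fun t =>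
    Cardinal.mk_image_le.trans (hF _), fun S hS hSF hSc => ?_⟩
  have hS' := g.strong_comap hS fun y _ => hg y
  obtain ⟨i, hi, h1, h2⟩ := hcl (S.comap g.emb.toHom) hS'
    (fun t ht x hx => by
      refine hSF (t.map ⟨g, g.injective⟩) (fun y hy => ?_) ⟨x, ?_, rfl⟩
      · obtain ⟨z, hz, rfl⟩ := Finset.mem_map.1 hy
        exact ht hz
      · have : (t.map ⟨g, g.injective⟩).preimage g g.injective.injOn = t := by
          ext y
          simp only [Finset.mem_preimage, Finset.mem_map, Function.Embedding.coeFn_mk]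
          exact ⟨fun ⟨z, hz, h⟩ => g.injective h ▸ hz, fun h => ⟨y, h, rfl⟩⟩
        rwa [this])
    ((Cardinal.mk_le_of_injective (f := fun x : S.comap g.emb.toHom => (⟨g x, x.2⟩ : S))
      fun x y h => Subtype.ext (g.injective (congrArg Subtype.val h))).trans hSc)
  refine ⟨i, hi, h1, fun e' he' => ?_⟩
  obtain ⟨k, hk⟩ := SEmb.exists_factor (g.comp (SEmb.ofSub hS')) (SEmb.ofSub hS) (fun z => by
    obtain ⟨x, hx⟩ := hg z.1
    exact ⟨⟨x, show g x ∈ S from hx ▸ z.2⟩, hx⟩)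
  have hk' : ∀ z, g (k z) = z := fun z => DFunLike.congr_fun hk z
  have h3 := h2 (k.comp e') fun z => g.injective ((hk' _).trans (he' z))
  rw [← SEmb.tp_comp g] at h3
  exact h3.of_le (r := g.comp (SEmb.ofSub hS')) (SEmb.ofSub hS) (fun z => ⟨k z, hk' z⟩) e'
    fun z => (hk' _).symm

/-- The ordinals below `δ` are coded by elements of `α`. -/
theorem exists_surj_index {α : Type u} {δ : Ordinal.{u}} (h0 : 0 < δ) (hδ : δ.card ≤ #α) :
    ∃ (ι : α → Ordinal.{u}) (g : Ordinal.{u} → α), (∀ y, ι y < δ) ∧ ∀ i < δ, ι (g i) = i := by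
  classical
  have h1 : #δ.ToType ≤ #α := by simpa using hδ
  obtain ⟨f⟩ := h1
  have : Nonempty δ.ToType := ⟨Ordinal.ToType.mk ⟨0, h0⟩⟩
  have : Nonempty α := ⟨f (Classical.arbitrary _)⟩
  refine ⟨fun y => (Ordinal.ToType.mk.symm (Function.invFun f y)).1,
    fun i => if h : i < δ then f (Ordinal.ToType.mk ⟨i, h⟩) else Classical.arbitrary α,
    fun y => (Ordinal.ToType.mk.symm (Function.invFun f y)).2, fun i hi => ?_⟩
  simp only [dif_pos hi]
  rw [Function.leftInverse_invFun f.injective]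
  simp

/-- `StaysFree` is preserved by unions of chains. A small submodel `S` closed under a suitable
operation is the union of its traces on the members `T j` of the chain with `j` in a set of
indices without a last element. These traces are closed, and they all meet `X` in `X ∩ S`. -/
theorem StaysFree.union (F : FreeSeq s lam χ C e a) (H : Ctx K s lam θ) (hlam : lam ≤ χ)
    {δ : Ordinal.{u}} (hδ : Order.IsSuccLimit δ) (hδM : δ.card ≤ #M)
    (T : Ordinal.{u} → L.Substructure M) (hT : ∀ i < δ, K.Strong (T i))
    (hm : ∀ i j, i ≤ j → j < δ → T i ≤ T j) (ht : ∀ x, ∃ i < δ, x ∈ T i) (f : X → M)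
    (hf : ∀ i < δ, ∀ x, f x ∈ T i)
    (h : ∀ i (hi : i < δ), StaysFree s lam χ C e a (fun x => (⟨f x, hf i hi x⟩ : T i))) :
    StaysFree s lam χ C e a f := by
  classical
  have hχ : ℵ₀ ≤ χ := H.aleph0_le.trans hlam
  have hM : K.Mem M := (K.mem_of_strong _ (hT 0 hδ.bot_lt)).2
  obtain ⟨G, hG, hsk⟩ := exists_skolem_chain hM δ T hT hm
  obtain ⟨ι, g, hι, hg⟩ := exists_surj_index hδ.bot_lt hδM
  choose F' hF' hcl using h
  choose r hr hrT using ht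
  -- Indices are coded by elements of `M`. A set closed under `E` is closed under successors of
  -- coded indices and under the rank `r`, and its trace on `T (ι y)`, for each of its elements `y`, is
  -- closed under the operation belonging to `T (ι y)`.
  let Q : M → Finset M → Set M := fun y t =>
    Subtype.val '' F' (ι y) (hι y) (t.subtype (· ∈ T (ι y)))
  let E : Finset M → Set M := fun t => {g 0} ∪ ⋃ y : t, ({g (Order.succ (ι y))} ∪ {g (r y)} ∪
    ⋃ t' : t.powerset, Q y t')
  have hone : ∀ y : M, #({y} : Set M) ≤ χ := fun y => by
    rw [Cardinal.mk_singleton]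
    exact Cardinal.one_le_aleph0.trans hχ
  have hfin : ∀ t : Finset M, #t ≤ χ := fun t => (Cardinal.lt_aleph0_of_finite _).le.trans hχ
  refine ⟨fun t => G t ∪ E t, fun t => mk_union_le_of_le hχ ((hG t).trans (H.LS_le.trans hlam))
    (mk_union_le_of_le hχ (hone _) (mk_iUnion_le_of_le hχ _ (hfin _) fun y =>
      mk_union_le_of_le hχ (mk_union_le_of_le hχ (hone _) (hone _))
        (mk_iUnion_le_of_le hχ _ ((Cardinal.lt_aleph0_of_finite _).le.trans hχ) fun t' =>
          Cardinal.mk_image_le.trans (hF' _ _ _)))), fun S hS hSF hSc => ?_⟩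
  have hE : ∀ t : Finset M, (t : Set M) ⊆ S → E t ⊆ S := fun t hts =>
    Set.subset_union_right.trans (hSF t hts)
  have hg0 : g 0 ∈ S := hE ∅ (by simp) (Or.inl rfl)
  have hE1 : ∀ y ∈ S, ∀ t : Finset M, (t : Set M) ⊆ S →
      g (Order.succ (ι y)) ∈ S ∧ g (r y) ∈ S ∧ Q y t ⊆ S := by
    intro y hy t ht
    have hyt : ((insert y t : Finset M) : Set M) ⊆ S := by
      rw [Finset.coe_insert, Set.insert_subset_iff]
      exact ⟨hy, ht⟩
    have h1 := Set.subset_union_right.trans (hE _ hyt)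
    have h2 := (Set.subset_iUnion (fun z : (insert y t : Finset M) =>
      ({g (Order.succ (ι z))} ∪ {g (r z)} ∪ ⋃ t' : (insert y t : Finset M).powerset, Q z t'))
      ⟨y, Finset.mem_insert_self _ _⟩).trans h1
    refine ⟨h2 (Or.inl (Or.inl rfl)), h2 (Or.inl (Or.inr rfl)), ?_⟩
    refine Set.Subset.trans ?_ (Set.subset_union_right.trans h2)
    exact Set.subset_iUnion (fun t' : (insert y t : Finset M).powerset => Q y t')
      ⟨t, Finset.mem_powerset.2 (Finset.subset_insert _ _)⟩
  have hE2 : ∀ y ∈ S, ∃ z ∈ S, ι z = Order.succ (ι y) := fun y hy =>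
    ⟨_, (hE1 y hy ∅ (by simp)).1, hg _ (hδ.succ_lt (hι y))⟩
  have hE3 : ∀ y ∈ S, ∃ z ∈ S, y ∈ T (ι z) := fun y hy =>
    ⟨_, (hE1 y hy ∅ (by simp)).2.1, by rw [hg _ (hr y)]; exact hrT y⟩
  have hST : ∀ i < δ, K.Strong (S ⊓ T i) := fun i hi => by
    obtain ⟨S', h1, -, h2⟩ := hsk S (Cl.mono (fun _ => Set.subset_union_left) hSF)
    rw [← SetLike.coe_injective h1]
    exact h2 i hi
  have hST' : ∀ i (hi : i < δ), K.Strong (S.comap (T i).subtype.toHom) := fun i hi => by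
    have h1 := (SEmb.ofSub (hT i hi)).strong_comap (hST i hi) (by
      rw [SEmb.range_ofSub]
      exact inf_le_right)
    convert h1 using 1
    ext x
    exact ⟨fun hx => ⟨hx, x.2⟩, fun hx => hx.1⟩
  have hloc : ∀ y ∈ S, ∃ i < (Order.succ χ).ord, (∀ x, f x ∈ S ↔ x ∈ C i) ∧
      ∀ e' : SEmb K A (S.comap (T (ι y)).subtype.toHom),
        (∀ z, ((e' z : T (ι y)) : M) = f (e z)) →
        Fr s lam e' (((SEmb.ofSub (hT _ (hι y))).comp (SEmb.ofSub (hST' _ (hι y)))).tp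
          (f (a i))) := by
    intro y hy
    obtain ⟨i, hi, h1, h2⟩ := hcl (ι y) (hι y) _ (hST' _ (hι y))
      (fun t ht x hx => by
        refine (hE1 y hy (t.map ⟨Subtype.val, Subtype.val_injective⟩) ?_).2.2 ⟨x, ?_, rfl⟩
        · intro z hz
          obtain ⟨w, hw, rfl⟩ := Finset.mem_map.1 (Finset.mem_coe.1 hz)
          exact ht (Finset.mem_coe.2 hw)
        · have : (t.map ⟨Subtype.val, Subtype.val_injective⟩).subtype (· ∈ T (ι y)) = t := by
            ext z
            simp
          rwa [this])
      ((Cardinal.mk_le_of_injective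
        (f := fun x : S.comap (T (ι y)).subtype.toHom => (⟨x.1.1, x.2⟩ : S))
        fun x y h => Subtype.ext (Subtype.ext (congrArg (fun z : S => (z : M)) h))).trans hSc)
    refine ⟨i, hi, h1, fun e' he' => ?_⟩
    have h3 := h2 e' fun z => Subtype.ext (he' z)
    rw [← SEmb.tp_comp (SEmb.ofSub (hT _ (hι y)))] at h3
    exact h3
  -- the index obtained from one trace is the index for all of them, as they have the same elements
  -- of `X`
  obtain ⟨i, hi, hi1, -⟩ := hloc _ hg0
  refine ⟨i, hi, hi1, fun e' he' => ?_⟩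
  -- the indices coded in `S` have no last element, and `S` is the union of its traces below `δ'`
  let δ' : Ordinal.{u} := ⨆ y : S, Order.succ (ι y)
  have hlt : ∀ {j}, j < δ' ↔ ∃ y ∈ S, j ≤ ι y := by
    intro j
    rw [Ordinal.lt_iSup_iff]
    exact ⟨fun ⟨y, hy⟩ => ⟨y, y.2, Order.lt_succ_iff.1 hy⟩,
      fun ⟨y, hy, h⟩ => ⟨⟨y, hy⟩, Order.lt_succ_iff.2 h⟩⟩
  have hδδ' : ∀ {j}, j < δ' → j < δ := fun hj => by
    obtain ⟨y, -, h⟩ := hlt.1 hj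
    exact h.trans_lt (hι y)
  have hδ' : Order.IsSuccLimit δ' := by
    rw [Ordinal.isSuccLimit_iff, Order.isSuccPrelimit_iff_succ_lt]
    refine ⟨(hlt.2 ⟨_, hg0, zero_le⟩).ne_bot, fun j hj => ?_⟩
    obtain ⟨y, hy, h⟩ := hlt.1 hj
    obtain ⟨z, hz, h'⟩ := hE2 y hy
    exact hlt.2 ⟨z, hz, h' ▸ Order.succ_le_succ h⟩
  refine Fr.of_cover H hδ' (B := fun j => (S ⊓ T j : L.Substructure M))
    (fun j hj => SEmb.incl inf_le_left (hST j (hδδ' hj)) hS)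
    (fun j k hjk hk x => ⟨⟨x, x.2.1, hm j k hjk (hδδ' hk) x.2.2⟩, rfl⟩)
    (fun x => by
      obtain ⟨z, hz, hx⟩ := hE3 x x.2
      exact ⟨ι z, hlt.2 ⟨z, hz, le_rfl⟩, ⟨x, x.2, hx⟩, rfl⟩)
    (fun z => ⟨⟨e' z, (e' z).2, by rw [he']; exact hf 0 hδ.bot_lt _⟩, rfl⟩) fun j hj e'' he'' => ?_
  obtain ⟨y, hy, hjy⟩ := hlt.1 hj
  obtain ⟨i', hi', h1, h2⟩ := hloc y hy
  obtain rfl : i = i' := F.injective H hi hi' fun k _ => by rw [← hi1, ← h1]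
  have hfz : ∀ z, f (e z) ∈ S := fun z => by rw [← he']; exact (e' z).2
  let r' := (SEmb.ofSub (hT _ (hι y))).comp (SEmb.ofSub (hST' _ (hι y)))
  obtain ⟨k, hk⟩ := SEmb.exists_factor r' ((SEmb.ofSub hS).comp e') fun z => by
    refine ⟨⟨⟨f (e z), hf _ (hι y) _⟩, hfz z⟩, (he' z).symm⟩
  have hk' : ∀ z, r' (k z) = e' z := fun z => DFunLike.congr_fun hk z
  have h3 := h2 k fun z => (hk' z).trans (he' z)
  exact h3.of_le ((SEmb.ofSub hS).comp (SEmb.incl inf_le_left (hST j (hδδ' hj)) hS))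
    (fun z => ⟨⟨⟨z, hm _ _ hjy (hι y) z.2.2⟩, z.2.1⟩, rfl⟩) e'' fun z => by
      refine Eq.trans ?_ (hk' z).symm
      exact congrArg (fun w : S => (w : M)) (DFunLike.congr_fun he'' z)

end

end Ctx

namespace Ctx

variable {s : K.Frame} {lam : Cardinal.{u}} {θ : WithTop Cardinal.{u}}

section

variable {A B D M N R S X : Type u} [L.Structure A] [L.Structure B] [L.Structure D] [L.Structure M]
  [L.Structure N] [L.Structure R] [L.Structure S] [L.Structure X]
  {χ : Cardinal.{u}} {C : Ordinal.{u} → L.Substructure X} {e : SEmb K A X}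
  {a : Ordinal.{u} → X}

open Classical in
/-- A free type over a model on which the sequence stays free is realized in an extension with
the same property. A filtration of the model by sets closed under the operation that witnesses
`StaysFree` carries a free sequence formed by some of the `a i`, and `FreeSeq.exists_push` extends
its members to models `R j`. By `exists_club`, small submodels of the extension closed under a
suitable operation are of the form `R j`. -/
theorem StaysFree.exists_extension (F : FreeSeq s lam χ C e a) (H : Ctx K s lam θ)
    (hχ : ((Order.succ χ : Cardinal.{u}) : WithTop Cardinal.{u}) < θ) (hlam : lam ≤ χ)
    (hS : SymAt K s lam χ) (f : SEmb K X M) (hf : StaysFree s lam χ C e a f)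
    (hM : #M ≤ Order.succ χ) (ι : SEmb K M N) (c : N) (d : SEmb K D M)
    (hc : Fr s lam d (ι.tp c)) :
    ∃ (R : Type u) (_ : L.Structure R) (g : SEmb K M R) (c' : R), #R ≤ Order.succ χ ∧
      g.tp c' = ι.tp c ∧ StaysFree s lam χ C e a (fun x => g (f x)) := by
  have hinf : ℵ₀ ≤ χ := H.aleph0_le.trans hlam
  obtain ⟨G, hG, hcl⟩ := hf
  have hMc : #M = Order.succ χ := le_antisymm hM ((F.succ_le_mk H).trans f.mk_le)
  -- `good i Y` says that `Y` meets `X` in `C i`, and that `a i` is free from `Y`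
  let good : Ordinal.{u} → Set M → Prop := fun i Y => i < (Order.succ χ).ord ∧
    ∀ (S : L.Substructure M) (hS : K.Strong S), (S : Set M) = Y →
      (∀ x, f x ∈ S ↔ x ∈ C i) ∧ ∀ e' : SEmb K A S, (∀ z, (e' z : M) = f (e z)) →
        Fr s lam e' ((SEmb.ofSub hS).tp (f (a i)))
  let I : Set M → Ordinal.{u} := fun Y => if h : ∃ i, good i Y then h.choose else 0
  have hI : ∀ Y, (∃ i, good i Y) → good (I Y) Y := fun Y h => by
    simp only [I, dif_pos h]
    exact h.choose_spec
  -- the witnesses put `a (I (C' i))` into `C' (i + 1)`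
  obtain ⟨C', hC', hGC, hCs, hD, hCc, hCl, hw, -⟩ := exists_filtration f.mem_right
    (H.LS_le.trans hlam) (hMc ▸ Order.lt_succ χ) G hG (Set.range d ∪ Set.range (f.comp e))
    (mk_union_le_of_le hinf (Cardinal.mk_range_le.trans (hc.1.le.trans hlam))
      (Cardinal.mk_range_le.trans ((F.free 0 F.chain.lim.bot_lt).1.le.trans hlam)))
    (fun Y => {f (a (I Y))}) (fun c hc Y _ => by
      rw [Cardinal.mk_singleton]
      exact Cardinal.one_le_aleph0.trans (hinf.trans hc))
  rw [hMc] at hC' hCc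
  have hgood : ∀ i < (Order.succ χ).ord, good (I (C' i)) (C' i) := fun i hi => by
    apply hI
    obtain ⟨j, hj, h1, h2⟩ := hcl (C' i) (hCs i) (hGC i) (Order.lt_succ_iff.1 (hCc i hi))
    refine ⟨j, hj, fun S hS hSC => ?_⟩
    obtain rfl := SetLike.coe_injective hSC
    exact ⟨h1, h2⟩
  have hbase : ∀ i z, f.comp e z ∈ C' i := fun i z => hD i (Or.inr ⟨z, rfl⟩)
  have F' : FreeSeq s lam χ C' (f.comp e) (fun i => f (a (I (C' i)))) :=
    { chain := hC'
      strong := hCs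
      card_le := fun i hi => Order.lt_succ_iff.1 (hCc i hi)
      le_card := fun i _ => hCl i
      base := hbase
      mem := fun i _ => hw i _ (Order.lt_succ i) rfl
      free := fun i hi => ((hgood i hi).2 (C' i) (hCs i) rfl).2 _ fun z => rfl }
  obtain ⟨R, _, g, sub, c', hg, ⟨Lm⟩⟩ := F'.exists_push H hχ hlam hS hM ι c d
    (fun i z => hD i (Or.inl ⟨z, rfl⟩)) hc
  refine ⟨R, inferInstance, g, c', Lm.mk_le (hinf.trans (Order.le_succ χ))
    (fun j hj => (Lm.size j hj).trans (Order.le_succ χ)) (by simp), hg, ?_⟩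
  have hemb : ∀ j (hj : j < (Order.succ χ).ord), ∀ x ∈ C' j, ∃ y, Lm.r j hj y = g x := by
    intro j hj x hx
    have hx' : x ∈ C' (Lm.ob j).idx := (Lm.idx j hj).symm ▸ hx
    exact ⟨(Lm.ob j).emb ⟨x, hx'⟩, Lm.r_emb j hj ⟨x, hx'⟩ x rfl⟩
  -- `V j` is the model `R j`; for the `j` given by `exists_club`, its trace on `M` is `C' j`
  let V : Ordinal.{u} → Set R := fun j => if hj : j < (Order.succ χ).ord then
    Set.range (Lm.r j hj) else ∅
  have hV : ∀ j (hj : j < (Order.succ χ).ord), V j = Set.range (Lm.r j hj) := fun j hj =>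
    dif_pos hj
  obtain ⟨E, hE, hEcl⟩ := exists_club hinf V (fun j => g '' C' j)
    (fun i j hij hj => by
      rw [hV i (hij.trans_lt hj), hV j hj]
      rintro _ ⟨x, rfl⟩
      exact ⟨_, Lm.r_map i j hij hj x⟩)
    (fun i hi hl x hx => by
      rw [hV i hi] at hx
      obtain ⟨x, rfl⟩ := hx
      obtain ⟨j, hj, y, hy⟩ := Lm.cont i hi hl x
      exact ⟨j, hj, by rw [hV j (hj.trans hi)]; exact ⟨y, hy⟩⟩)
    (fun x => by
      obtain ⟨j, hj, y, hy⟩ := Lm.cover x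
      exact ⟨j, hj, by rw [hV j hj]; exact ⟨y, hy⟩⟩)
    (fun i hi => by
      rw [hV i hi]
      exact Cardinal.mk_range_le.trans (Lm.size i hi))
    (fun i j hij hj => Set.image_mono (hC'.mono i j hij hj))
    (fun i hi => by
      rw [hV i hi]
      rintro _ ⟨x, hx, rfl⟩
      exact hemb i hi x hx)
  refine ⟨E, hE, fun S hS hSE hSc => ?_⟩
  obtain ⟨j, hj, h1, h2⟩ := hEcl S hSE hSc
  rw [hV j hj] at h1
  obtain ⟨h3, h4⟩ := (hgood j hj).2 (C' j) (hCs j) rfl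
  refine ⟨I (C' j), (hgood j hj).1, fun x => ?_, fun e' he' => ?_⟩
  · rw [← h3]
    constructor
    · intro hx
      obtain ⟨i, hi, hxi⟩ := hC'.top (f x)
      obtain ⟨y, hy, hxy⟩ := (h2 (g (f x))).1 ⟨hx, i, hi, f x, hxi, rfl⟩
      exact g.injective hxy ▸ hy
    · intro hx
      exact ((h2 (g (f x))).2 ⟨f x, hx, rfl⟩).1
  · have hj' : Order.succ j < (Order.succ χ).ord := F.chain.lim.succ_lt hj
    obtain ⟨x, hx, hfr⟩ := Lm.ext j _ (Order.lt_succ j) hj'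
    rw [← SEmb.tp_comp (Lm.r _ hj'), Lm.r_emb _ hj' x _ hx] at hfr
    have hcomp : (Lm.r _ hj').comp (Lm.map j _ (Order.lt_succ j).le hj') = Lm.r j hj :=
      SEmb.ext fun x => Lm.r_map j _ (Order.lt_succ j).le hj' x
    rw [hcomp] at hfr
    have hidx := Lm.idx j hj
    have hfin := hfr.of_le (SEmb.ofSub hS) (fun z => (Set.ext_iff.1 h1 z).1 z.2) e' fun z =>
      (he' z).trans (Lm.r_emb j hj _ (f (e z)) rfl).symm
    rw [hidx] at hfin
    exact hfin

open Classical in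
/-- Two increasing sequences of length `κ⁺`, the first one continuous, of sets of size at most `κ`:
at some stage the first does not meet the later members of the second any more. -/
theorem exists_stable_index {α : Type u} {κ : Cardinal.{u}} (hκ : ℵ₀ ≤ κ)
    (V U : Ordinal.{u} → Set α)
    (hm : ∀ i j, i ≤ j → j < (Order.succ κ).ord → V i ⊆ V j)
    (hc : ∀ i < (Order.succ κ).ord, Order.IsSuccLimit i → ∀ x ∈ V i, ∃ j < i, x ∈ V j)
    (ht : ∀ x, ∃ i < (Order.succ κ).ord, x ∈ V i)
    (hcard : ∀ i < (Order.succ κ).ord, #(V i) ≤ κ)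
    (hUm : ∀ i j, i ≤ j → j < (Order.succ κ).ord → U i ⊆ U j) :
    ∃ i < (Order.succ κ).ord, ∀ x ∈ V i, (∃ j < (Order.succ κ).ord, x ∈ U j) → x ∈ U i := by
  obtain ⟨F, hF, hcl⟩ := exists_club hκ V (fun i => V i ∩ U i) hm hc ht hcard
    (fun i j hij hj => Set.inter_subset_inter (hm i j hij hj) (hUm i j hij hj))
    (fun _ _ => Set.inter_subset_left)
  obtain ⟨i, hi, h1, h2⟩ := hcl (hull F ∅) (cl_hull F ∅) (mk_hull_le hκ hF (by simp))
  refine ⟨i, hi, fun x hx ⟨j, hj, hxj⟩ => ?_⟩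
  exact ((h2 x).1 ⟨h1 ▸ hx, max i j, max_lt hi hj, hm _ _ (le_max_left _ _) (max_lt hi hj) hx,
    hUm _ _ (le_max_right _ _) (max_lt hi hj) hxj⟩).2

/-- Every extension `R` of `X` of size `χ⁺` has an extension of size `χ⁺` on which the free sequence
stays free. Otherwise there is a continuous system of length `χ⁺⁺` of extensions of `R`, with
submodels on which the sequence stays free, in which every submodel acquires at the next stage an
element that it omitted. This is impossible, as models have size `χ⁺`. -/
theorem FreeSeq.exists_staysFree_extension (F : FreeSeq s lam χ C e a) (H : Ctx K s lam θ)
    (hχ : ((Order.succ χ : Cardinal.{u}) : WithTop Cardinal.{u}) < θ) (hlam : lam ≤ χ)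
    (hS : SymAt K s lam χ) (x : SEmb K X R) (hR : #R ≤ Order.succ χ) :
    ∃ (N : Type u) (_ : L.Structure N) (k : SEmb K R N), #N ≤ Order.succ χ ∧
      StaysFree s lam χ C e a (fun y => k (x y)) := by
  classical
  by_contra! hno
  have hinf : ℵ₀ ≤ χ := H.aleph0_le.trans hlam
  have hinf' : ℵ₀ ≤ Order.succ χ := hinf.trans (Order.le_succ χ)
  have hXm := x.mem_left
  have hXc := F.succ_le_mk H
  -- the extensions are over the constant chain `X`
  let Ct : Ordinal.{u} → L.Substructure X := fun _ => ⊤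
  have hlim : Order.IsSuccLimit (Order.succ (Order.succ χ)).ord :=
    Cardinal.isSuccLimit_ord (hinf'.trans (Order.le_succ _))
  have hCt : Chain K (Order.succ (Order.succ χ)).ord Ct :=
    ⟨hlim, fun _ _ => K.strong_top hXm, fun _ _ _ _ => le_rfl,
      fun i _ hl _ _ => ⟨0, hl.bot_lt, trivial⟩, fun _ => ⟨0, hlim.bot_lt, trivial⟩⟩
  -- `o` is an extension of `R` over `X`, and the sequence stays free on `o.sub`
  let P : ChainExt K Ct → Prop := fun o => K.Strong o.sub ∧
    (∃ hm : ∀ y : X, o.emb ⟨y, trivial⟩ ∈ o.sub,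
      StaysFree s lam χ C e a (fun y => (⟨o.emb ⟨y, trivial⟩, hm y⟩ : o.sub))) ∧
    ∃ k : SEmb K R o.carrier, ∀ y, k (x y) = o.emb ⟨y, trivial⟩
  obtain ⟨W, _, f, sub, pt, ⟨Lm⟩⟩ := exists_chain_tower (κ := Order.succ χ) hinf' P
    (fun o o' g => ∃ c, c ∉ o.sub ∧ g c ∈ o'.sub) hCt
    (fun i hi => Order.lt_succ_iff.1 (Cardinal.lt_ord.1 hi)) (fun _ => K.strong_top hXm)
    (fun o o' o'' f g _ hg ⟨c, hc, hc'⟩ => ⟨c, hc, hg.sub _ hc'⟩)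
    (fun o o' o'' f g hfs _ hf _ ⟨c, hc, hc'⟩ => by
      obtain ⟨c, rfl⟩ := hfs c
      exact ⟨c, fun h => hc (hf.sub _ h), hc'⟩)
    (by
      refine ⟨⟨0, R, x.comp (SEmb.ofSub (K.strong_top hXm)), x.range, x (a 0)⟩, rfl, hR,
        x.strong_range, ⟨fun y => ⟨y, rfl⟩, ?_⟩, SEmb.refl x.mem_right, fun y => rfl⟩
      exact (F.staysFree hinf).comp (x.lift x.strong_range fun y => ⟨y, rfl⟩)
        fun ⟨z, y, hy⟩ => ⟨y, Subtype.ext hy⟩)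
    (fun o _ hoc ⟨hs, ⟨hm, hfree⟩, k, hk⟩ => by
      -- `o.sub` is not all of `o`, so that a point `c` outside realizes a free type over it. A copy
      -- of `c` is adjoined by `StaysFree.exists_extension` and identified with `c` in an amalgam.
      have hns : ¬ Function.Surjective (SEmb.ofSub hs) := fun hsur => by
        refine hno _ inferInstance k hoc ?_
        convert hfree.comp (SEmb.ofSub hs) hsur using 2 with y
        exact hk y
      let f₀ : SEmb K X o.sub := (k.comp x).lift hs fun y => by
        change k (x y) ∈ o.sub
        rw [hk]
        exact hm y
      have hf₀ : StaysFree s lam χ C e a f₀ := by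
        convert hfree using 2 with y
        exact Subtype.ext (hk y)
      have hXo : lam ≤ #o.sub := hlam.trans ((Order.le_succ χ).trans (hXc.trans f₀.mk_le))
      obtain ⟨c, D, _, d, hd⟩ := H.exists_fr_of_not_surjective (SEmb.ofSub hs) hXo hns
      obtain ⟨V, _, g, c', hV, hc', hfr⟩ := StaysFree.exists_extension F H hχ hlam hS f₀ hf₀
        ((Cardinal.mk_set_le _).trans hoc) (SEmb.ofSub hs) c d hd
      obtain ⟨W, _, h, h', hW, h1, h2⟩ := H.amalg_of_tp_eq hχ (SEmb.ofSub hs) g hXo hoc hV hc'.symm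
      have hcomm : ∀ y : X, h (o.emb ⟨y, trivial⟩) = h' (g (f₀ y)) := fun y => by
        rw [← hk, ← h1]
        rfl
      refine ⟨⟨Order.succ o.idx, W, h.comp o.emb, h'.range, h o.pt⟩, h, rfl, hW,
        ⟨h'.strong_range, ⟨fun y => ⟨g (f₀ y), (hcomm y).symm⟩, ?_⟩, h.comp k, fun y =>
          congrArg h (hk y)⟩, ⟨le_rfl, fun y y' hy => ?_, fun y hy => ?_, rfl⟩, c, ?_, ?_⟩
      · convert hfr.comp (h'.lift h'.strong_range fun y => ⟨y, rfl⟩)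
          (fun ⟨z, y, hy⟩ => ⟨y, Subtype.ext hy⟩) using 2 with y
        exact Subtype.ext (hcomm y)
      · have : y = y' := Subtype.ext hy
        subst this
        rfl
      · exact ⟨g ⟨y, hy⟩, (h1 ⟨y, hy⟩).symm⟩
      · have := Fr.not_mem H hd
        rwa [SEmb.range_ofSub] at this
      · exact ⟨c', h2.symm⟩)
    (fun o hi hl hoc Lm => by
      have hjm := fun j (hj : j < o.idx) => (Lm.good j hj).1
      let c₀ : ∀ j, j < o.idx → SEmb K (Lm.ob j).sub o.carrier := fun j hj =>
        (Lm.r j hj).comp (SEmb.ofSub (hjm j hj))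
      have hc₀ : ∀ j k (hjk : j ≤ k) (hk : k < o.idx) y,
          c₀ j (hjk.trans_lt hk) y ∈ (c₀ k hk).range := fun j k hjk hk y =>
        ⟨⟨Lm.map j k hjk hk y, (Lm.compat j k hjk hk).sub _ y.2⟩, Lm.r_map j k hjk hk y⟩
      have hs : K.Strong o.sub := Lm.strong_sub hl hjm
      have hemb : ∀ j (hj : j < o.idx) (y : X),
          Lm.r j hj ((Lm.ob j).emb ⟨y, trivial⟩) = o.emb ⟨y, trivial⟩ := fun j hj y =>
        Lm.r_emb j hj _ _ rfl
      have hm : ∀ y : X, o.emb ⟨y, trivial⟩ ∈ o.sub := fun y => by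
        rw [← hemb 0 hl.bot_lt]
        exact Lm.r_sub _ _ _ ((Lm.good 0 hl.bot_lt).2.1.choose y)
      let c : ∀ j, j < o.idx → SEmb K (Lm.ob j).sub o.sub := fun j hj =>
        (c₀ j hj).lift hs fun y => Lm.r_sub j hj y y.2
      have hf' : ∀ j (hj : j < o.idx) (y : X), (⟨o.emb ⟨y, trivial⟩, hm y⟩ : o.sub) ∈
          (c j hj).range := fun j hj y =>
        ⟨⟨_, (Lm.good j hj).2.1.choose y⟩, Subtype.ext (hemb j hj y)⟩
      refine ⟨hs, ⟨hm, ?_⟩, ?_⟩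
      · refine StaysFree.union F H hlam hl ?_ (coverChain c) (fun i hi => ?_) (fun i j hij hj => ?_)
          (fun z => ?_) _ (fun i hi y => by rw [coverChain_eq c hi]; exact hf' i hi y)
          fun i hi => ?_
        · refine (Order.lt_succ_iff.1 (Cardinal.lt_ord.1 hi)).trans (hXc.trans ?_)
          exact Cardinal.mk_le_of_injective (f := fun y : X => (⟨o.emb ⟨y, trivial⟩, hm y⟩ : o.sub))
            fun y y' h => congrArg Subtype.val (o.emb.injective (congrArg Subtype.val h))
        · rw [coverChain_eq c hi]
          exact (c i hi).strong_range
        · rw [coverChain_eq c (hij.trans_lt hj), coverChain_eq c hj]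
          rintro _ ⟨y, rfl⟩
          obtain ⟨z, hz⟩ := hc₀ i j hij hj y
          exact ⟨z, Subtype.ext hz⟩
        · obtain ⟨j, hj, y, hy, h⟩ := Lm.sub_cover z z.2
          exact ⟨j, hj, by rw [coverChain_eq c hj]; exact ⟨⟨y, hy⟩, Subtype.ext h⟩⟩
        · have key : ∀ (T : L.Substructure o.sub) (hT : T = (c i hi).range)
              (h : ∀ y : X, (⟨o.emb ⟨y, trivial⟩, hm y⟩ : o.sub) ∈ T),
              StaysFree s lam χ C e a
                (fun y => (⟨⟨o.emb ⟨y, trivial⟩, hm y⟩, h y⟩ : T)) := by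
            rintro _ rfl h
            obtain ⟨-, ⟨hm', hfree⟩, -⟩ := Lm.good i hi
            convert hfree.comp ((c i hi).lift (c i hi).strong_range fun y => ⟨y, rfl⟩)
              (fun ⟨z, y, hy⟩ => ⟨y, Subtype.ext hy⟩) using 2 with y
            exact Subtype.ext (Subtype.ext (hemb i hi y).symm)
          exact key _ (coverChain_eq c hi) _
      · obtain ⟨-, -, k, hk⟩ := Lm.good 0 hl.bot_lt
        exact ⟨(Lm.r 0 hl.bot_lt).comp k, fun y => by
          rw [SEmb.comp_apply, hk, hemb]⟩)
  let V : Ordinal.{u} → Set W := fun j => if hj : j < (Order.succ (Order.succ χ)).ord then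
    Set.range (Lm.r j hj) else ∅
  let U : Ordinal.{u} → Set W := fun j => if hj : j < (Order.succ (Order.succ χ)).ord then
    Lm.r j hj '' (Lm.ob j).sub else ∅
  have hV : ∀ j (hj : j < (Order.succ (Order.succ χ)).ord), V j = Set.range (Lm.r j hj) :=
    fun j hj => dif_pos hj
  have hU : ∀ j (hj : j < (Order.succ (Order.succ χ)).ord), U j = Lm.r j hj '' (Lm.ob j).sub :=
    fun j hj => dif_pos hj
  obtain ⟨i, hi, h⟩ := exists_stable_index hinf' V U
    (fun i j hij hj => by
      rw [hV i (hij.trans_lt hj), hV j hj]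
      rintro _ ⟨x, rfl⟩
      exact ⟨_, Lm.r_map i j hij hj x⟩)
    (fun i hi hl x hx => by
      rw [hV i hi] at hx
      obtain ⟨x, rfl⟩ := hx
      obtain ⟨j, hj, y, hy⟩ := Lm.cont i hi hl x
      exact ⟨j, hj, by rw [hV j (hj.trans hi)]; exact ⟨y, hy⟩⟩)
    (fun x => by
      obtain ⟨j, hj, y, hy⟩ := Lm.cover x
      exact ⟨j, hj, by rw [hV j hj]; exact ⟨y, hy⟩⟩)
    (fun i hi => by
      rw [hV i hi]
      exact Cardinal.mk_range_le.trans (Lm.size i hi))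
    (fun i j hij hj => by
      rw [hU i (hij.trans_lt hj), hU j hj]
      rintro _ ⟨x, hx, rfl⟩
      exact ⟨_, (Lm.compat i j hij hj).sub x hx, Lm.r_map i j hij hj x⟩)
  -- the element added to the submodel at stage `i + 1` would be in the submodel of stage `i`
  have hi' := hlim.succ_lt hi
  obtain ⟨c, hc, hc'⟩ := Lm.ext i _ (Order.lt_succ i) hi'
  have h1 := h (Lm.r i hi c) (by rw [hV i hi]; exact ⟨c, rfl⟩)
    ⟨_, hi', by rw [hU _ hi']; exact ⟨_, hc', Lm.r_map i _ (Order.le_succ i) hi' c⟩⟩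
  rw [hU i hi] at h1
  obtain ⟨c₁, hc₁, h2⟩ := h1
  exact hc ((Lm.r i hi).injective h2 ▸ hc₁)

open Classical in
/-- If `X = ⋃ C i`, carrying a free sequence `a`, is contained in `R = ⋃ T i`, where the `T i` form
another chain of models of size at most `χ`, then some `a i` is free from `T i`. -/
theorem FreeSeq.exists_free (F : FreeSeq s lam χ C e a) (H : Ctx K s lam θ)
    (hχ : ((Order.succ χ : Cardinal.{u}) : WithTop Cardinal.{u}) < θ) (hlam : lam ≤ χ)
    (hS : SymAt K s lam χ) (x : SEmb K X R) (hR : #R ≤ Order.succ χ)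
    {T : Ordinal.{u} → L.Substructure R} (hT : Chain K (Order.succ χ).ord T)
    (hTc : ∀ i < (Order.succ χ).ord, #(T i) ≤ χ) :
    ∃ i, ∃ hi : i < (Order.succ χ).ord, ∀ e' : SEmb K A (T i), (∀ z, (e' z : R) = x (e z)) →
      Fr s lam e' ((SEmb.ofSub (hT.strong i hi)).tp (x (a i))) := by
  have hinf : ℵ₀ ≤ χ := H.aleph0_le.trans hlam
  obtain ⟨N, _, k, hN, G, hG, hcl⟩ := F.exists_staysFree_extension H hχ hlam hS x hR
  obtain ⟨G', hG', hsk⟩ := exists_skolem k.mem_right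
  -- closing under `a j ↦ T (j + 1)` gives sets `S` with `T i ⊆ S` whenever `C i ⊆ S`
  let Q : N → Set N := fun y => if h : ∃ j, j < (Order.succ χ).ord ∧ k (x (a j)) = y then
    k '' (T (Order.succ h.choose)) else ∅
  have hQ : ∀ j < (Order.succ χ).ord, Q (k (x (a j))) = k '' (T (Order.succ j)) := fun j hj => by
    have h : ∃ j', j' < (Order.succ χ).ord ∧ k (x (a j')) = k (x (a j)) := ⟨j, hj, rfl⟩
    simp only [Q, dif_pos h]
    rw [F.a_injective H h.choose_spec.1 hj (x.injective (k.injective h.choose_spec.2))]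
  have hQc : ∀ y, #(Q y) ≤ χ := fun y => by
    by_cases h : ∃ j, j < (Order.succ χ).ord ∧ k (x (a j)) = y
    · obtain ⟨j, hj, rfl⟩ := h
      rw [hQ j hj]
      exact Cardinal.mk_image_le.trans (hTc _ (F.chain.lim.succ_lt hj))
    · simp only [Q, dif_neg h]
      simp
  let E : Finset N → Set N := fun t => (G t ∪ G' t) ∪ (k '' (T 0) ∪ ⋃ y : t, Q y)
  have hE : ∀ t, #(E t) ≤ χ := fun t => mk_union_le_of_le hinf
    (mk_union_le_of_le hinf (hG t) ((hG' t).trans (H.LS_le.trans hlam)))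
    (mk_union_le_of_le hinf (Cardinal.mk_image_le.trans (hTc 0 F.chain.lim.bot_lt))
      (mk_iUnion_le_of_le hinf _ ((Cardinal.lt_aleph0_of_finite _).le.trans hinf)
        fun y => hQc y))
  have hcE := cl_hull E ∅
  obtain ⟨S, hSE, hSs⟩ := hsk _ (Cl.mono
    (fun t => Set.subset_union_right.trans Set.subset_union_left) hcE)
  rw [← hSE] at hcE
  have hSc : #(S : Set N) ≤ χ := by
    rw [hSE]
    exact mk_hull_le hinf hE (by simp)
  obtain ⟨i, hi, h1, h2⟩ := hcl S hSs (Cl.mono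
    (fun t => Set.subset_union_left.trans Set.subset_union_left) hcE) hSc
  have h0 : ∀ y ∈ T 0, k y ∈ S := fun y hy =>
    hcE ∅ (by simp) (Or.inr (Or.inl ⟨y, hy, rfl⟩))
  have hsucc : ∀ j < i, ∀ y ∈ T (Order.succ j), k y ∈ S := fun j hj y hy => by
    have hja : k (x (a j)) ∈ S := (h1 _).2
      (F.chain.mono _ _ (Order.succ_le_of_lt hj) hi (F.mem j (hj.trans hi)))
    refine hcE {k (x (a j))} (by simpa using hja) (Or.inr (Or.inr ?_))
    refine Set.mem_iUnion.2 ⟨⟨_, Finset.mem_singleton_self _⟩, ?_⟩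
    rw [hQ j (hj.trans hi)]
    exact ⟨y, hy, rfl⟩
  have hTS : ∀ y ∈ T i, k y ∈ S := by
    rcases Ordinal.zero_or_succ_or_isSuccLimit i with rfl | ⟨j, rfl⟩ | hl
    · exact h0
    · exact hsucc j (Order.lt_succ j)
    · intro y hy
      obtain ⟨j, hj, hyj⟩ := hT.cont i hi hl y hy
      exact hsucc j hj y (hT.mono _ _ (Order.le_succ j) ((hl.succ_lt hj).trans hi) hyj)
  refine ⟨i, hi, fun e' he' => ?_⟩
  have h3 := h2 (((k.comp (SEmb.ofSub (hT.strong i hi))).comp e').lift hSs fun z => hTS _ (e' z).2)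
    fun z => congrArg k (he' z)
  rw [← SEmb.tp_comp k]
  exact h3.of_le (k.comp (SEmb.ofSub (hT.strong i hi))) (fun z => ⟨⟨k z, hTS z z.2⟩, rfl⟩) e'
    fun z => rfl

end

end Ctx

/-! ### Domination -/

/-- Outside the indices of a chain its members do not matter, so that they can be assumed to be
strong. -/
theorem Chain.exists_strong {X : Type u} [L.Structure X] {δ : Ordinal.{u}}
    {C : Ordinal.{u} → L.Substructure X} (hC : Chain K δ C) :
    ∃ C' : Ordinal.{u} → L.Substructure X, Chain K δ C' ∧ (∀ i, K.Strong (C' i)) ∧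
      (∀ i < δ, C' i = C i) ∧ ∀ i, ¬ i < δ → C' i = ⊤ := by
  classical
  have hX : K.Mem X := (K.mem_of_strong _ (hC.strong 0 hC.lim.bot_lt)).2
  let C' : Ordinal.{u} → L.Substructure X := fun i => if i < δ then C i else ⊤
  have h1 : ∀ i < δ, C' i = C i := fun i hi => if_pos hi
  have h2 : ∀ i, ¬ i < δ → C' i = ⊤ := fun i hi => if_neg hi
  refine ⟨C', ⟨hC.lim, fun i hi => ?_, fun i j hij hj => ?_, fun i hi hl x hx => ?_, fun x => ?_⟩,
    fun i => ?_, h1, h2⟩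
  · rw [h1 i hi]
    exact hC.strong i hi
  · rw [h1 i (hij.trans_lt hj), h1 j hj]
    exact hC.mono i j hij hj
  · rw [h1 i hi] at hx
    obtain ⟨j, hj, h⟩ := hC.cont i hi hl x hx
    exact ⟨j, hj, by rwa [h1 j (hj.trans hi)]⟩
  · obtain ⟨i, hi, h⟩ := hC.top x
    exact ⟨i, hi, by rwa [h1 i hi]⟩
  · by_cases hi : i < δ
    · rw [h1 i hi]
      exact hC.strong i hi
    · rw [h2 i hi]
      exact K.strong_top hX

namespace Ctx

variable {s : K.Frame} {lam : Cardinal.{u}} {θ : WithTop Cardinal.{u}}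

/-- At limits of towers, freeness of the distinguished point from the distinguished submodel is
preserved. -/
theorem Fr.of_chainLimit (H : Ctx K s lam θ) {A Y : Type u} [L.Structure A] [L.Structure Y]
    {C : Ordinal.{u} → L.Substructure Y} {κ : Cardinal.{u}} {P : ChainExt K C → Prop}
    {E : ∀ o o' : ChainExt K C, SEmb K o.carrier o'.carrier → Prop} {i : Ordinal.{u}}
    {Z W : Type u} [L.Structure Z] [L.Structure W] {ζ : SEmb K Z Y} {f : SEmb K Z W}
    {sub : L.Substructure W} {pt : W} (Lm : ChainLimit κ P E i ζ f sub pt)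
    (hi : Order.IsSuccLimit i) (hsub : K.Strong sub) (e : SEmb K A sub)
    (h : ∀ j (hj : j < i), ∃ hs : K.Strong (Lm.ob j).sub, ∃ e' : SEmb K A (Lm.ob j).sub,
      (∀ z, Lm.r j hj (e' z) = e z) ∧ Fr s lam e' ((SEmb.ofSub hs).tp (Lm.ob j).pt)) :
    Fr s lam e ((SEmb.ofSub hsub).tp pt) := by
  choose hs e' he hfr using h
  refine Fr.of_cover H hi (B := fun j => (Lm.ob j).sub)
    (fun j hj => ((Lm.r j hj).comp (SEmb.ofSub (hs j hj))).lift hsub fun x => Lm.r_sub j hj x x.2)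
    (fun j k hjk hk x => ⟨⟨Lm.map j k hjk hk x, (Lm.compat j k hjk hk).sub _ x.2⟩,
      Subtype.ext (Lm.r_map j k hjk hk x)⟩)
    (fun x => by
      obtain ⟨j, hj, y, hy, hyx⟩ := Lm.sub_cover x x.2
      exact ⟨j, hj, ⟨y, hy⟩, Subtype.ext hyx⟩)
    (fun z => ⟨e' 0 hi.bot_lt z, Subtype.ext (he _ _ z)⟩) fun j hj e'' he'' => ?_
  have h1 := hfr j hj
  rw [← SEmb.tp_comp (Lm.r j hj), Lm.r_pt] at h1
  refine h1.of_le (r := (Lm.r j hj).comp (SEmb.ofSub (hs j hj)))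
    ((Lm.r j hj).comp (SEmb.ofSub (hs j hj))) (fun z => ⟨z, rfl⟩) e'' fun z => ?_
  exact (congrArg (fun w : sub => (w : W)) (DFunLike.congr_fun he'' z)).trans (he j hj z).symm

/-- `X` dominates the extension `N` of `X` over `b`: whenever `a`, a realization of the free
extension of `p` to `X`, lies in a model `P` from which `b` is free, then `a` is free from `N`. The
models in question are of size at most `χ`, and freeness is over the model `A`. -/
def Dominated (s : K.Frame) (lam χ : Cardinal.{u}) {A X N : Type u} [L.Structure A] [L.Structure X]
    [L.Structure N] (p : K.GType A) (e : SEmb K A X) (x : SEmb K X N) (b : N) : Prop :=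
  ∀ (N' P : Type u) [L.Structure N'] [L.Structure P] (g : SEmb K N N') (y : SEmb K P N')
    (x' : SEmb K X P) (a : P), #N' ≤ χ → (∀ z, y (x' z) = g (x z)) →
    Fr s lam (x'.comp e) (y.tp (g b)) → Fr s lam e (x'.tp a) → (x'.tp a).pull e = p →
    Fr s lam (x.comp e) (g.tp (y a))

section

variable {A X N : Type u} [L.Structure A] [L.Structure X] [L.Structure N]

/-- Dominated extensions exist. Otherwise there is a tower of length `χ⁺` which contradicts
`FreeSeq.exists_free`. -/
theorem exists_dominated (H : Ctx K s lam θ) {χ : Cardinal.{u}}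
    (hχ : ((Order.succ χ : Cardinal.{u}) : WithTop Cardinal.{u}) < θ) (hlam : lam ≤ χ)
    (hS : SymAt K s lam χ) (p : K.GType A) (e : SEmb K A X) (x : SEmb K X N) (b : N)
    (hb : Fr s lam e (x.tp b)) (hN : #N ≤ χ) (hX : χ ≤ #X) :
    ∃ (N' X' : Type u) (_ : L.Structure N') (_ : L.Structure X') (g : SEmb K N N')
      (x' : SEmb K X X') (k : SEmb K X' N'), #N' ≤ χ ∧ (∀ z, k (x' z) = g (x z)) ∧
      Fr s lam (x'.comp e) (k.tp (g b)) ∧ Dominated s lam χ p (x'.comp e) k (g b) := by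
  classical
  by_contra! hno
  have hinf : ℵ₀ ≤ χ := H.aleph0_le.trans hlam
  have hNm := x.mem_right
  -- the tower consists of extensions of the constant chain `N`
  let Ct : Ordinal.{u} → L.Substructure N := fun _ => ⊤
  have hlim : Order.IsSuccLimit (Order.succ χ).ord :=
    Cardinal.isSuccLimit_ord (hinf.trans (Order.le_succ _))
  have hCt : Chain K (Order.succ χ).ord Ct :=
    ⟨hlim, fun _ _ => K.strong_top hNm, fun _ _ _ _ => le_rfl,
      fun i _ hl _ _ => ⟨0, hl.bot_lt, trivial⟩, fun _ => ⟨0, hlim.bot_lt, trivial⟩⟩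
  let t : SEmb K N (⊤ : L.Substructure N) :=
    (SEmb.refl hNm).lift (K.strong_top hNm) fun _ => trivial
  let emb : ∀ o : ChainExt K Ct, SEmb K N o.carrier := fun o =>
    SEmb.comp (N := (⊤ : L.Substructure N)) o.emb t
  -- `o.sub` contains `X`, and `b` is free from it
  let P : ChainExt K Ct → Prop := fun o => ∃ (hs : K.Strong o.sub) (x' : SEmb K X o.sub),
    (∀ z, (x' z : o.carrier) = emb o (x z)) ∧ o.pt = emb o b ∧
      Fr s lam (x'.comp e) ((SEmb.ofSub hs).tp o.pt)
  -- an element of the next submodel is free from the submodel, but not from the model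
  let E : ∀ o o' : ChainExt K Ct, SEmb K o.carrier o'.carrier → Prop := fun o o' g =>
    ∃ c ∈ o'.sub, (∀ (S : Type u) [L.Structure S] (j : SEmb K S o.carrier) (e' : SEmb K A S),
        (∀ z, j z ∈ o.sub) → (∀ z, j (e' z) = emb o (x (e z))) → Fr s lam e' ((g.comp j).tp c)) ∧
      ¬ Fr s lam ((emb o).comp (x.comp e)) (g.tp c)
  obtain ⟨W, _, f, sub, pt, ⟨Lm⟩⟩ := exists_chain_tower (κ := χ) hinf P E hCt
    (fun i hi => Order.lt_succ_iff.1 (Cardinal.lt_ord.1 hi)) (fun _ => K.strong_top hNm)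
    (fun o o' o'' f g _ hg ⟨c, hc, h1, h2⟩ => by
      refine ⟨g c, hg.sub _ hc, fun S _ j e' hj he' => ?_, ?_⟩
      · rw [SEmb.comp_assoc, SEmb.tp_comp]
        exact h1 S j e' hj he'
      · rwa [SEmb.tp_comp])
    (fun o o' o'' f g hfs _ hf _ ⟨c, hc, h1, h2⟩ => by
      have hfe : ∀ y, f (emb o y) = emb o' y := fun y => hf.emb _ _ rfl
      refine ⟨c, hc, fun S _ j e' hj he' => ?_, fun h => h2 ?_⟩
      · exact h1 S (f.comp j) e' (fun z => hf.sub _ (hj z)) fun z =>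
          (congrArg f (he' z)).trans (hfe _)
      · refine h.of_le (r := g.comp f) g (fun z => ?_) _ fun z => ?_
        · obtain ⟨z, rfl⟩ := hfs z
          exact ⟨z, rfl⟩
        · exact (congrArg g (hfe (x (e z)))).symm)
    (by
      refine ⟨⟨0, N, SEmb.ofSub (K.strong_top hNm), x.range, b⟩, rfl, hN, x.strong_range,
        x.lift x.strong_range fun y => ⟨y, rfl⟩, fun z => rfl, rfl, ?_⟩
      exact hb.of_le _ (fun z => z.2) _ fun z => rfl)
    (fun o _ hoc ⟨hs, x', hx', hpt, hfr⟩ => by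
      have h1 := hno o.carrier o.sub inferInstance inferInstance (emb o) x' (SEmb.ofSub hs) hoc hx'
        (by rw [← hpt]; exact hfr)
      unfold Dominated at h1
      push Not at h1
      obtain ⟨N', P', _, _, g, y, z, a, hN', h2, h3, h4, -, h5⟩ := h1
      refine ⟨⟨Order.succ o.idx, N', g.comp o.emb, y.range, g o.pt⟩, g, rfl, hN',
        ⟨y.strong_range, (y.comp (z.comp x')).lift y.strong_range fun w => ⟨z (x' w), rfl⟩,
          fun w => ?_, ?_, ?_⟩, ⟨le_rfl, fun w w' hw => ?_, fun w hw => ?_, rfl⟩, y a, ⟨a, rfl⟩,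
          fun S _ j e' hj he' => ?_, ?_⟩
      · exact (h2 (x' w)).trans (congrArg g (hx' w))
      · exact congrArg g hpt
      · rw [hpt]
        exact h3.of_le _ (fun w => w.2) _ fun w => rfl
      · have : w = w' := Subtype.ext hw
        subst this
        rfl
      · exact ⟨z ⟨w, hw⟩, h2 ⟨w, hw⟩⟩
      · rw [← SEmb.tp_eq_of_comp y z (g.comp (SEmb.ofSub hs)) (SEmb.ext fun w => h2 w)] at h4
        exact h4.of_le (g.comp j) (fun w => ⟨⟨j w, hj w⟩, rfl⟩) e' fun w =>
          congrArg g ((he' w).trans (hx' (e w)).symm)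
      · intro h6
        refine h5 ?_
        have : (SEmb.ofSub hs).comp (x'.comp e) = (emb o).comp (x.comp e) :=
          SEmb.ext fun w => hx' (e w)
        rwa [this])
    (fun o hi hl hoc Lm => by
      have hs : K.Strong o.sub := Lm.strong_sub hl fun j hj => (Lm.good j hj).choose
      have hemb : ∀ j (hj : j < o.idx) (y : N), Lm.r j hj (emb (Lm.ob j) y) = emb o y :=
        fun j hj y => Lm.r_emb j hj _ _ rfl
      have hsub : ∀ z, (emb o).comp x z ∈ o.sub := fun z => by
        obtain ⟨h1, x', hx', -⟩ := Lm.good 0 hl.bot_lt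
        rw [SEmb.comp_apply, ← hemb 0 hl.bot_lt, ← hx']
        exact Lm.r_sub _ _ _ (x' z).2
      refine ⟨hs, ((emb o).comp x).lift hs hsub, fun z => rfl, ?_, ?_⟩
      · obtain ⟨h1, x', -, hpt, -⟩ := Lm.good 0 hl.bot_lt
        rw [← hemb 0 hl.bot_lt, ← hpt, Lm.r_pt]
      · refine Fr.of_chainLimit H Lm hl hs _ fun j hj => ?_
        obtain ⟨h1, x', hx', -, h2⟩ := Lm.good j hj
        refine ⟨h1, x'.comp e, fun z => ?_, h2⟩
        rw [SEmb.comp_apply, hx', hemb]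
        rfl)
  have hs : K.Strong sub := Lm.strong_sub hlim fun j hj => (Lm.good j hj).choose
  have hemb : ∀ j (hj : j < (Order.succ χ).ord) (y : N), Lm.r j hj (emb (Lm.ob j) y) = f y :=
    fun j hj y => Lm.r_emb j hj _ _ rfl
  let c : ∀ j, j < (Order.succ χ).ord → SEmb K (Lm.ob j).sub sub := fun j hj =>
    ((Lm.r j hj).comp (SEmb.ofSub (Lm.good j hj).choose)).lift hs fun y => Lm.r_sub j hj y y.2
  have hc : ∀ i j (hij : i ≤ j) (hj : j < (Order.succ χ).ord),
      coverChain c i ≤ coverChain c j := fun i j hij hj => by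
    rw [coverChain_eq c (hij.trans_lt hj), coverChain_eq c hj]
    rintro _ ⟨y, rfl⟩
    exact ⟨⟨_, (Lm.compat i j hij hj).sub _ y.2⟩, Subtype.ext (Lm.r_map i j hij hj y)⟩
  have hch := chain_contChain (K := K) hlim (C := coverChain c)
    (fun i hi => by rw [coverChain_eq c hi]; exact (c i hi).strong_range) hc
    (fun y => by
      obtain ⟨j, hj, z, hz, hzy⟩ := Lm.sub_cover y y.2
      exact ⟨j, hj, by rw [coverChain_eq c hj]; exact ⟨⟨z, hz⟩, Subtype.ext hzy⟩⟩)
  have hcle : ∀ i (hi : i < (Order.succ χ).ord), contChain (coverChain c) i ≤ (c i hi).range :=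
    fun i hi => by
      rw [← coverChain_eq c hi]
      exact contChain_le fun j k h hk => hc j k h (hk.trans_lt hi)
  obtain ⟨C, hC, hCs, hC1, hC2⟩ := hch.exists_strong
  have hfx : ∀ z, f.comp x z ∈ sub := fun z => by
    obtain ⟨h1, x', hx', -⟩ := Lm.good 0 hlim.bot_lt
    rw [SEmb.comp_apply, ← hemb 0 hlim.bot_lt, ← hx']
    exact Lm.r_sub _ _ _ (x' z).2
  let xs : SEmb K X sub := (f.comp x).lift hs hfx
  have hxC : ∀ i z, xs z ∈ C i := by
    have hl0 : ¬ Order.IsSuccLimit (0 : Ordinal.{u}) := fun h => h.ne_bot rfl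
    have h0 : ∀ z, xs z ∈ C 0 := fun z => by
      rw [hC1 0 hlim.bot_lt, contChain_of_not_limit _ hl0, coverChain_eq c (j := 0) hlim.bot_lt]
      obtain ⟨h1, x', hx', -⟩ := Lm.good 0 hlim.bot_lt
      refine ⟨x' z, Subtype.ext ?_⟩
      change Lm.r 0 hlim.bot_lt (x' z) = f (x z)
      rw [hx', hemb]
    intro i z
    by_cases hi : i < (Order.succ χ).ord
    · exact hC.mono 0 i zero_le hi (h0 z)
    · rw [hC2 i hi]
      trivial
  -- the elements witnessing the failure of domination form a free sequence in the union of the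
  -- distinguished submodels
  have hext := fun i (hi : i < (Order.succ χ).ord) =>
    Lm.ext i _ (Order.lt_succ i) (hlim.succ_lt hi)
  choose d hd hd1 hd2 using hext
  let a : Ordinal.{u} → sub := fun i => if hi : i < (Order.succ χ).ord then
    ⟨Lm.r _ (hlim.succ_lt hi) (d i hi), Lm.r_sub _ _ _ (hd i hi)⟩ else xs (Classical.choice
      (Cardinal.mk_ne_zero_iff.1 (Cardinal.aleph0_pos.trans_le (hinf.trans hX)).ne'))
  have ha : ∀ i (hi : i < (Order.succ χ).ord),
      (a i : W) = Lm.r _ (hlim.succ_lt hi) (d i hi) := fun i hi => by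
    simp only [a, dif_pos hi]
  have hrr : ∀ i (hi : i < (Order.succ χ).ord), (Lm.r _ (hlim.succ_lt hi)).comp
      (Lm.map i _ (Order.lt_succ i).le (hlim.succ_lt hi)) = Lm.r i hi := fun i hi =>
    SEmb.ext fun y => Lm.r_map i _ (Order.lt_succ i).le (hlim.succ_lt hi) y
  have hCc : ∀ i (hi : i < (Order.succ χ).ord), #(C i) ≤ χ := fun i hi => by
    rw [hC1 i hi]
    refine (Cardinal.mk_le_mk_of_subset (hcle i hi)).trans ?_
    have h1 : #(c i hi).range ≤ χ := by
      rw [SEmb.mk_range]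
      exact (Cardinal.mk_set_le _).trans (Lm.size i hi)
    exact h1
  have F : FreeSeq s lam χ C (xs.comp e) a :=
    { chain := hC
      strong := hCs
      card_le := hCc
      le_card := fun i hi => hX.trans (Cardinal.mk_le_of_injective
        (f := fun z : X => (⟨xs z, hxC i z⟩ : C i)) fun z z' h =>
          xs.injective (congrArg (fun w : C i => (w : sub)) h))
      base := fun i z => hxC i (e z)
      mem := fun i hi => by
        rw [hC1 _ (hlim.succ_lt hi), contChain_of_not_limit _ (Order.not_isSuccLimit_succ i),
          coverChain_eq c (hlim.succ_lt hi)]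
        exact ⟨⟨d i hi, hd i hi⟩, Subtype.ext (ha i hi).symm⟩
      free := fun i hi => by
        obtain ⟨h1, x', hx', -⟩ := Lm.good i hi
        have h2 := hd1 i hi _ (SEmb.ofSub h1) (x'.comp e) (fun z => z.2) fun z => hx' (e z)
        rw [← SEmb.tp_comp (Lm.r _ (hlim.succ_lt hi)), ← SEmb.comp_assoc, hrr i hi, ← ha i hi] at h2
        rw [← SEmb.tp_comp (SEmb.ofSub hs)]
        refine h2.of_le (r := (Lm.r i hi).comp (SEmb.ofSub h1)) _ (fun z => ?_) _ fun z => ?_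
        · obtain ⟨w, hw⟩ := hcle i hi ((hC1 i hi).le z.2)
          exact ⟨w, congrArg (fun w : sub => (w : W)) hw⟩
        · refine Eq.trans ?_ (congrArg (Lm.r i hi) (hx' (e z))).symm
          rw [hemb]
          rfl }
  have hT : Chain K (Order.succ χ).ord (coverChain Lm.r) := by
    refine ⟨hlim, fun i hi => ?_, fun i j hij hj => ?_, fun i hi hl y hy => ?_, fun y => ?_⟩
    · rw [coverChain_eq _ hi]
      exact (Lm.r i hi).strong_range
    · rw [coverChain_eq _ (hij.trans_lt hj), coverChain_eq _ hj]
      rintro _ ⟨y, rfl⟩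
      exact ⟨_, Lm.r_map i j hij hj y⟩
    · rw [coverChain_eq _ hi] at hy
      obtain ⟨y, rfl⟩ := hy
      obtain ⟨j, hj, z, hz⟩ := Lm.cont i hi hl y
      exact ⟨j, hj, by rw [coverChain_eq _ (hj.trans hi)]; exact ⟨z, hz⟩⟩
    · obtain ⟨j, hj, z, hz⟩ := Lm.cover y
      exact ⟨j, hj, by rw [coverChain_eq _ hj]; exact ⟨z, hz⟩⟩
  obtain ⟨i, hi, h⟩ := F.exists_free H hχ hlam hS (SEmb.ofSub hs)
    (Lm.mk_le (hinf.trans (Order.le_succ χ)) (fun j hj => (Lm.size j hj).trans (Order.le_succ χ))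
      (by simp)) hT (fun i hi => by
        rw [coverChain_eq _ hi, SEmb.mk_range]
        exact Lm.size i hi)
  -- `a i` is free from the `i`-th model of the tower, contrary to its choice
  have hfT : ∀ z, (f.comp (x.comp e)) z ∈ coverChain Lm.r i := fun z => by
    rw [coverChain_eq _ hi]
    exact ⟨_, hemb i hi (x (e z))⟩
  have h1 := h ((f.comp (x.comp e)).lift (hT.strong i hi) hfT) fun z => rfl
  refine hd2 i hi ?_
  rw [← SEmb.tp_comp (Lm.r _ (hlim.succ_lt hi)), hrr i hi, ← ha i hi]
  refine h1.of_le _ (fun z => ?_) _ fun z => hemb i hi _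
  rw [SEmb.range_ofSub, coverChain_eq _ hi]
  exact ⟨z, rfl⟩

end

end Ctx

/-! ### Symmetry in all sizes -/

namespace Ctx

variable {s : K.Frame} {lam : Cardinal.{u}} {θ : WithTop Cardinal.{u}}

section

variable {A X : Type u} [L.Structure A] [L.Structure X]

/-- Two elements `a`, `b` which are free from models containing `X` and the other one. The model `X`
is resolved into a chain of smaller models, and a tower of dominated extensions of its members is
built, with union `X⁺`. If `b` is free from a model containing `X⁺` and `a`, then by domination
`a` is free from all members of the tower, hence from its union. -/
theorem exists_free_pair (H : Ctx K s lam θ) {μ : Cardinal.{u}}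
    (hμ : (μ : WithTop Cardinal.{u}) < θ) (hlam : lam < μ)
    (hS : ∀ χ, lam ≤ χ → χ < μ → SymAt K s lam χ) (e : SEmb K A X) (hX : #X = μ) (hA : #A = lam)
    {p q : K.GType A} (hp : p ∈ s.bs A) (hq : q ∈ s.bs A) :
    ∃ (N P R : Type u) (_ : L.Structure N) (_ : L.Structure P) (_ : L.Structure R)
      (i : SEmb K X P) (j : SEmb K X R) (g : SEmb K P N) (h : SEmb K R N) (a : P) (b : R),
      #N ≤ μ ∧ (∀ z, g (i z) = h (j z)) ∧ Fr s lam (i.comp e) (g.tp (h b)) ∧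
      Fr s lam (j.comp e) (h.tp (g a)) ∧ (i.comp e).tp a = p ∧ (j.comp e).tp b = q := by
  classical
  subst hX
  obtain ⟨C, hC, -, hCs, hD, hCc, hCl, -, hCi⟩ := exists_filtration e.mem_right H.LS_le hlam
    (fun _ => ∅) (fun _ => by simp) (Set.range e) (Cardinal.mk_range_le.trans hA.le)
    (fun _ => ∅) (fun _ _ _ _ => by simp)
  have hlt : ∀ {c : Cardinal.{u}}, c ≤ #X → (c : WithTop Cardinal.{u}) < θ := fun h =>
    (WithTop.coe_le_coe.2 h).trans_lt hμ
  have hinf : ∀ i, ℵ₀ ≤ #(C i) := fun i => H.aleph0_le.trans (hCl i)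
  have hCm : ∀ i j, i ≤ j → j < (#X).ord → #(C i) ≤ #(C j) := fun i j hij hj =>
    Cardinal.mk_le_mk_of_subset (hC.mono i j hij hj)
  let eC : ∀ i, SEmb K A (C i) := fun i => e.lift (hCs i) fun z => hD i ⟨z, rfl⟩
  -- `o.sub` contains `C o.idx`, `o.pt` realizes the free extension of `q` to it, and at successors
  -- some model inside `o.sub` dominates `o`
  let P : ChainExt K C → Prop := fun o => #o.carrier ≤ #(C o.idx) ∧
    ∃ (hs : K.Strong o.sub) (x' : SEmb K (C o.idx) o.sub), (∀ z, (x' z : o.carrier) = o.emb z) ∧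
      Fr s lam (x'.comp (eC o.idx)) ((SEmb.ofSub hs).tp o.pt) ∧
      (o.emb.comp (eC o.idx)).tp o.pt = q ∧
      ∀ j, o.idx = Order.succ j → ∃ (B : Type u) (_ : L.Structure B) (k : SEmb K B o.carrier)
        (e' : SEmb K A B), (∀ z, k z ∈ o.sub) ∧ (∀ z, k (e' z) = o.emb (eC o.idx z)) ∧
        Dominated s lam #(C o.idx) p e' k o.pt
  obtain ⟨W, _, f, sub, pt, ⟨Lm⟩⟩ := exists_chain_tower (κ := #X) (H.aleph0_le.trans hlam.le) P
    (fun _ _ _ => True) hC (fun i hi => (Cardinal.lt_ord.1 hi).le) hCs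
    (fun _ _ _ _ _ _ _ _ => trivial) (fun _ _ _ _ _ _ _ _ _ _ => trivial)
    (by
      have h0 := (hCc 0 hC.lim.bot_lt).le
      obtain ⟨t, ht, htq⟩ := H.exists_fr hq hA (eC 0) (hlt h0)
      obtain ⟨N, _, i, b, hN, rfl⟩ := H.exists_tp_small (hCl 0) t
      refine ⟨⟨0, N, i, i.range, b⟩, rfl, hN.trans h0, hN, i.strong_range,
        i.lift i.strong_range fun z => ⟨z, rfl⟩, fun z => rfl, ?_, htq, fun j hj => ?_⟩
      · exact ht.of_le _ (fun z => z.2) _ fun z => rfl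
      · exact absurd hj (Order.bot_lt_succ j).ne)
    (fun o hi _ ⟨hoc, hs, x', hx', hfr, hoq, _⟩ => by
      have hii : o.idx < (#X).ord := (Order.lt_succ _).trans hi
      have hle := hC.mono _ _ (Order.le_succ o.idx) hi
      have hχμ := hCc _ hi
      -- adjoin `C (o.idx + 1)` to the submodel, keep the point free over the result, and pass to a
      -- dominated extension
      let inc : SEmb K (C o.idx) (C (Order.succ o.idx)) := SEmb.incl hle (hCs _) (hCs _)
      obtain ⟨W₁, _, g₁, g₂, hW₁, h1⟩ := H.amalg (hlt hχμ.le) x' inc (hCl _)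
        ((Cardinal.mk_set_le _).trans (hoc.trans (hCm _ _ (Order.le_succ _) hi))) le_rfl
      obtain ⟨W₂, _, g₃, g₄, hW₂, h2, hfr2⟩ := H.exists_free_amalgam (hlt hχμ.le) (SEmb.ofSub hs)
        o.pt hfr g₁ (hoc.trans (hCm _ _ (Order.le_succ _) hi)) hW₁
      obtain ⟨N', X', _, _, g₅, x₅, k₅, hN', h3, hfr3, hdom⟩ := H.exists_dominated
        (hlt (Order.succ_le_of_lt hχμ)) (hCl _) (hS _ (hCl _) hχμ) p _ g₄ (g₃ o.pt) hfr2 hW₂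
        g₂.mk_le
      have h4 : ∀ z, g₅ (g₃ (x' z)) = g₅ (g₄ (g₂ (inc z))) := fun z => by
        rw [← h1, ← h2]
        rfl
      have h5 : ∀ z, k₅ (x₅ (g₂ z)) = g₅ (g₄ (g₂ z)) := fun z => h3 _
      have h6 : ∀ z, k₅ (x₅ (g₁ (x' (eC o.idx z)))) =
          g₅ (g₄ (g₂ (eC (Order.succ o.idx) z))) := fun z => by
        rw [h3, h1]
        rfl
      refine ⟨⟨Order.succ o.idx, N', g₅.comp (g₄.comp g₂), k₅.range, g₅ (g₃ o.pt)⟩, g₅.comp g₃, rfl,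
        hN'.trans hχμ.le, ⟨hN', k₅.strong_range, (g₅.comp (g₄.comp g₂)).lift k₅.strong_range
          fun z => ⟨_, h5 z⟩, fun z => rfl, ?_, ?_, fun j _ => ⟨X', inferInstance, k₅, _,
          fun z => ⟨z, rfl⟩, h6, hdom⟩⟩, ⟨hle, fun z z' hz => ?_, fun y hy => ?_, rfl⟩, trivial⟩
      · exact hfr3.of_le _ (fun z => z.2) _ fun z => (h6 z).symm
      · refine Eq.trans ?_ hoq
        refine SEmb.tp_eq_of_comp (g₅.comp g₃) (o.emb.comp (eC o.idx)) _ (SEmb.ext fun z => ?_) o.pt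
        simp only [SEmb.comp_apply]
        rw [← hx', h4]
        rfl
      · have : inc z = z' := Subtype.ext hz
        subst this
        simp only [SEmb.comp_apply]
        rw [← hx', h4]
      · refine ⟨x₅ (g₁ ⟨y, hy⟩), ?_⟩
        have h7 := h2 ⟨y, hy⟩
        exact (h3 _).trans (congrArg g₅ h7.symm))
    (fun o hi hl _ Lm => by
      have hs : K.Strong o.sub := Lm.strong_sub hl fun j hj => (Lm.good j hj).2.choose
      have hle : ∀ j < o.idx, C (Lm.ob j).idx ≤ C o.idx := fun j hj => by
        rw [Lm.idx j hj]
        exact hC.mono j _ hj.le hi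
      have hemb : ∀ z, o.emb z ∈ o.sub := fun z => by
        obtain ⟨j, hj, hz⟩ := hC.cont o.idx hi hl z z.2
        have hz' : (z : X) ∈ C (Lm.ob j).idx := by rwa [Lm.idx j hj]
        obtain ⟨-, h1, x', hx', -⟩ := Lm.good j hj
        rw [← Lm.r_emb j hj ⟨z, hz'⟩ z rfl, ← hx']
        exact Lm.r_sub j hj _ (x' _).2
      refine ⟨Lm.mk_le (hinf _) (fun j hj => (Lm.good j hj).1.trans
        (Cardinal.mk_le_mk_of_subset (hle j hj))) (hCi _ hi), hs, o.emb.lift hs hemb,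
        fun z => rfl, ?_, ?_, fun j hj => ?_⟩
      · refine Fr.of_chainLimit H Lm hl hs _ fun j hj => ?_
        obtain ⟨-, h1, x', hx', h2, -⟩ := Lm.good j hj
        refine ⟨h1, _, fun z => ?_, h2⟩
        rw [SEmb.comp_apply, hx']
        exact Lm.r_emb j hj _ _ rfl
      · obtain ⟨-, h1, x', hx', -, h2, -⟩ := Lm.good 0 hl.bot_lt
        have h3 := SEmb.tp_eq_of_comp (Lm.r 0 hl.bot_lt) ((Lm.ob 0).emb.comp (eC _))
          (o.emb.comp (eC o.idx)) (SEmb.ext fun z => Lm.r_emb 0 hl.bot_lt _ _ rfl) (Lm.ob 0).pt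
        rw [Lm.r_pt] at h3
        exact h3.trans h2
      · rw [hj] at hl
        exact absurd hl (Order.not_isSuccLimit_succ j))
  have hlim := hC.lim
  have hs : K.Strong sub := Lm.strong_sub hlim fun j hj => (Lm.good j hj).2.choose
  have hemb : ∀ j (hj : j < (#X).ord) z, Lm.r j hj ((Lm.ob j).emb (eC _ z)) = f (e z) :=
    fun j hj z => Lm.r_emb j hj _ _ rfl
  have hfs : ∀ z, f z ∈ sub := fun z => by
    obtain ⟨j, hj, hz⟩ := hC.top z
    have hz' : z ∈ C (Lm.ob j).idx := by rwa [Lm.idx j hj]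
    obtain ⟨-, h1, x', hx', -⟩ := Lm.good j hj
    rw [← Lm.r_emb j hj ⟨z, hz'⟩ z rfl, ← hx']
    exact Lm.r_sub j hj _ (x' _).2
  have hW : #W ≤ #X := Lm.mk_le (H.aleph0_le.trans hlam.le) Lm.size (by simp)
  let fs : SEmb K X sub := f.lift hs hfs
  have hfr : Fr s lam (fs.comp e) ((SEmb.ofSub hs).tp pt) :=
    Fr.of_chainLimit H Lm hlim hs _ fun j hj => by
      obtain ⟨-, h1, x', hx', h2, -⟩ := Lm.good j hj
      refine ⟨h1, _, fun z => ?_, h2⟩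
      rw [SEmb.comp_apply, hx']
      exact hemb j hj z
  have hbq : (f.comp e).tp pt = q := by
    obtain ⟨-, h1, x', hx', -, h2, -⟩ := Lm.good 0 hlim.bot_lt
    have h3 := SEmb.tp_eq_of_comp (Lm.r 0 hlim.bot_lt) ((Lm.ob 0).emb.comp (eC _))
      (f.comp e) (SEmb.ext fun z => hemb 0 hlim.bot_lt z) (Lm.ob 0).pt
    rw [Lm.r_pt] at h3
    exact h3.trans h2
  -- realize the free extension of `p` to `sub` by `a` in `V`, and amalgamate `V` and `W` over `sub`
  -- such that `pt` is free from `V`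
  have hsubc : #sub ≤ #X := (Cardinal.mk_set_le _).trans hW
  obtain ⟨t, ht, htp⟩ := H.exists_fr hp hA (fs.comp e) (hlt hsubc)
  obtain ⟨V, _, v, a, hV, rfl⟩ := H.exists_tp_small (ht.le) t
  obtain ⟨Q, _, g, k, hQ, hgk, hfrk⟩ := H.exists_free_amalgam hμ (SEmb.ofSub hs) pt hfr v hW
    (hV.trans hsubc)
  refine ⟨Q, V, W, inferInstance, inferInstance, inferInstance, v.comp fs, f, k, g, a, pt, hQ,
    fun z => (hgk (fs z)).symm, hfrk, ?_, htp, hbq⟩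
  refine Fr.of_cover H hlim (B := fun j => (Lm.ob (Order.succ j)).carrier)
    (fun j hj => Lm.r _ (hlim.succ_lt hj))
    (fun j k hjk hk x => ⟨_, Lm.r_map _ _ (Order.succ_le_succ hjk) (hlim.succ_lt hk) x⟩)
    (fun x => by
      obtain ⟨j, hj, y, rfl⟩ := Lm.cover x
      exact ⟨j, hj, _, Lm.r_map _ _ (Order.le_succ j) (hlim.succ_lt hj) y⟩)
    (fun z => ⟨_, hemb _ _ z⟩) fun j hj e'' he'' => ?_
  -- `a` is free from the members of the tower with successor index, by domination
  have hj' := hlim.succ_lt hj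
  obtain ⟨hoc, h1, x', hx', -, -, h2⟩ := Lm.good _ hj'
  obtain ⟨B, _, k', e', hk', he', hdom⟩ := h2 j (Lm.idx _ hj')
  let χ := #(C (Lm.ob (Order.succ j)).idx)
  have hχ : ℵ₀ ≤ χ := hinf _
  have hLS : K.LS ≤ χ := H.LS_le.trans (hCl _)
  let r := Lm.r _ hj'
  let cB : SEmb K B sub := (r.comp k').lift hs fun z => Lm.r_sub _ hj' _ (hk' z)
  have hcB : ∀ z, cB (e' z) = fs (e z) := fun z =>
    Subtype.ext ((congrArg r (he' z)).trans (hemb _ hj' z))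
  -- models of size `χ` containing the relevant elements
  obtain ⟨S₁, hS1, hS1s, hS1c⟩ := exists_strong_le v.mem_right hLS (Set.range (v.comp cB) ∪ {a})
    (mk_union_le_of_le hχ (Cardinal.mk_range_le.trans (k'.mk_le.trans hoc)) (by
      rw [Cardinal.mk_singleton]
      exact Cardinal.one_le_aleph0.trans hχ))
  obtain ⟨S₂, hS2, hS2s, hS2c⟩ := exists_strong_le k.mem_right hLS
    (Set.range (g.comp r) ∪ Set.range (k.comp (SEmb.ofSub hS1s)))
    (mk_union_le_of_le hχ (Cardinal.mk_range_le.trans hoc) (Cardinal.mk_range_le.trans hS1c))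
  let g' := (g.comp r).lift hS2s fun z => hS2 (Or.inl ⟨z, rfl⟩)
  let y' := (k.comp (SEmb.ofSub hS1s)).lift hS2s fun z => hS2 (Or.inr ⟨z, rfl⟩)
  let x'' := (v.comp cB).lift hS1s fun z => hS1 (Or.inl ⟨z, rfl⟩)
  have hcBe : cB.comp e' = fs.comp e := SEmb.ext hcB
  have e1 : (v.tp a).pull cB = x''.tp ⟨a, hS1 (Or.inr rfl)⟩ :=
    SEmb.tp_comp (SEmb.ofSub hS1s) x'' (⟨a, hS1 (Or.inr rfl)⟩ : S₁)
  have h3 := hdom S₂ S₁ g' y' x'' ⟨a, hS1 (Or.inr rfl)⟩ hS2c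
    (fun z => Subtype.ext (hgk (cB z)).symm)
    (by
      rw [← SEmb.tp_comp (SEmb.ofSub hS2s)]
      have e2 : SEmb.ofSub hS2s (g' (Lm.ob (Order.succ j)).pt) = g pt := congrArg g (Lm.r_pt _ hj')
      rw [e2]
      refine hfrk.of_le ((SEmb.ofSub hS2s).comp y') (fun z => ⟨(z : V), rfl⟩) _ fun z => ?_
      exact congrArg (fun w => k (v w)) (hcB z))
    (by
      rw [← e1]
      refine Fr.pull ?_
      rwa [hcBe])
    (by
      rw [← e1, GType.pull_pull, hcBe]
      exact htp)
  rw [← SEmb.tp_comp (SEmb.ofSub hS2s)] at h3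
  have e3 : k'.comp e' = e'' := SEmb.ext fun z => r.injective (by
    have h4 : r (e'' z) = f (e z) := DFunLike.congr_fun he'' z
    rw [h4]
    exact (congrArg r (he' z)).trans (hemb _ hj' z))
  rw [e3] at h3
  exact h3

/-- Symmetry holds in all sizes below `θ`. By uniqueness the given pair can be compared with the one
from `exists_free_pair`: `a` has the same type over `X` as `a₁`, and, after free amalgamation, `b`
has the same type as `b₁` over a model containing `X` and `a = a₁`. -/
theorem symAt (H : Ctx K s lam θ) (μ : Cardinal.{u}) (hlam : lam ≤ μ)
    (hμ : (μ : WithTop Cardinal.{u}) < θ) : SymAt K s lam μ := by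
  induction μ using WellFoundedLT.induction with
  | ind μ ih =>
  rcases hlam.eq_or_lt with rfl | hlam
  · exact H.symAt_lam
  intro A A' X P N _ _ _ _ _ e e' x y b a hX hN hb ha
  have hlt : ∀ {c : Cardinal.{u}}, c ≤ μ → (c : WithTop Cardinal.{u}) < θ := fun h =>
    (WithTop.coe_le_coe.2 h).trans_lt hμ
  have hPμ : #P ≤ μ := y.mk_le.trans hN
  have hXc : #X = μ := le_antisymm (x.mk_le.trans hPμ) hX
  obtain ⟨D, _, m, d, d', hD, hd, hd', -⟩ := H.exists_common e e' hb.1.le ha.1.le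
    (hlam.le.trans hX) ∅ (by simp)
  subst hd hd'
  have ha1 : Fr s lam m (x.tp a) := Fr.base H ha hD
  have hb1 : Fr s lam (x.comp m) (y.tp b) := Fr.base H (c := d) hb hD
  obtain ⟨N₁, P₁, R₁, _, _, _, i, j, g, h, a₁, b₁, hN₁, h1, hb2, ha2, hap, hbq⟩ :=
    H.exists_free_pair hμ hlam (fun χ h1 h2 => ih χ h2 h1 (hlt h2.le)) m hXc hD (ha1.bs H)
      (hb1.bs H)
  have ha3 : Fr s lam m (i.tp a₁) := by
    have h2 : (h.tp (g a₁)).pull j = i.tp a₁ :=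
      SEmb.tp_eq_of_comp g i (h.comp j) (SEmb.ext h1) a₁
    exact h2 ▸ Fr.pull (j := j) ha2
  have htp : x.tp a = i.tp a₁ := Fr.uniq H (hlt hXc.le) ha1 ha3 hap.symm
  obtain ⟨Q, _, σ, τ, hQ, h2, h2'⟩ := H.amalg_of_tp_eq hμ x i (hlam.le.trans hX) hPμ
    (g.mk_le.trans hN₁) htp
  obtain ⟨Q₁, _, gN, kQ, hQ₁, h3, h3'⟩ := H.exists_free_amalgam hμ y b hb1 σ hN hQ
  obtain ⟨Q₂, _, gN', kQ', hQ₂, h4, h4'⟩ := H.exists_free_amalgam hμ g (h b₁) hb2 τ hN₁ hQ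
  have hbase : σ.comp (x.comp m) = τ.comp (i.comp m) := SEmb.ext fun z => h2 (m z)
  have htp' : kQ.tp (gN b) = kQ'.tp (gN' (h b₁)) := by
    refine Fr.uniq H (hlt hQ) h3' (hbase ▸ h4') ?_
    rw [SEmb.tp_pull, SEmb.tp_pull]
    have e1 : (kQ.comp (σ.comp (x.comp m))).tp (gN b) = (y.comp (x.comp m)).tp b :=
      SEmb.tp_eq_of_comp gN _ _ (SEmb.ext fun z => h3 _) b
    have e2 : (kQ'.comp (σ.comp (x.comp m))).tp (gN' (h b₁)) = (j.comp m).tp b₁ :=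
      SEmb.tp_eq_of_comp (gN'.comp h) _ _ (SEmb.ext fun z => by
        simp only [SEmb.comp_apply]
        rw [← h1, h4, h2]) b₁
    rw [e1, e2, hbq]
    rfl
  obtain ⟨Z, _, z, z', hZ, h5, h5'⟩ := H.amalg_of_tp_eq hμ kQ kQ' (hlam.le.trans
    (hX.trans (σ.comp x).mk_le)) hQ₁ hQ₂ htp'
  refine ⟨Z, R₁, inferInstance, inferInstance, z.comp gN, z'.comp (gN'.comp h), j, b₁, hZ,
    fun w => ?_, h5'.symm, ?_⟩
  · simp only [SEmb.comp_apply]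
    rw [← h1, h4, ← h2, ← h5, ← h3]
  · have e1 : (z.comp gN) (y a) = (z'.comp gN') (g a₁) := by
      simp only [SEmb.comp_apply]
      rw [h3, h2', h5, h4]
    rw [e1]
    have e2 : (z'.comp (gN'.comp h)).tp ((z'.comp gN') (g a₁)) = h.tp (g a₁) :=
      SEmb.tp_eq_of_comp (z'.comp gN') h _ rfl (g a₁)
    rw [e2]
    refine Fr.trans H ha2 ?_
    have h6 : (h.tp (g a₁)).pull j = i.tp a₁ :=
      SEmb.tp_eq_of_comp g i (h.comp j) (SEmb.ext h1) a₁
    rw [h6, ← htp]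
    exact ha

end

end Ctx

/-! ### The extended frame in terms of free types -/

namespace Ctx

variable {s : K.Frame} {lam : Cardinal.{u}} {θ : WithTop Cardinal.{u}}

section

variable {A B M N X Y : Type u} [L.Structure A] [L.Structure B] [L.Structure M] [L.Structure N]
  [L.Structure X] [L.Structure Y]

theorem lt_of_mk_le (h : #X ≤ #Y) (hY : ((#Y : Cardinal.{u}) : WithTop Cardinal.{u}) < θ) :
    ((#X : Cardinal.{u}) : WithTop Cardinal.{u}) < θ := (WithTop.coe_le_coe.2 h).trans_lt hY

/-- A free type over a model, with a base inside `S`, gives an instance of the nonforking relation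
of the extended frame. -/
theorem extendNF_of_fr (H : Ctx K s lam θ) (i : SEmb K M N)
    (hN : ((#N : Cardinal.{u}) : WithTop Cardinal.{u}) < θ) {e : SEmb K A M} {a : N}
    (h : Fr s lam e (i.tp a)) {S : L.Substructure N} (hS : K.Strong S) (hle : S ≤ i.range)
    (he : ∀ z, i (e z) ∈ S) : s.extendNF lam θ S i.range a := by
  have hi := i.strong_range
  have hAS : (i.comp e).range ≤ S := by
    rintro _ ⟨z, rfl⟩
    exact he z
  have hS0 : lam ≤ #S := by
    rw [← h.1]
    exact ((i.comp e).lift hS he).mk_le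
  have hSi : #S ≤ #i.range := (SEmb.incl hle hS hi).mk_le
  have hiN : #i.range ≤ #N := Cardinal.mk_subtype_le _
  refine ⟨⟨hS.mem, hS0, lt_of_mk_le (hSi.trans hiN) hN⟩,
    ⟨hi.mem, hS0.trans hSi, lt_of_mk_le hiN hN⟩, ⟨i.mem_right, (hS0.trans hSi).trans hiN, hN⟩,
    (Strong.le_iff hS hi).2 hle, hi, (i.comp e).range,
    (Strong.le_iff (SEmb.strong_range _) hS).2 hAS, by rw [SEmb.mk_range, h.1],
    fun M' N' h1 h2 h3 hN' hMc hNc ha => ?_⟩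
  have hM' : K.Strong M' := h2.strong hi
  obtain ⟨m, hm⟩ := SEmb.exists_factor i (SEmb.ofSub hM') fun x => h2.1 x.2
  let d : SEmb K A M' := (i.comp e).lift hM' fun z => h1.1 ⟨z, rfl⟩
  have hd : m.comp d = e := SEmb.ext fun z => i.injective (DFunLike.congr_fun hm (d z))
  have h4 := h.2 M' m d hMc hd
  have h5 : (SEmb.incl h3.1 hM' hN').tp ⟨a, ha⟩ = (i.tp a).pull m := by
    rw [SEmb.tp_pull, hm]
    exact (SEmb.tp_comp (SEmb.ofSub hN') (SEmb.incl h3.1 hM' hN') (⟨a, ha⟩ : N')).symm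
  rw [← h5] at h4
  have h6 := H.nf_of_dnf (SEmb.incl h3.1 hM' hN') hNc d _ h4
  have e1 : ((SEmb.incl h3.1 hM' hN').comp d).range =
      (i.comp e).range.comap N'.subtype.toHom := by
    ext z
    exact ⟨fun ⟨w, hw⟩ => ⟨w, congrArg Subtype.val hw⟩, fun ⟨w, hw⟩ => ⟨w, Subtype.ext hw⟩⟩
  have e2 : (SEmb.incl h3.1 hM' hN').range = M'.comap N'.subtype.toHom := by
    ext z
    exact ⟨fun ⟨w, hw⟩ => hw ▸ w.2, fun hz => ⟨⟨z, hz⟩, rfl⟩⟩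
  rwa [e1, e2] at h6

theorem fr_of_extendNF (H : Ctx K s lam θ) (i : SEmb K M N) {S : L.Substructure N} {a : N}
    (h : s.extendNF lam θ S i.range a) :
    ∃ (A : Type u) (_ : L.Structure A) (e : SEmb K A M), (∀ z, i (e z) ∈ S) ∧
      Fr s lam e (i.tp a) := by
  obtain ⟨-, -, hN, hSi, hi, A, hA, hAc, hall⟩ := h
  have hAs : K.Strong A := hA.strong (hSi.strong hi)
  obtain ⟨e, he⟩ := SEmb.exists_factor i (SEmb.ofSub hAs) fun x => hSi.1 (hA.1 x.2)
  refine ⟨A, inferInstance, e, fun z => ?_, hAc, fun M₂ _ m d hM₂ hd => ?_⟩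
  · rw [show i (e z) = z from DFunLike.congr_fun he z]
    exact hA.1 z.2
  obtain ⟨N', h1, hN's, hNc⟩ := exists_strong_card i.mem_right H.LS_le
    (((i.comp m).range : Set N) ∪ {a})
    (mk_union_le_of_le H.aleph0_le ((i.comp m).mk_range.trans hM₂).le (by
      rw [Cardinal.mk_singleton]
      exact Cardinal.one_le_aleph0.trans H.aleph0_le)) hN.2.1
  have ha : a ∈ N' := h1 (Or.inr rfl)
  have himd : (i.comp m).comp d = SEmb.ofSub hAs := by rw [SEmb.comp_assoc, hd, he]
  have hms := (i.comp m).strong_range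
  have h2 := hall (i.comp m).range N'
    ((Strong.le_iff hAs hms).2 fun x hx => ⟨d ⟨x, hx⟩, DFunLike.congr_fun himd ⟨x, hx⟩⟩)
    ((Strong.le_iff hms hi).2 fun x ⟨w, hw⟩ => ⟨m w, hw⟩)
    ((Strong.le_iff hms hN's).2 fun x hx => h1 (Or.inl hx)) hN's
    ((i.comp m).mk_range.trans hM₂) hNc ha
  let k : SEmb K M₂ N' := (i.comp m).lift hN's fun z => h1 (Or.inl ⟨z, rfl⟩)
  refine ⟨⟨N', k.emb, k.strong, ⟨a, ha⟩⟩,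
    (SEmb.tp_comp (SEmb.ofSub hN's) k (⟨a, ha⟩ : N')).symm, ?_⟩
  have e1 : d.range.map k.emb.toHom = A.comap N'.subtype.toHom := by
    ext z
    constructor
    · rintro ⟨_, ⟨w, rfl⟩, rfl⟩
      have h3 : ((k (d w) : N') : N) = w := DFunLike.congr_fun himd w
      change ((k (d w) : N') : N) ∈ A
      rw [h3]
      exact w.2
    · intro hz
      let w : A := ⟨(z : N), hz⟩
      have h3 : ((k (d w) : N') : N) = w := DFunLike.congr_fun himd w
      exact ⟨d w, ⟨_, rfl⟩, Subtype.ext h3⟩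
  have e2 : k.range = (i.comp m).range.comap N'.subtype.toHom := by
    ext z
    exact ⟨fun ⟨w, hw⟩ => ⟨w, congrArg Subtype.val hw⟩, fun ⟨w, hw⟩ => ⟨w, Subtype.ext hw⟩⟩
  change s.nf (d.range.map k.emb.toHom) k.range ⟨a, ha⟩
  rw [e1, e2]
  exact h2

theorem extendNF_iff (H : Ctx K s lam θ) {S T : L.Substructure N} {a : N} :
    s.extendNF lam θ S T a ↔ ((#N : Cardinal.{u}) : WithTop Cardinal.{u}) < θ ∧ S ≤ T ∧
      K.Strong S ∧ ∃ (hT : K.Strong T) (A : Type u) (_ : L.Structure A) (e : SEmb K A T),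
        (∀ z, (e z : N) ∈ S) ∧ Fr s lam e ((SEmb.ofSub hT).tp a) := by
  constructor
  · intro h
    have hT : K.Strong T := h.2.2.2.2.1
    refine ⟨h.2.2.1.2.2, h.2.2.2.1.1, h.2.2.2.1.strong hT, hT, ?_⟩
    rw [← SEmb.range_ofSub hT] at h
    exact H.fr_of_extendNF (SEmb.ofSub hT) h
  · rintro ⟨hN, hST, hS, hT, A, _, e, he, h⟩
    have h1 := H.extendNF_of_fr (SEmb.ofSub hT) hN h hS (by rwa [SEmb.range_ofSub]) he
    rwa [SEmb.range_ofSub] at h1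

/-- Basic types of the extended frame are the types which are free over some model. -/
theorem mem_extend_bs_iff (H : Ctx K s lam θ) {p : K.GType M} :
    p ∈ (s.extend lam θ).bs M ↔ ((#M : Cardinal.{u}) : WithTop Cardinal.{u}) < θ ∧
      ∃ (A : Type u) (_ : L.Structure A) (e : SEmb K A M), Fr s lam e p := by
  constructor
  · rintro ⟨x, rfl, hx⟩
    let i : SEmb K M x.carrier := ⟨x.emb, x.strong⟩
    obtain ⟨A, _, e, -, he⟩ := H.fr_of_extendNF i hx
    exact ⟨lt_of_mk_le i.mk_le hx.2.2.1.2.2, A, inferInstance, e, he⟩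
  · rintro ⟨hM, A, _, e, he⟩
    obtain ⟨N, _, i, a, hN, rfl⟩ := H.exists_tp_small he.le p
    exact ⟨⟨N, i.emb, i.strong, a⟩, rfl, H.extendNF_of_fr i (lt_of_mk_le hN hM) he
      i.strong_range le_rfl fun z => ⟨e z, rfl⟩⟩

theorem extend_dnf_iff (H : Ctx K s lam θ) {p : K.GType M} {S : L.Substructure M} :
    (s.extend lam θ).DoesNotFork p S ↔ ((#M : Cardinal.{u}) : WithTop Cardinal.{u}) < θ ∧
      K.Strong S ∧
      ∃ (A : Type u) (_ : L.Structure A) (e : SEmb K A M), (∀ z, e z ∈ S) ∧ Fr s lam e p := by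
  constructor
  · rintro ⟨x, rfl, hx⟩
    let i : SEmb K M x.carrier := ⟨x.emb, x.strong⟩
    have hmem : ∀ z, i z ∈ S.map x.emb.toHom → z ∈ S := by
      rintro z ⟨w, hw, h⟩
      rwa [← i.injective h]
    obtain ⟨A, _, e, he, he'⟩ := H.fr_of_extendNF i hx
    refine ⟨lt_of_mk_le i.mk_le hx.2.2.1.2.2, ?_, A, inferInstance, e,
      fun z => hmem _ (he z), he'⟩
    have h1 := i.strong_comap (hx.2.2.2.1.strong hx.2.2.2.2.1) hx.2.2.2.1.1
    have h2 : (S.map x.emb.toHom).comap i.emb.toHom = S := by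
      ext z
      exact ⟨hmem z, fun hz => ⟨z, hz, rfl⟩⟩
    rwa [h2] at h1
  · rintro ⟨hM, hS, A, _, e, he, he'⟩
    obtain ⟨N, _, i, a, hN, rfl⟩ := H.exists_tp_small he'.le p
    exact ⟨⟨N, i.emb, i.strong, a⟩, rfl, H.extendNF_of_fr i (lt_of_mk_le hN hM) he'
      (i.strong_map hS) (fun _ ⟨w, _, hw⟩ => ⟨w, hw⟩) fun z => ⟨e z, he z, rfl⟩⟩

/-- Uniqueness of free extensions, with different bases in a common submodel. -/
theorem Fr.uniq_of_comp (H : Ctx K s lam θ) (j : SEmb K Y X)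
    (hX : ((#X : Cardinal.{u}) : WithTop Cardinal.{u}) < θ) {e : SEmb K A Y} {e' : SEmb K B Y}
    {p q : K.GType X} (hp : Fr s lam (j.comp e) p) (hq : Fr s lam (j.comp e') q)
    (h : p.pull j = q.pull j) : p = q := by
  obtain ⟨D, _, m, d, d', hD, rfl, rfl, -⟩ := H.exists_common e e' hp.1.le hq.1.le
    (hp.1 ▸ e.mk_le) ∅ (by simp)
  refine Fr.uniq H hX (e := j.comp m) (Fr.base H (c := d) hp hD) (Fr.base H (c := d') hq hD) ?_
  rw [← GType.pull_pull, h, GType.pull_pull]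

theorem Fr.inF {e : SEmb K A X} {p : K.GType X} (h : Fr s lam e p)
    (hX : ((#X : Cardinal.{u}) : WithTop Cardinal.{u}) < θ) : K.InF lam θ X :=
  ⟨e.mem_right, h.le, hX⟩

/-! ### The axioms of a pre-frame -/

/-- Monotonicity of the extended nonforking relation, along an embedding of the ambient model. -/
theorem extendNF_map (H : Ctx K s lam θ) (j : SEmb K N X)
    (hX : ((#X : Cardinal.{u}) : WithTop Cardinal.{u}) < θ) {S S' T' T : L.Substructure N} {a : N}
    (h : s.extendNF lam θ S T a) (hS : S ≤ S') (hS' : K.Strong S') (hST : S' ≤ T')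
    (hT' : K.Strong T') (hT : T' ≤ T) :
    s.extendNF lam θ (S'.map j.emb.toHom) (T'.map j.emb.toHom) (j a) := by
  obtain ⟨-, -, -, hTs, A, _, e, he, hfr⟩ := H.extendNF_iff.1 h
  let e' : SEmb K A T' := ((SEmb.ofSub hTs).comp e).lift hT' fun z => hST (hS (he z))
  have h1 : Fr s lam e' ((SEmb.ofSub hT').tp a) :=
    hfr.of_le (SEmb.ofSub hT') (fun z => ⟨⟨z, hT z.2⟩, rfl⟩) _ fun z => rfl
  rw [← SEmb.tp_comp j] at h1
  have h2 := H.extendNF_of_fr (j.comp (SEmb.ofSub hT')) hX h1 (j.strong_map hS')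
    (by
      rintro _ ⟨z, hz, rfl⟩
      exact ⟨⟨z, hST hz⟩, rfl⟩) fun z => ⟨_, hS (he z), rfl⟩
  rwa [SEmb.range_comp, SEmb.range_ofSub] at h2

theorem extend_isPreFrame (H : Ctx K s lam θ) : (s.extend lam θ).IsPreFrame lam θ where
  LS_le := H.LS_le
  exists_model := H.good.exists_model
  bs_dom M _ p hp := by
    obtain ⟨hM, A, _, e, he⟩ := H.mem_extend_bs_iff.1 hp
    refine ⟨he.inF hM, ?_⟩
    obtain ⟨N, _, i, a, rfl⟩ := p.exists_tp
    exact ⟨⟨N, i.emb, i.strong, a⟩, rfl, Fr.not_mem H he⟩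
  nf_dom M₀ M₁ a h := ⟨h.1, h.2.1, h.2.2.1, h.2.2.2.1, h.2.2.2.2.1⟩
  nf_iso := fun {N N'} _ _ f M₀ M₁ a h => by
    have hN : K.Mem N := h.2.2.1.1
    have h1 : K.Strong M₁ := h.2.2.2.2.1
    refine H.extendNF_map (SEmb.ofEquiv f hN) (lt_of_mk_le ?_ h.2.2.1.2.2) h le_rfl
      (h.2.2.2.1.strong h1) h.2.2.2.1.1 h1 le_rfl
    exact (Cardinal.mk_congr f.toEquiv).ge
  bs_iso := fun {M M' N N'} _ _ _ _ i hi i' hi' g f hfg a h => by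
    obtain ⟨hM, A, _, e, he⟩ := H.mem_extend_bs_iff.1 h
    let i₀ : SEmb K M N := ⟨i, hi⟩
    let i₀' : SEmb K M' N' := ⟨i', hi'⟩
    let k := SEmb.ofEquiv g.symm i₀'.mem_left
    obtain ⟨e', rfl⟩ := SEmb.exists_factor k e fun x => ⟨g (e x), g.symm_apply_apply _⟩
    refine H.mem_extend_bs_iff.2 ⟨lt_of_mk_le (Cardinal.mk_congr g.toEquiv).ge hM, A,
      inferInstance, e', ?_⟩
    have h1 : i₀'.tp (f a) = (i₀.tp a).pull k := by
      refine SEmb.tp_eq_of_comp (SEmb.ofEquiv f i₀.mem_right) (i₀.comp k) i₀'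
        (SEmb.ext fun z => ?_) a
      change f (i (g.symm z)) = i' z
      rw [hfg, g.apply_symm_apply]
    change Fr s lam e' (i₀'.tp (f a))
    rw [h1]
    exact he.pull
  mono_down M₀ M₀' M₁' M₁ N' a h h0 h01 h1 hN' hNs ha := by
    obtain ⟨hN, -, -, hTs, A, _, e, he, hfr⟩ := H.extendNF_iff.1 h
    have hM₁' := h1.strong hTs
    have hM₀' := h01.strong hM₁'
    have hle : M₁' ≤ N' := h1.1.trans hN'.1
    let i := SEmb.incl hle hM₁' hNs
    let e' : SEmb K A M₁' := ((SEmb.ofSub hTs).comp e).lift hM₁' fun z => h01.1 (h0.1 (he z))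
    have h2 : Fr s lam e' ((SEmb.ofSub hM₁').tp a) :=
      hfr.of_le (SEmb.ofSub hM₁') (fun z => ⟨⟨z, h1.1 z.2⟩, rfl⟩) _ fun z => rfl
    have h3 : (SEmb.ofSub hM₁').tp a = i.tp ⟨a, ha⟩ :=
      SEmb.tp_eq_of_comp (SEmb.ofSub hNs) i (SEmb.ofSub hM₁') rfl (⟨a, ha⟩ : N')
    rw [h3] at h2
    have hr : i.range = M₁'.comap N'.subtype.toHom := by
      ext z
      exact ⟨fun ⟨w, hw⟩ => hw ▸ w.2, fun hz => ⟨⟨z, hz⟩, rfl⟩⟩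
    have h4 := H.extendNF_of_fr i (lt_of_mk_le (Cardinal.mk_subtype_le _) hN) h2
      (S := M₀'.comap N'.subtype.toHom)
      ((SEmb.ofSub hNs).strong_comap hM₀' (by
        rw [SEmb.range_ofSub]
        exact h01.1.trans hle)) (fun z hz => ⟨⟨z, h01.1 hz⟩, rfl⟩) fun z => h0.1 (he z)
    rwa [hr] at h4
  mono_up M₀ M₀' M₁' M₁ a j h h0 h01 h1 hj hN := by
    have hM₁' := h1.strong h.2.2.2.2.1
    exact H.extendNF_map ⟨j, hj⟩ hN.2.2 h h0.1 (h01.strong hM₁') h01.1 hM₁' h1.1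
  bs_of_nf M hM a h := by
    obtain ⟨hN, -, -, _, A, _, e, -, he⟩ := H.extendNF_iff.1 h
    exact H.mem_extend_bs_iff.2 ⟨lt_of_mk_le (Cardinal.mk_subtype_le _) hN, A, inferInstance, e, he⟩

end

end Ctx

/-! ### Joint embedding, no maximal models, stability, symmetry -/

namespace Ctx

variable {s : K.Frame} {lam : Cardinal.{u}} {θ : WithTop Cardinal.{u}}

section

variable {A B M N X Y : Type u} [L.Structure A] [L.Structure B] [L.Structure M] [L.Structure N]
  [L.Structure X] [L.Structure Y]

theorem jointEmbedding (H : Ctx K s lam θ) : K.JointEmbedding lam θ := by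
  intro M₁ M₂ _ _ h₁ h₂
  obtain ⟨A₁, _, a₁, hA₁, -⟩ := SEmb.exists_small h₁.1 H.LS_le ∅ (by simp) h₁.2.1
  obtain ⟨A₂, _, a₂, hA₂, -⟩ := SEmb.exists_small h₂.1 H.LS_le ∅ (by simp) h₂.2.1
  obtain ⟨B, _, b₁, b₂, hB, hb₁, hb₂⟩ := H.good.jointEmbedding A₁ A₂
    (inF_succ_iff.2 ⟨a₁.mem_left, hA₁⟩) (inF_succ_iff.2 ⟨a₂.mem_left, hA₂⟩)
  have hκ : ((max #M₁ #M₂ : Cardinal.{u}) : WithTop Cardinal.{u}) < θ := by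
    rcases max_choice #M₁ #M₂ with h | h <;> rw [h]
    exacts [h₁.2.2, h₂.2.2]
  obtain ⟨W₁, _, g₁, k₁, hW₁, -⟩ := H.amalg hκ a₁ ⟨b₁, hb₁⟩ hA₁.ge (le_max_left _ _)
    ((inF_succ_iff.1 hB).2.le.trans (h₁.2.1.trans (le_max_left _ _)))
  obtain ⟨W₂, _, g₂, k₂, hW₂, -⟩ := H.amalg hκ (k₁.comp ⟨b₂, hb₂⟩) a₂ hA₂.ge hW₁ (le_max_right _ _)
  exact ⟨W₂, inferInstance, (g₂.comp g₁).emb, k₂.emb, ⟨k₂.mem_right, h₂.2.1.trans k₂.mk_le,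
    (WithTop.coe_le_coe.2 hW₂).trans_lt hκ⟩, (g₂.comp g₁).strong, k₂.strong⟩

theorem exists_mem_bs (H : Ctx K s lam θ) (hA : K.Mem A) (hAc : #A = lam) : ∃ p, p ∈ s.bs A := by
  obtain ⟨N, _, g, hN, hg, hgs⟩ := H.good.noMaximalModels A (inF_succ_iff.2 ⟨hA, hAc⟩)
  let g₀ : SEmb K A N := ⟨g, hg⟩
  obtain ⟨a, ha⟩ := H.good.density g₀.range g₀.strong_range
    (inF_succ_iff.2 ⟨g₀.strong_range.mem, g₀.mk_range.trans hAc⟩) hN fun h => hgs fun y => by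
      have h1 : y ∈ g₀.range := h ▸ trivial
      exact h1
  exact ⟨_, H.bs_pull_of_surjective ha (g₀.lift g₀.strong_range fun x => ⟨x, rfl⟩)
    fun ⟨_, x, hx⟩ => ⟨x, Subtype.ext hx⟩⟩

/-- A model has a free extension by an element realizing the free extension of a basic type over a
submodel of size `lam`. -/
theorem noMaximalModels (H : Ctx K s lam θ) : K.NoMaximalModels lam θ := by
  intro M _ hM
  obtain ⟨A, _, e, hA, -⟩ := SEmb.exists_small hM.1 H.LS_le ∅ (by simp) hM.2.1
  obtain ⟨p, hp⟩ := H.exists_mem_bs e.mem_left hA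
  obtain ⟨q, hq, -⟩ := H.exists_fr hp hA e hM.2.2
  obtain ⟨N, _, i, a, hN, rfl⟩ := H.exists_tp_small hM.2.1 q
  exact ⟨N, inferInstance, i.emb, ⟨i.mem_right, hM.2.1.trans i.mk_le, lt_of_mk_le hN hM.2.2⟩,
    i.strong, fun h => Fr.not_mem H hq (h a)⟩

theorem mk_extend_bs_le (H : Ctx K s lam θ) (hM : K.InF lam θ M) :
    #((s.extend lam θ).bs M) ≤ Cardinal.lift.{u + 1} #M := by
  induction hc : #M using WellFoundedLT.induction generalizing M with
  | ind c ih =>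
  subst hc
  rcases hM.2.1.eq_or_lt with hlam | hlam
  · refine le_trans (Cardinal.mk_le_mk_of_subset fun p hp => ?_)
      (H.good.bs_stability M (inF_succ_iff.2 ⟨hM.1, hlam.symm⟩))
    obtain ⟨-, A, _, e, he⟩ := H.mem_extend_bs_iff.1 hp
    exact H.dnf_bs e ((fr_iff H he.1 hlam.symm).1 he)
  obtain ⟨C, hC, -, hCs, -, hCc, hCl, -⟩ := exists_filtration hM.1 H.LS_le hlam
    (fun _ => ∅) (fun _ => by simp) ∅ (by simp) (fun _ => ∅) (fun _ _ _ _ => by simp)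
  -- a basic type is determined by its restriction to a member of the chain containing a base
  have key : ∀ p : (s.extend lam θ).bs M, ∃ x : Σ i : (#M).ord.ToType,
      (s.extend lam θ).bs (C (Ordinal.ToType.mk.symm i)), ∃ (A : Type u) (_ : L.Structure A)
        (e : SEmb K A (C (Ordinal.ToType.mk.symm x.1))), x.2.1 = p.1.pull (SEmb.ofSub (hCs _)) ∧
        Fr s lam ((SEmb.ofSub (hCs _)).comp e) p.1 := by
    rintro ⟨p, hp⟩
    obtain ⟨-, A, _, e, he⟩ := H.mem_extend_bs_iff.1 hp
    obtain ⟨i, hi, B, _, e', he'⟩ := Fr.exists_base_in_chain H hC (hCl 0) he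
    obtain ⟨t, rfl⟩ : ∃ t : (#M).ord.ToType, (Ordinal.ToType.mk.symm t : Ordinal.{u}) = i :=
      ⟨Ordinal.ToType.mk ⟨i, hi⟩, by simp⟩
    exact ⟨⟨t, p.pull (SEmb.ofSub (hCs _)), H.mem_extend_bs_iff.2
      ⟨lt_of_mk_le (Cardinal.mk_subtype_le _) hM.2.2, B, inferInstance, e', he'.pull⟩⟩,
      B, inferInstance, e', rfl, he'⟩
  choose x A _ e hx he using key
  have hinj : Function.Injective x := by
    intro p q hpq
    have h1 := hx p
    have h2 := he p
    have h3 : ∀ y, y = x q → y.2.1 = p.1.pull (SEmb.ofSub (hCs (Ordinal.ToType.mk.symm y.1))) →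
        ∀ e : SEmb K (A p) (C (Ordinal.ToType.mk.symm y.1)),
        Fr s lam ((SEmb.ofSub (hCs _)).comp e) p.1 → p.1 = q.1 := by
      rintro _ rfl h4 e' h5
      exact Fr.uniq_of_comp H _ hM.2.2 h5 (he q) (h4.symm.trans (hx q))
    exact Subtype.ext (h3 _ hpq h1 (e p) h2)
  refine (Cardinal.mk_le_of_injective hinj).trans ?_
  rw [Cardinal.mk_sigma]
  have h1 : ∀ i : (#M).ord.ToType, #((s.extend lam θ).bs (C (Ordinal.ToType.mk.symm i))) ≤
      Cardinal.lift.{u + 1} #M := fun i => by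
    have hi := hCc (Ordinal.ToType.mk.symm i).1 (Ordinal.ToType.mk.symm i).2
    refine (ih _ hi ⟨(hCs _).mem, hCl _, lt_of_mk_le hi.le hM.2.2⟩ rfl).trans ?_
    exact Cardinal.lift_le.2 hi.le
  refine (Cardinal.sum_le_sum _ _ h1).trans ?_
  have hinf : ℵ₀ ≤ #M := H.aleph0_le.trans hlam.le
  rw [Cardinal.sum_const, Cardinal.mk_toType, Cardinal.card_ord, Cardinal.lift_lift,
    ← Cardinal.lift_mul, Cardinal.mul_eq_self hinf]

theorem extend_symmetry (H : Ctx K s lam θ) {M₀ M₂ : L.Substructure N} (hM₀ : K.Strong M₀)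
    {a₁ a₂ : N} (h : s.extendNF lam θ M₀ M₂ a₁) (ha₂ : a₂ ∈ M₂)
    (hb : (SEmb.ofSub hM₀).tp a₂ ∈ (s.extend lam θ).bs M₀) :
    ∃ (N' : Type u) (_ : L.Structure N') (j : SEmb K N N') (M₁ : L.Substructure N'),
      j a₁ ∈ M₁ ∧ s.extendNF lam θ (M₀.map j.emb.toHom) M₁ (j a₂) := by
  obtain ⟨hN, h02, -, hM₂, A, _, e, he, hfr⟩ := H.extendNF_iff.1 h
  obtain ⟨hM₀θ, A', _, e', hfr'⟩ := H.mem_extend_bs_iff.1 hb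
  have hinf : ℵ₀ ≤ #M₀ := H.aleph0_le.trans hfr'.le
  have h1 : ∀ x : N, #({x} : Set N) ≤ #M₀ := fun x => by
    rw [Cardinal.mk_singleton]
    exact Cardinal.one_le_aleph0.trans hinf
  -- models of the size of `M₀` containing the relevant elements
  let D : Set M₂ := {z | (z : N) ∈ M₀ ∨ (z : N) = a₂}
  have hD : #D ≤ #M₀ := by
    refine le_trans ?_ (mk_union_le_of_le (A := (M₀ : Set N)) hinf le_rfl (h1 a₂))
    exact Cardinal.mk_le_of_injective
      (f := fun z : D => (⟨z.1.1, z.2⟩ : ((M₀ : Set N) ∪ {a₂} : Set N)))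
      fun x y hxy => by
        have h2 := congrArg Subtype.val hxy
        exact Subtype.ext (Subtype.ext h2)
  obtain ⟨P, hP, hPs, hPc⟩ := exists_strong_le hM₂.mem (H.LS_le.trans hfr'.le) D hD
  let p : SEmb K P N := (SEmb.ofSub hM₂).comp (SEmb.ofSub hPs)
  obtain ⟨N₁, hN₁, hN₁s, hN₁c⟩ := exists_strong_le p.mem_right (H.LS_le.trans hfr'.le)
    ((p.range : Set N) ∪ {a₁}) (mk_union_le_of_le hinf (p.mk_range.le.trans hPc) (h1 a₁))
  let y : SEmb K P N₁ := p.lift hN₁s fun z => hN₁ (Or.inl ⟨z, rfl⟩)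
  let x₂ : SEmb K M₀ M₂ := SEmb.incl h02 hM₀ hM₂
  let x : SEmb K M₀ P := x₂.lift hPs fun z => hP (Or.inl z.2)
  let e₀ : SEmb K A M₀ := ((SEmb.ofSub hM₂).comp e).lift hM₀ he
  let b : N₁ := ⟨a₁, hN₁ (Or.inr rfl)⟩
  let a : P := ⟨⟨a₂, ha₂⟩, hP (Or.inr rfl)⟩
  have hfb : Fr s lam (x.comp e₀) (y.tp b) := by
    have h2 : y.tp b = p.tp a₁ := (SEmb.tp_comp (SEmb.ofSub hN₁s) y b).symm
    rw [h2]
    exact hfr.of_le p (fun z => ⟨z.1, rfl⟩) _ fun z => rfl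
  have hfa : Fr s lam e' (x.tp a) := by
    have h2 : (SEmb.ofSub hM₀).tp a₂ = x.tp a := SEmb.tp_eq_of_comp p x (SEmb.ofSub hM₀) rfl a
    exact h2 ▸ hfr'
  obtain ⟨N', R, _, _, g, r, x', b', hN', h2, h3, h4⟩ := H.symAt #M₀ hfr'.le hM₀θ A A' M₀ P N₁ e₀
    e' x y b a le_rfl hN₁c hfb hfa
  have hM₀N : #M₀ ≤ #N := Cardinal.mk_subtype_le _
  obtain ⟨W, _, j, k, hW, h5⟩ := H.amalg hN (SEmb.ofSub hN₁s) g
    (hfr'.le.trans (y.comp x).mk_le) le_rfl (hN'.trans hM₀N)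
  have h6 : j a₂ = k (g (y a)) := h5 (y a)
  refine ⟨W, inferInstance, j, (k.comp r).range, ⟨b', ?_⟩, ?_⟩
  · exact (congrArg k h3).trans (h5 b).symm
  have h7 : r.tp (g (y a)) = (k.comp r).tp (j a₂) := by
    rw [h6]
    exact (SEmb.tp_comp k r _).symm
  rw [h7] at h4
  have h8 : ∀ z : M₀, j z = k (r (x' z)) := fun z =>
    (h5 (y (x z))).trans (congrArg k (h2 z).symm)
  refine H.extendNF_of_fr (k.comp r) ((WithTop.coe_le_coe.2 hW).trans_lt hN) h4 (j.strong_map hM₀)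
    ?_ fun z => ⟨_, (e' z).2, h8 _⟩
  rintro _ ⟨z, hz, rfl⟩
  exact ⟨x' ⟨z, hz⟩, (h8 ⟨z, hz⟩).symm⟩

end

end Ctx

/-! ### Existence of limits of chains of basic types -/

namespace Ctx

variable {s : K.Frame} {lam : Cardinal.{u}} {θ : WithTop Cardinal.{u}}

section

variable {N : Type u} [L.Structure N] {δ : Ordinal.{u}} {C : Ordinal.{u} → L.Substructure N}

theorem chain_of_isChain (hδ : Order.IsSuccLimit δ) (hC : K.IsChain lam θ δ C) : Chain K δ C where
  lim := hδ
  strong i hi := hC.strong i hi.le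
  mono i j hij hj := hC.mono i j hij hj.le
  cont i hi hl x hx := by
    have h : x ∈ (C i : Set N) := hx
    rw [hC.cont i hi.le hl, Set.mem_iUnion₂] at h
    obtain ⟨j, hj, h⟩ := h
    exact ⟨j, hj, h⟩
  top x := by
    have h : x ∈ (C δ : Set N) := hC.last ▸ trivial
    rw [hC.cont δ le_rfl hδ, Set.mem_iUnion₂] at h
    obtain ⟨j, hj, h⟩ := h
    exact ⟨j, hj, h⟩

/-- The free types in a coherent sequence, over the members of a chain of length `ω`, cannot all
have their bases outside the previous member of the chain: a model of size `lam` that contains all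
the bases inherits a coherent sequence of basic types, which has a basic limit, and local character
applies to the limit. -/
theorem exists_base_in_previous (H : Ctx K s lam θ) {C : Ordinal.{u} → L.Substructure N}
    (hC : Chain K Ordinal.omega0.{u} C) (hCs : ∀ i, K.Strong (C i)) (p : ∀ i, K.GType (C i))
    (hcoh : ∀ j i (hji : j ≤ i) (hi : i < Ordinal.omega0.{u}),
      (p i).pull (SEmb.incl (hC.mono j i hji hi) (hCs j) (hCs i)) = p j)
    (hp : ∀ i, ∃ (A : Type u) (_ : L.Structure A) (e : SEmb K A (C i)), Fr s lam e (p i)) :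
    ∃ i < Ordinal.omega0.{u}, ∃ (B : Type u) (_ : L.Structure B)
      (e : SEmb K B (C (Order.succ i))), (∀ z, (e z : N) ∈ C i) ∧
        Fr s lam e (p (Order.succ i)) := by
  have hω : Order.IsSuccLimit Ordinal.omega0.{u} := Ordinal.isSuccLimit_omega0
  choose A _ e he using hp
  obtain ⟨Y, _, y, C', hY, hDy, hst, hch, hmem⟩ := H.exists_small_chain hC (he 0).le
    (⋃ i : Set.Iio Ordinal.omega0.{u}, Set.range ((SEmb.ofSub (hCs i.1)).comp (e i.1)))
    (mk_biUnion_ordinal_le H.aleph0_le (by rw [Ordinal.card_omega0]; exact H.aleph0_le) _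
      fun i => Cardinal.mk_range_le.trans (he _).1.le)
  have hcard : ∀ i ≤ Ordinal.omega0.{u}, #(C' i) = lam := fun i hi =>
    (inF_succ_iff.1 (hch.inF i hi)).2
  let c : ∀ i, i < Ordinal.omega0.{u} → SEmb K (C' i) (C i) := fun i hi =>
    (y.comp (SEmb.ofSub (hst i))).lift (hCs i) fun z => (hmem i hi _).1 z.2
  have hbase : ∀ i (hi : i < Ordinal.omega0.{u}), Fr s lam (c i hi) (p i) := fun i hi => by
    obtain ⟨k, hk⟩ := SEmb.exists_factor y ((SEmb.ofSub (hCs i)).comp (e i)) fun x =>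
      hDy _ (Set.mem_iUnion.2 ⟨⟨i, hi⟩, x, rfl⟩)
    have hk' : ∀ x, y (k x) = (e i x : N) := fun x => DFunLike.congr_fun hk x
    refine Fr.base H (c := k.lift (hst i) fun x => (hmem i hi _).2 ?_) ?_ (hcard i hi.le)
    · rw [hk']
      exact (e i x).2
    · have h1 : (c i hi).comp (k.lift (hst i) fun x => (hmem i hi _).2 (by
          rw [hk']
          exact (e i x).2)) = e i := SEmb.ext fun x => Subtype.ext (hk' x)
      rw [h1]
      exact he i
  have hne : Nonempty Y := by
    rw [← Cardinal.mk_ne_zero_iff, hY]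
    exact (Cardinal.aleph0_pos.trans_le H.aleph0_le).ne'
  obtain ⟨p', hp'⟩ : ∃ p' : ∀ i, K.GType (C' i), ∀ i hi, p' i = (p i).pull (c i hi) := by
    classical
    refine ⟨fun i => if hi : i < Ordinal.omega0.{u} then (p i).pull (c i hi) else
      (SEmb.ofSub (hst i)).tp hne.some, fun i hi => dif_pos hi⟩
  obtain ⟨⟨q, hq, hqp⟩, -⟩ := H.good.continuity _ hω C' hch p' (fun i hi => by
      rw [hp' i hi]
      exact Fr.bs H (hbase i hi)) fun i j hji hi => by
    change (p' i).pull (SEmb.incl (hch.mono j i hji.le hi.le) (hst j) (hst i)) = p' j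
    rw [hp' i hi, hp' j (hji.trans hi), ← hcoh j i hji.le hi, GType.pull_pull, GType.pull_pull]
    rfl
  obtain ⟨i, hi, hdnf⟩ := H.good.localCharacter _ hω C' hch q hq
  have hi' := hω.succ_lt hi
  have hle := Order.le_succ i
  have hle' := hch.mono i _ hle hi'.le
  have h1 : q.pull (SEmb.ofSub (hst (Order.succ i))) = p' (Order.succ i) := hqp _ hi'
  have h2 := H.dnf_mono (p := q) (SEmb.ofSub (hst i)) (SEmb.refl (hst i).mem)
    (SEmb.incl hle' (hst i) (hst _)) (SEmb.ofSub (hst (Order.succ i))) (fun _ => rfl)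
    (by rwa [SEmb.range_ofSub])
  rw [h1, hp' _ hi', ← fr_iff H (hcard i hi.le) (hcard _ hi'.le)] at h2
  refine ⟨i, hi, C' i, inferInstance, (c _ hi').comp (SEmb.incl hle' (hst i) (hst _)),
    fun z => (hmem i hi _).1 z.2, ?_⟩
  exact Fr.trans H (e' := SEmb.refl (hst _).mem) (by
    rw [SEmb.comp_refl]
    exact hbase _ hi') h2

/-- In a coherent sequence of free types, all types have a base in one member of the chain. -/
theorem exists_uniform_base (H : Ctx K s lam θ) (hC : Chain K δ C) (p : ∀ i, K.GType (C i))
    (hcoh : ∀ j i (hji : j ≤ i) (hi : i < δ),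
      (p i).pull (SEmb.incl (hC.mono j i hji hi) (hC.strong j (hji.trans_lt hi))
        (hC.strong i hi)) = p j)
    (hp : ∀ i < δ, ∃ (A : Type u) (_ : L.Structure A) (e : SEmb K A (C i)), Fr s lam e (p i)) :
    ∃ j < δ, ∀ i, j ≤ i → i < δ → ∃ (B : Type u) (_ : L.Structure B) (e : SEmb K B (C i)),
      (∀ z, (e z : N) ∈ C j) ∧ Fr s lam e (p i) := by
  by_contra! hcon
  choose! f hjf hf hnot using hcon
  -- a sequence of indices, indexed by ordinals below `ω`
  let g : ℕ → Ordinal.{u} := fun n => f^[n] 0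
  have hg : ∀ n, g n < δ := fun n => by
    induction n with
    | zero => exact hC.lim.bot_lt
    | succ n ih =>
      change f^[n + 1] 0 < δ
      rw [Function.iterate_succ_apply']
      exact hf _ ih
  have hgs : ∀ n, g (n + 1) = f (g n) := fun n => Function.iterate_succ_apply' f n 0
  have hgm : Monotone g := monotone_nat_of_le_succ fun n => by
    rw [hgs]
    exact hjf _ (hg n)
  let k : Ordinal.{u} → Ordinal.{u} := fun i => g (Cardinal.toNat i.card)
  have hk : ∀ i, k i < δ := fun i => hg _
  have hks : ∀ i < Ordinal.omega0.{u}, k (Order.succ i) = f (k i) := fun i hi => by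
    obtain ⟨n, rfl⟩ := Ordinal.lt_omega0.1 hi
    have h1 : Order.succ (n : Ordinal.{u}) = ((n + 1 : ℕ) : Ordinal.{u}) := by
      push_cast
      rfl
    simp only [k, h1, Ordinal.card_nat, Cardinal.toNat_natCast, hgs]
  have hkm : ∀ i j, i ≤ j → j < Ordinal.omega0.{u} → k i ≤ k j := fun i j hij hj => by
    obtain ⟨m, rfl⟩ := Ordinal.lt_omega0.1 hj
    obtain ⟨n, rfl⟩ := Ordinal.lt_omega0.1 (hij.trans_lt hj)
    simp only [k, Ordinal.card_nat, Cardinal.toNat_natCast]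
    exact hgm (by exact_mod_cast hij)
  have hCk : ∀ i j, i ≤ j → j < Ordinal.omega0.{u} → C (k i) ≤ C (k j) := fun i j hij hj =>
    hC.mono _ _ (hkm i j hij hj) (hk j)
  have hω : Order.IsSuccLimit Ordinal.omega0.{u} := Ordinal.isSuccLimit_omega0
  -- the union of the corresponding members of the chain
  let T : L.Substructure N := ⨆ n, C (g n)
  have hT : ∀ x, x ∈ T ↔ ∃ i < Ordinal.omega0.{u}, x ∈ C (k i) := fun x => by
    rw [FirstOrder.Language.Substructure.mem_iSup_of_directed
      (Monotone.directed_le fun m n h => hC.mono _ _ (hgm h) (hg n))]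
    constructor
    · rintro ⟨n, hn⟩
      refine ⟨n, Ordinal.natCast_lt_omega0 n, ?_⟩
      simpa only [k, Ordinal.card_nat, Cardinal.toNat_natCast] using hn
    · rintro ⟨i, -, hi⟩
      exact ⟨_, hi⟩
  have hTs : K.Strong T := strong_iUnion_chain hω (fun i => C (k i)) (fun i _ => hC.strong _ (hk i))
    hCk T (by
      ext x
      rw [Set.mem_iUnion₂]
      exact (hT x).trans ⟨fun ⟨i, hi, h⟩ => ⟨i, hi, h⟩, fun ⟨i, hi, h⟩ => ⟨i, hi, h⟩⟩)
  have hle : ∀ i, C (k i) ≤ T := fun i =>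
    le_iSup (fun n => C (g n)) (Cardinal.toNat i.card)
  let D : Ordinal.{u} → L.Substructure T := fun i => (C (k i)).comap T.subtype.toHom
  have hDs : ∀ i, K.Strong (D i) := fun i =>
    (SEmb.ofSub hTs).strong_comap (hC.strong _ (hk i)) (by rw [SEmb.range_ofSub]; exact hle i)
  have hD : Chain K Ordinal.omega0.{u} D := ⟨hω, fun i _ => hDs i, fun i j hij hj z hz =>
    hCk i j hij hj hz, fun i hi hl => absurd hi (not_lt.2 (Ordinal.omega0_le_of_isSuccLimit hl)),
    fun x => (hT x).1 x.2⟩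
  let d : ∀ i, SEmb K (D i) (C (k i)) := fun i =>
    ((SEmb.ofSub hTs).comp (SEmb.ofSub (hDs i))).lift (hC.strong _ (hk i)) fun z => z.2
  have hds : ∀ i, Function.Surjective (d i) := fun i z => ⟨⟨⟨z, hle i z.2⟩, z.2⟩, rfl⟩
  obtain ⟨i, hi, B, _, e, he, hfr⟩ := H.exists_base_in_previous hD hDs
    (fun i => (p (k i)).pull (d i)) (fun j i hji hi => by
      rw [← hcoh _ _ (hkm j i hji hi) (hk i), GType.pull_pull, GType.pull_pull]
      rfl) fun i => by
    obtain ⟨A, _, e, he⟩ := hp _ (hk i)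
    obtain ⟨e', rfl⟩ := SEmb.exists_factor (d i) e fun x => hds i _
    exact ⟨A, inferInstance, e', he.pull⟩
  have hfr' : Fr s lam ((d _).comp e) (p (k (Order.succ i))) := by
    obtain ⟨r, hr, hr'⟩ := (d (Order.succ i)).exists_inverse (hds _)
    have h1 : (d (Order.succ i)).comp r = SEmb.refl (d (Order.succ i)).mem_right := SEmb.ext hr
    have h2 : ((p (k (Order.succ i))).pull (d _)).pull r = p (k (Order.succ i)) := by
      rw [GType.pull_pull, h1, GType.pull_refl]
    rw [← h2]
    refine Fr.pull ?_
    have h3 : r.comp ((d _).comp e) = e := SEmb.ext fun z => hr' _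
    rwa [h3]
  have key : ∀ j, j = f (k i) → ∀ e : SEmb K B (C j), (∀ z, (e z : N) ∈ C (k i)) →
      ¬ Fr s lam e (p j) := by
    rintro _ rfl e' he'
    exact hnot _ (hk i) B inferInstance e' he'
  exact key _ (hks i hi) ((d _).comp e) (fun z => he z) hfr'

/-- A coherent sequence of basic types over a chain has a basic limit: the free extension of the
restriction of the sequence to a common base. -/
theorem exists_limit_bs (H : Ctx K s lam θ)
    (hN : ((#N : Cardinal.{u}) : WithTop Cardinal.{u}) < θ) (hC : Chain K δ C)
    (p : ∀ i, K.GType (C i))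
    (hcoh : ∀ j i (hji : j ≤ i) (hi : i < δ),
      (p i).pull (SEmb.incl (hC.mono j i hji hi) (hC.strong j (hji.trans_lt hi))
        (hC.strong i hi)) = p j)
    (hp : ∀ i < δ, ∃ (A : Type u) (_ : L.Structure A) (e : SEmb K A (C i)), Fr s lam e (p i)) :
    ∃ (q : K.GType N) (A : Type u) (_ : L.Structure A) (e : SEmb K A N), Fr s lam e q ∧
      ∀ i (hi : i < δ), q.pull (SEmb.ofSub (hC.strong i hi)) = p i := by
  obtain ⟨j, hj, hu⟩ := H.exists_uniform_base hC p hcoh hp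
  obtain ⟨A, _, e, he⟩ := hp j hj
  have hlt : ∀ i, ((#(C i) : Cardinal.{u}) : WithTop Cardinal.{u}) < θ := fun i =>
    lt_of_mk_le (Cardinal.mk_subtype_le _) hN
  let m : ∀ i (hi : i < δ), SEmb K (C i) N := fun i hi => SEmb.ofSub (hC.strong i hi)
  obtain ⟨q, hq, hqe⟩ := H.exists_fr (he.bs H) he.1 ((m j hj).comp e) hN
  have hqj : q.pull (m j hj) = p j := Fr.uniq H (hlt j) hq.pull he (by
    rw [GType.pull_pull]
    exact hqe)
  refine ⟨q, A, inferInstance, _, hq, fun i hi => ?_⟩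
  rcases le_total j i with hji | hij
  · obtain ⟨B, _, e', he', hfr⟩ := hu i hji hi
    let r := SEmb.incl (hC.mono j i hji hi) (hC.strong j hj) (hC.strong i hi)
    obtain ⟨e'', rfl⟩ := SEmb.exists_factor r e' fun x => ⟨⟨e' x, he' x⟩, rfl⟩
    have h1 : Fr s lam (r.comp e) (q.pull (m i hi)) := Fr.pull (j := m i hi) hq
    refine Fr.uniq_of_comp H r (hlt i) h1 hfr ?_
    rw [hcoh j i hji hi, GType.pull_pull]
    exact hqj
  · rw [← hcoh i j hij hj, ← hqj, GType.pull_pull]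
    rfl

/-! ### The extended frame is good -/

theorem extend_isGood (H : Ctx K s lam θ) : (s.extend lam θ).IsGood lam θ where
  toIsPreFrame := H.extend_isPreFrame
  amalgamation := H.ap
  jointEmbedding := H.jointEmbedding
  noMaximalModels := H.noMaximalModels
  bs_stability M _ hM := H.mk_extend_bs_le hM
  density M hM hMF hN hne := by
    obtain ⟨a, A, _, e, he⟩ := H.exists_fr_of_not_surjective (SEmb.ofSub hM) hMF.2.1 fun h => by
      apply hne
      ext x
      obtain ⟨z, rfl⟩ := h x
      exact ⟨fun _ => trivial, fun _ => z.2⟩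
    exact ⟨a, H.mem_extend_bs_iff.2 ⟨hMF.2.2, A, inferInstance, e, he⟩⟩
  existence M hM hN p hp := by
    obtain ⟨hMθ, A, _, e, he⟩ := H.mem_extend_bs_iff.1 hp
    obtain ⟨q, hq, hqe⟩ := H.exists_fr (he.bs H) he.1 ((SEmb.ofSub hM).comp e) hN.2.2
    refine ⟨q, H.mem_extend_bs_iff.2 ⟨hN.2.2, A, inferInstance, _, hq⟩,
      H.extend_dnf_iff.2 ⟨hN.2.2, hM, A, inferInstance, _, fun z => (e z).2, hq⟩, ?_⟩
    exact Fr.uniq H hMθ hq.pull he ((GType.pull_pull q (SEmb.ofSub hM) e).trans hqe)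
  uniqueness M hM p q hp hq h := by
    obtain ⟨hN, -, A, _, e, he, hfr⟩ := H.extend_dnf_iff.1 hp
    obtain ⟨-, -, B, _, e', he', hfr'⟩ := H.extend_dnf_iff.1 hq
    obtain ⟨k, rfl⟩ := SEmb.exists_factor (SEmb.ofSub hM) e fun x => ⟨⟨e x, he x⟩, rfl⟩
    obtain ⟨k', rfl⟩ := SEmb.exists_factor (SEmb.ofSub hM) e' fun x => ⟨⟨e' x, he' x⟩, rfl⟩
    exact Fr.uniq_of_comp H _ hN hfr hfr' h
  symmetry M₀ M₂ hM₀ a₁ a₂ h ha₂ hb := by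
    obtain ⟨N', _, j, M₁, h1, h2⟩ := H.extend_symmetry hM₀ h ha₂ hb
    exact ⟨N', inferInstance, j.emb, M₁, j.strong, h1, h2⟩
  localCharacter δ hδ C hC p hp := by
    obtain ⟨hN, A, _, e, he⟩ := H.mem_extend_bs_iff.1 hp
    obtain ⟨i, hi, B, _, e', he'⟩ := Fr.exists_base_in_chain H (chain_of_isChain hδ hC)
      (hC.inF 0 zero_le).2.1 he
    exact ⟨i, hi, H.extend_dnf_iff.2 ⟨hN, hC.strong i hi.le, B, inferInstance, _,
      fun z => (e' z).2, he'⟩⟩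
  continuity := fun {N} _ δ hδ C hC p hp hcoh => by
    have hch := chain_of_isChain hδ hC
    have hN : ((#N : Cardinal.{u}) : WithTop Cardinal.{u}) < θ := by
      have h1 := (hC.inF δ le_rfl).2.2
      rw [hC.last] at h1
      rwa [show #(⊤ : L.Substructure N) = #N from Cardinal.mk_univ] at h1
    have hcoh' : ∀ j i (hji : j ≤ i) (hi : i < δ), (p i).pull (SEmb.incl (hch.mono j i hji hi)
        (hch.strong j (hji.trans_lt hi)) (hch.strong i hi)) = p j := fun j i hji hi => by
      rcases hji.eq_or_lt with rfl | h
      · exact GType.pull_refl _ (hch.strong j hi).mem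
      · exact hcoh i j h hi
    refine ⟨?_, fun hfree q hq => ?_⟩
    · obtain ⟨q, A, _, e, he, hq⟩ := H.exists_limit_bs hN hch p hcoh' fun i hi =>
        (H.mem_extend_bs_iff.1 (hp i hi)).2
      exact ⟨q, H.mem_extend_bs_iff.2 ⟨hN, A, inferInstance, e, he⟩, hq⟩
    · have h0 := hδ.bot_lt
      obtain ⟨-, A, _, e, he⟩ := H.mem_extend_bs_iff.1 (hp 0 h0)
      refine H.extend_dnf_iff.2 ⟨hN, hch.strong 0 h0, A, inferInstance,
        (SEmb.ofSub (hch.strong 0 h0)).comp e, fun z => (e z).2,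
        Fr.of_chain H hch (fun z => (e z).2) fun i hi e' he' => ?_⟩
      have h1 : q.pull (SEmb.ofSub (hch.strong i hi)) = p i := hq i hi
      rw [h1]
      let r := SEmb.incl (hch.mono 0 i zero_le hi) (hch.strong 0 h0) (hch.strong i hi)
      have h2 : r.comp e = e' := SEmb.ext fun z => Subtype.ext (DFunLike.congr_fun he' z).symm
      obtain ⟨-, -, B, _, e₁, he₁, hfr⟩ := H.extend_dnf_iff.1 (hfree i hi)
      obtain ⟨e₂, rfl⟩ := SEmb.exists_factor r e₁ fun x => ⟨⟨e₁ x, he₁ x⟩, rfl⟩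
      rw [← h2]
      refine Fr.trans H hfr ?_
      rw [hcoh' 0 i zero_le hi]
      exact he
  transitivity M₀ M₁ hM₁ h01 p hp hp₁ := by
    obtain ⟨hN, -, B, _, e₁, he₁, hfr₁⟩ := H.extend_dnf_iff.1 hp
    obtain ⟨-, -, A, _, e, he, hfr⟩ := H.extend_dnf_iff.1 hp₁
    obtain ⟨k, rfl⟩ := SEmb.exists_factor (SEmb.ofSub hM₁) e₁ fun x => ⟨⟨e₁ x, he₁ x⟩, rfl⟩
    exact H.extend_dnf_iff.2 ⟨hN, h01.strong hM₁, A, inferInstance, (SEmb.ofSub hM₁).comp e, he,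
      Fr.trans H hfr₁ hfr⟩

end

end Ctx

end AEC

theorem corollary5p13 {L : FirstOrder.Language.{u, u}} (K : AEC.{u} L) (s : K.Frame)
    (lam : Cardinal.{u}) (θ : WithTop Cardinal.{u}) (hθ : (lam : WithTop Cardinal.{u}) < θ)
    (hs : s.IsGood lam ((Order.succ lam : Cardinal.{u}) : WithTop Cardinal.{u}))
    (hAP : K.Amalgamation lam θ) (hT : K.Tame lam θ) :
    (s.extend lam θ).IsGood lam θ :=
  AEC.Ctx.extend_isGood ⟨hθ, hs, hAP, hT⟩
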